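/- Let $q\ge 1$ be an integer and let $r,t\in\{0,1,\dots,q-1\}$ be coprime to $q$ (so $r=t=0$ if $q=1$, and $r,t\in\{1,\dots,q-1\}$ otherwise). Let $\alpha,\beta$ be non-zero real numbers and $s\ge 0$ a real number. Write $\langle\cdot,\cdot\rangle$ for the inner product of $L^2(\mathbb{R}\times\mathbb{Z}_q)$, linear in the first variable (Lebesgue times counting measure). **Time-frequency shifts.** For $\nu=(\lambda,l,\gamma,c)\in\mathbb{R}\times\mathbb{Z}_q\times\mathbb{R}\times\mathbb{Z}_q$ put $\pi(\nu)=E_{\gamma,c}T_{\lambda,l}$ and $\pi^\circ(\nu)=T_{\lambda,l}E_{\gamma,c}$, where $(T_{\lambda,l}f)(x,j)=f(x-\lambda,j-l)$ and $(E_{\gamma,c}f)(x,j)=e^{2\pi i(x\gamma+jc/q)}f(x,j)$. **Lattices.** Let $\Lambda=\{(\alpha n,\,rn \bmod q):n\in\mathbb{Z}\}$ and $\Gamma=\{(\beta m,\,tm \bmod q):m\in\mathbb{Z}\}$, and let $$\Lambda^\perp=\{(\xi,\tau)\in\mathbb{R}\times\mathbb{Z}_q: e^{2\pi i(\lambda\xi+l\tau/q)}=1\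 \text{for all}\ (\lambda,l)\in\Lambda\},$$ and similarly $\Gamma^\perp$. For $D=\Lambda\times\Gamma$ or $D=\Gamma^\perp\times\Lambda^\perp$ let $\ell^1_s(D)$ be the space of all $a:D\to\mathbb{C}$ with $\sum_{(\lambda,l,\gamma,c)\in D}|a(\lambda,l,\gamma,c)|(1+|\lambda|+|\gamma|)^s<\infty$. **Modulation space.** Fix any non-zero Schwartz function $w$ on $\mathbb{R}$. Let $M^1_s(\mathbb{R})$ be the space of all $f\in L^2(\mathbb{R})$ with $$\int_{\mathbb{R}^2}\Big|\int_{\mathbb{R}} f(y)\,\overline{e^{2\pi i y\omega}w(y-x)}\,dy\Big|\,(1+|x|+|\omega|)^s\,dx\,d\omega<\infty,$$ and let $M^1_s(\mathbb{R}\times\mathbb{Z}_q)$ be the space of all $f\in L^2(\mathbb{R}\times\mathbb{Z}_q)$ with $f(\cdot,k)\in M^1_s(\mathbb{R})$ for all $k\in\mathbb{Z}_q$. **Algebras.** Let $\mathcal{A}_s$ be the algebra of operators $\sum_{\nu\in\Lambda\times\Gamma}a(\nu)\pi(\nu)$ with $a\in\ell^1_s(\Lambda\times\Gamma)$, and let $\mathcal{A}_s^\circ$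 be the algebra of operators $\sum_{\nu\in\Gamma^\perp\times\Lambda^\perp}b(\nu)\pi^\circ(\nu)$ with $b\in\ell^1_s(\Gamma^\perp\times\Lambda^\perp)$, both with the $L^2$-adjoint as involution. They act on $M^1_s(\mathbb{R}\times\mathbb{Z}_q)$ by $T\cdot f=Tf$ for $T\in\mathcal{A}_s$ (from the left) and $f\cdot T=Tf$ for $T\in\mathcal{A}_s^\circ$ (from the right; the algebra acting from the right is thus $\mathcal{A}_s^\circ$ with the order of composition reversed). **Claim.** For all $f,g\in M^1_s(\mathbb{R}\times\mathbb{Z}_q)$ the coefficients below lie in $\ell^1_s(\Lambda\times\Gamma)$ and in $\ell^1_s(\Gamma^\perp\times\Lambda^\perp)$, respectively, and with the inner products $${}_\bullet\langle f,g\rangle=\sum_{\nu\in\Lambda\times\Gamma}\langle f,\pi(\nu)g\rangle\,\pi(\nu)\in\mathcal{A}_s,\qquad \langle f,g\rangle_\bullet=\frac{1}{q|\alpha\beta|}\sum_{\nu\in\Gamma^\perp\times\Lambda^\perp}\langle g,\pi^\circ(\nu)f\rangle\,\pi^\circ(\nu)\in\mathcal{A}_s^\circ$$ the following hold. 1. $M^1_s(\mathbb{R}\times\mathbb{Z}_q)$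 is an equivalence bimodule between $\mathcal{A}_s$ (left) and $\mathcal{A}_s^\circ$ (right) in the sense of Rieffel: the two actions are $\mathbb{C}$-linear and commute; both inner products are sesquilinear over the respective algebra, hermitian, positive and definite; each algebra acts by adjointable operators, bounded by the $L^2$-operator norm, for the inner product with values in the other algebra; ${}_\bullet\langle f,g\rangle\cdot h=f\cdot\langle g,h\rangle_\bullet$ for all $f,g,h$; and each inner product is full, that is, its values span the whole algebra. (Positivity is that of operators on $L^2(\mathbb{R}\times\mathbb{Z}_q)$.) 2. $\mathcal{A}_s$ and $\mathcal{A}_s^\circ$ are Morita equivalent: their categories of modules are equivalent as $\mathbb{C}$-linear categories. This holds for either order of multiplication on $\mathcal{A}_s^\circ$. 3. $M^1_s(\mathbb{R}\times\mathbb{Z}_q)$ is a finitely generated projective left $\mathcal{A}_s$-module. More precisely, there are finitely many $g_1,\dots,g_n\in M^1_s(\mathbb{R}\times\mathbb{Z}_q)$ such that every $f\in M^1_s(\mathbb{R}\times\mathbb{Z}_q)$ satisfies $$f={}_\bullet\langle f,g_1\rangle\cdot g_1+\dots+{}_\bullet\langle f,g_n\rangle\cdot g_n.$$ -/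

import Mathlib

open MeasureTheory
open scoped NNReal ENNReal FourierTransform SchwartzMap InnerProductSpace

noncomputable section

namespace GaborTorus

/-! ### The group `ℝ × ℤ_q` and its `L²`-space -/

/-- The group `ℝ × ℤ_q`. It is also used for its own dual group. -/
abbrev TimeGroup (q : ℕ) : Type := ℝ × ZMod q

/-- The time-frequency plane `(ℝ × ℤ_q) × (ℝ × ℤ_q)^`; a point is `((l, j), (γ, c))`. -/
abbrev Phase (q : ℕ) : Type := TimeGroup q × TimeGroup q

/-- Lebesgue measure times counting measure on `ℝ × ℤ_q`. -/
abbrev timeMeasure (q : ℕ) : Measure (TimeGroup q) :=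
  (volume : Measure ℝ).prod Measure.count

/-- The Hilbert space `L²(ℝ × ℤ_q)`. -/
abbrev L2 (q : ℕ) : Type := Lp ℂ 2 (timeMeasure q)

/-- The duality pairing `(x, j), (γ, c) ↦ exp (2πi (x γ + j c / q))`. -/
def pairing {q : ℕ} [NeZero q] (y ζ : TimeGroup q) : Circle :=
  𝐞 (y.1 * ζ.1) * ZMod.toCircle (y.2 * ζ.2)

section Basic

variable {q : ℕ}

lemma star_eq_of_isometry {S T : L2 q →L[ℂ] L2 q} (hS : ∀ f, ‖S f‖ = ‖f‖) (h : S * T = 1) :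
    star S = T := by
  have h1 : star S * S = 1 := S.norm_map_iff_adjoint_comp_self.1 hS
  calc star S = star S * (S * T) := by rw [h, mul_one]
    _ = T := by rw [← mul_assoc, h1, one_mul]

variable [NeZero q]

lemma pairing_add_left (y z ζ : TimeGroup q) :
    pairing (y + z) ζ = pairing y ζ * pairing z ζ := by
  simp only [pairing, Prod.fst_add, Prod.snd_add, add_mul, AddChar.map_add_eq_mul]
  exact mul_mul_mul_comm _ _ _ _

lemma pairing_add_right (y ζ ξ : TimeGroup q) :
    pairing y (ζ + ξ) = pairing y ζ * pairing y ξ := by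
  simp only [pairing, Prod.fst_add, Prod.snd_add, mul_add, AddChar.map_add_eq_mul]
  exact mul_mul_mul_comm _ _ _ _

@[simp] lemma pairing_zero_left (ζ : TimeGroup q) : pairing 0 ζ = 1 := by
  simp [pairing]

@[simp] lemma pairing_zero_right (y : TimeGroup q) : pairing y 0 = 1 := by
  simp [pairing]

lemma measurable_pairing (ζ : TimeGroup q) :
    Measurable fun y : TimeGroup q => (pairing y ζ : ℂ) := by
  have h1 : Measurable fun y : TimeGroup q => ((𝐞 (y.1 * ζ.1) : Circle) : ℂ) := by
    have : Continuous fun x : ℝ => ((𝐞 (x * ζ.1) : Circle) : ℂ) :=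
      continuous_induced_dom.comp
        (Real.continuous_fourierChar.comp (continuous_id.mul continuous_const))
    exact this.measurable.comp measurable_fst
  have h2 : Measurable fun y : TimeGroup q => ((ZMod.toCircle (y.2 * ζ.2) : Circle) : ℂ) :=
    (measurable_of_countable
      (fun j : ZMod q => ((ZMod.toCircle (j * ζ.2) : Circle) : ℂ))).comp measurable_snd
  have h := h1.mul h2
  simp only [pairing, Circle.coe_mul]
  exact h

lemma measurePreserving_sub (z : TimeGroup q) :
    MeasurePreserving (fun y : TimeGroup q => y - z) (timeMeasure q) (timeMeasure q) :=
  (measurePreserving_sub_right (volume : Measure ℝ) z.1).prod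
    (measurePreserving_sub_right (Measure.count : Measure (ZMod q)) z.2)

/-! ### Time-frequency shifts -/

/-- The translation `(T_z f)(y) = f (y - z)` on `L²(ℝ × ℤ_q)`. -/
def translation (z : TimeGroup q) : L2 q →L[ℂ] L2 q :=
  (Lp.compMeasurePreservingₗᵢ ℂ (fun y : TimeGroup q => y - z)
    (measurePreserving_sub z)).toContinuousLinearMap

lemma translation_coe (z : TimeGroup q) (f : L2 q) :
    translation z f =ᵐ[timeMeasure q] fun y => f (y - z) :=
  Lp.coeFn_compMeasurePreserving f (measurePreserving_sub z)

lemma norm_translation (z : TimeGroup q) (f : L2 q) : ‖translation z f‖ = ‖f‖ :=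
  (Lp.compMeasurePreservingₗᵢ ℂ (fun y : TimeGroup q => y - z)
    (measurePreserving_sub z)).norm_map f

lemma memLp_modulation (ζ : TimeGroup q) (f : L2 q) :
    MemLp (fun y => (pairing y ζ : ℂ) * f y) 2 (timeMeasure q) := by
  refine (Lp.memLp f).of_le
    ((measurable_pairing ζ).aestronglyMeasurable.mul (Lp.aestronglyMeasurable f)) ?_
  filter_upwards with y
  rw [norm_mul, Circle.norm_coe, one_mul]

/-- The modulation `(E_ζ f)(y) = exp (2πi ⟨y, ζ⟩) f(y)` on `L²(ℝ × ℤ_q)`. -/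
def modulation (ζ : TimeGroup q) : L2 q →L[ℂ] L2 q :=
  LinearMap.mkContinuous
    { toFun := fun f => (memLp_modulation ζ f).toLp _
      map_add' := fun f g => by
        refine Lp.ext ?_
        filter_upwards [(memLp_modulation ζ (f + g)).coeFn_toLp,
          (memLp_modulation ζ f).coeFn_toLp, (memLp_modulation ζ g).coeFn_toLp,
          Lp.coeFn_add f g, Lp.coeFn_add ((memLp_modulation ζ f).toLp _)
            ((memLp_modulation ζ g).toLp _)] with y h1 h2 h3 h4 h5
        rw [h1, h5, Pi.add_apply, h2, h3, h4, Pi.add_apply, mul_add]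
      map_smul' := fun c f => by
        refine Lp.ext ?_
        filter_upwards [(memLp_modulation ζ (c • f)).coeFn_toLp,
          (memLp_modulation ζ f).coeFn_toLp, Lp.coeFn_smul c f,
          Lp.coeFn_smul c ((memLp_modulation ζ f).toLp _)] with y h1 h2 h3 h4
        rw [h1, RingHom.id_apply, h4, Pi.smul_apply, h2, h3, Pi.smul_apply]
        simp only [smul_eq_mul]
        ring }
    1 (fun f => by
      simp only [LinearMap.coe_mk, AddHom.coe_mk, one_mul]
      refine Lp.norm_le_norm_of_ae_le ?_
      filter_upwards [(memLp_modulation ζ f).coeFn_toLp] with y h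
      rw [h, norm_mul, Circle.norm_coe, one_mul])

lemma modulation_coe (ζ : TimeGroup q) (f : L2 q) :
    modulation ζ f =ᵐ[timeMeasure q] fun y => (pairing y ζ : ℂ) * f y :=
  (memLp_modulation ζ f).coeFn_toLp

lemma norm_modulation (ζ : TimeGroup q) (f : L2 q) : ‖modulation ζ f‖ = ‖f‖ := by
  refine le_antisymm (Lp.norm_le_norm_of_ae_le ?_) (Lp.norm_le_norm_of_ae_le ?_) <;>
  · filter_upwards [modulation_coe ζ f] with y h
    rw [h, norm_mul, Circle.norm_coe, one_mul]

/-- The time-frequency shift `π(ν) = E_{γ,c} T_{l,j}`. -/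
def tfShift (ν : Phase q) : L2 q →L[ℂ] L2 q := modulation ν.2 * translation ν.1

/-- The frequency-time shift `π°(ν) = T_{l,j} E_{γ,c}`. -/
def ftShift (ν : Phase q) : L2 q →L[ℂ] L2 q := translation ν.1 * modulation ν.2

lemma translation_add (z z' : TimeGroup q) :
    translation z * translation z' = translation (z + z') := by
  refine ContinuousLinearMap.ext fun f => Lp.ext ?_
  have h := (measurePreserving_sub z).quasiMeasurePreserving.ae (translation_coe z' f)
  filter_upwards [translation_coe z (translation z' f), translation_coe (z + z') f, h]
    with y h1 h2 h3
  rw [mul_apply_eq_comp, h1, h2, h3, sub_sub]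

lemma modulation_add (ζ ζ' : TimeGroup q) :
    modulation ζ * modulation ζ' = modulation (ζ + ζ') := by
  refine ContinuousLinearMap.ext fun f => Lp.ext ?_
  filter_upwards [modulation_coe ζ (modulation ζ' f), modulation_coe (ζ + ζ') f,
    modulation_coe ζ' f] with y h1 h2 h3
  rw [mul_apply_eq_comp, h1, h2, h3, pairing_add_right]
  push_cast
  ring

lemma modulation_mul_translation (ζ z : TimeGroup q) :
    modulation ζ * translation z = (pairing z ζ : ℂ) • (translation z * modulation ζ) := by
  refine ContinuousLinearMap.ext fun f => Lp.ext ?_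
  have h := (measurePreserving_sub z).quasiMeasurePreserving.ae (modulation_coe ζ f)
  filter_upwards [modulation_coe ζ (translation z f), translation_coe z f,
    translation_coe z (modulation ζ f), h,
    Lp.coeFn_smul (pairing z ζ : ℂ) (translation z (modulation ζ f))] with y h1 h2 h3 h4 h5
  rw [mul_apply_eq_comp, h1, h2, smul_apply, mul_apply_eq_comp, h5,
    Pi.smul_apply, h3, h4, smul_eq_mul, ← mul_assoc, ← Circle.coe_mul, ← pairing_add_left,
    add_sub_cancel]

lemma translation_zero : translation (0 : TimeGroup q) = 1 := by
  refine ContinuousLinearMap.ext fun f => Lp.ext ?_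
  filter_upwards [translation_coe 0 f] with y h
  rw [h, sub_zero, one_apply_eq_self]

lemma modulation_zero : modulation (0 : TimeGroup q) = 1 := by
  refine ContinuousLinearMap.ext fun f => Lp.ext ?_
  filter_upwards [modulation_coe 0 f] with y h
  rw [h, one_apply_eq_self]
  simp

lemma star_translation (z : TimeGroup q) : star (translation z) = translation (-z) :=
  star_eq_of_isometry (norm_translation z) (by rw [translation_add, add_neg_cancel,
    translation_zero])

lemma star_modulation (ζ : TimeGroup q) : star (modulation ζ) = modulation (-ζ) :=
  star_eq_of_isometry (norm_modulation ζ) (by rw [modulation_add, add_neg_cancel,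
    modulation_zero])

lemma tfShift_eq (ν : Phase q) : tfShift ν = (pairing ν.1 ν.2 : ℂ) • ftShift ν :=
  modulation_mul_translation _ _

lemma ftShift_eq (ν : Phase q) :
    ftShift ν = ((pairing ν.1 ν.2)⁻¹ : Circle) • tfShift ν := by
  rw [tfShift_eq, Circle.smul_def, smul_smul, ← Circle.coe_mul]
  simp

lemma tfShift_zero : tfShift (0 : Phase q) = 1 := by
  simp [tfShift, translation_zero, modulation_zero]

lemma norm_tfShift_apply (ν : Phase q) (f : L2 q) : ‖tfShift ν f‖ = ‖f‖ := by
  rw [tfShift, mul_apply_eq_comp, norm_modulation, norm_translation]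

lemma norm_tfShift_le (ν : Phase q) : ‖tfShift ν‖ ≤ 1 :=
  ContinuousLinearMap.opNorm_le_bound _ zero_le_one fun f => by
    rw [norm_tfShift_apply, one_mul]

/-- The 2-cocycle `φ(ν, μ) = exp (-2πi ⟨ν.1, μ.2⟩)`. -/
def cocycle (ν μ : Phase q) : Circle := (pairing ν.1 μ.2)⁻¹

lemma tfShift_mul (ν μ : Phase q) :
    tfShift ν * tfShift μ = (cocycle ν μ : ℂ) • tfShift (ν + μ) := by
  have h : translation ν.1 * modulation μ.2
      = (cocycle ν μ : ℂ) • (modulation μ.2 * translation ν.1) := by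
    rw [modulation_mul_translation, smul_smul, ← Circle.coe_mul]
    simp [cocycle]
  calc tfShift ν * tfShift μ
      = modulation ν.2 * (translation ν.1 * modulation μ.2) * translation μ.1 := by
        simp only [tfShift, mul_assoc]
    _ = (cocycle ν μ : ℂ) • ((modulation ν.2 * modulation μ.2)
          * (translation ν.1 * translation μ.1)) := by
        rw [h, mul_smul_comm, smul_mul_assoc]
        simp only [mul_assoc]
    _ = _ := by rw [modulation_add, translation_add]; rfl

lemma star_tfShift (ν : Phase q) : star (tfShift ν) = ftShift (-ν) := by
  rw [tfShift, star_mul, star_translation, star_modulation]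
  rfl

end Basic

/-! ### The algebras of time-frequency and frequency-time shifts -/

/-- The weight `(1 + |l| + |γ|)^s` of the point `((l, j), (γ, c))`. -/
def weight {q : ℕ} (s : ℝ≥0) (ν : Phase q) : ℝ := (1 + |ν.1.1| + |ν.2.1|) ^ (s : ℝ)

section Algebra

variable {q : ℕ}

lemma one_le_weight (s : ℝ≥0) (ν : Phase q) : 1 ≤ weight s ν := by
  refine Real.one_le_rpow ?_ s.2
  have := abs_nonneg ν.1.1
  have := abs_nonneg ν.2.1
  linarith

lemma weight_nonneg (s : ℝ≥0) (ν : Phase q) : 0 ≤ weight s ν :=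
  zero_le_one.trans (one_le_weight s ν)

lemma weight_neg (s : ℝ≥0) (ν : Phase q) : weight s (-ν) = weight s ν := by
  simp [weight]

lemma weight_add_le (s : ℝ≥0) (ν μ : Phase q) :
    weight s (ν + μ) ≤ weight s ν * weight s μ := by
  have h1 := abs_nonneg ν.1.1
  have h2 := abs_nonneg ν.2.1
  have h3 := abs_nonneg μ.1.1
  have h4 := abs_nonneg μ.2.1
  have h5 := abs_add_le ν.1.1 μ.1.1
  have h6 := abs_add_le ν.2.1 μ.2.1
  have h7 := mul_nonneg (add_nonneg h1 h2) (add_nonneg h3 h4)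
  unfold weight
  rw [← Real.mul_rpow (by linarith) (by linarith)]
  refine Real.rpow_le_rpow ?_ ?_ s.2
  · simp only [Prod.fst_add, Prod.snd_add]
    positivity
  · simp only [Prod.fst_add, Prod.snd_add]
    nlinarith

lemma hasSum_mul_aux {H ι κ : Type*} [NormedAddCommGroup H] [InnerProductSpace ℂ H]
    [CompleteSpace H] {f : ι → H →L[ℂ] H} {g : κ → H →L[ℂ] H} {S T : H →L[ℂ] H}
    (hf : HasSum f S) (hg : HasSum g T) (hf' : Summable fun i => ‖f i‖)
    (hg' : Summable fun i => ‖g i‖) : HasSum (fun p : ι × κ => f p.1 * g p.2) (S * T) :=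
  hf.mul hg (summable_mul_of_summable_norm hf' hg')

lemma hasSum_fiber_aux {E ι κ : Type*} [NormedAddCommGroup E] [NormedSpace ℂ E]
    {A : ι × κ → ℂ} (hA : Summable fun p => ‖A p‖) {F : ι → E} {S : E}
    (h : HasSum (fun p : ι × κ => A p • F p.1) S) :
    HasSum (fun i => (∑' k, A (i, k)) • F i) S :=
  h.prod_fiberwise fun i => ((hA.prod_factor i).of_norm.hasSum).smul_const _

/-- `a ∈ ℓ¹_s(D)` for a subgroup `D` of the time-frequency plane. -/
def MemL1 (D : AddSubgroup (Phase q)) (s : ℝ≥0) (a : D → ℂ) : Prop :=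
  Summable fun ν : D => ‖a ν‖ * weight s (ν : Phase q)

lemma MemL1.summable_norm {D : AddSubgroup (Phase q)} {s : ℝ≥0} {a : D → ℂ}
    (h : MemL1 D s a) : Summable fun ν => ‖a ν‖ :=
  Summable.of_nonneg_of_le (fun _ => norm_nonneg _)
    (fun _ => le_mul_of_one_le_right (norm_nonneg _) (one_le_weight s _)) h

variable [NeZero q]

lemma summable_norm_smul {D : AddSubgroup (Phase q)} {a : D → ℂ}
    (h : Summable fun ν => ‖a ν‖) :
    Summable fun ν : D => ‖a ν • tfShift (ν : Phase q)‖ :=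
  Summable.of_nonneg_of_le (fun _ => norm_nonneg _)
    (fun ν => by
      rw [norm_smul]
      exact mul_le_of_le_one_right (norm_nonneg _) (norm_tfShift_le _)) h

/-- The shear `(ν, μ) ↦ (ν + μ, ν)` of `D × D`. -/
def shear (D : AddSubgroup (Phase q)) : D × D ≃ D × D where
  toFun p := (p.1 + p.2, p.1)
  invFun p := (p.2, p.1 - p.2)
  left_inv p := by simp
  right_inv p := by simp

/-- Twisted convolution `(a ♮ b)(κ) = ∑_ν a(ν) b(κ - ν) φ(ν, κ - ν)`. -/
def twistedConv {D : AddSubgroup (Phase q)} (a b : D → ℂ) (κ : D) : ℂ :=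
  ∑' ν : D, a ν * b (κ - ν) * (cocycle (ν : Phase q) ((κ - ν : D) : Phase q) : ℂ)

lemma mul_mem_aux {D : AddSubgroup (Phase q)} {s : ℝ≥0} {a b : D → ℂ}
    {S T : L2 q →L[ℂ] L2 q} (ha : MemL1 D s a) (hb : MemL1 D s b)
    (hS : HasSum (fun ν : D => a ν • tfShift (ν : Phase q)) S)
    (hT : HasSum (fun ν : D => b ν • tfShift (ν : Phase q)) T) :
    MemL1 D s (twistedConv a b) ∧
      HasSum (fun ν : D => twistedConv a b ν • tfShift (ν : Phase q)) (S * T) := by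
  set A : D × D → ℂ := fun p =>
    a p.2 * b (p.1 - p.2) * (cocycle (p.2 : Phase q) ((p.1 - p.2 : D) : Phase q) : ℂ) with hA
  have hnA : ∀ p, ‖A p‖ = ‖a p.2‖ * ‖b (p.1 - p.2)‖ := fun p => by
    simp only [hA, norm_mul, Circle.norm_coe, mul_one]
  -- weighted summability over pairs
  have hw : Summable fun p : D × D => ‖A p‖ * weight s (p.1 : Phase q) := by
    rw [← (shear D).summable_iff]
    refine Summable.of_nonneg_of_le
      (fun p => mul_nonneg (norm_nonneg _) (weight_nonneg _ _)) (fun p => ?_)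
      (Summable.mul_of_nonneg ha hb
        (fun ν => mul_nonneg (norm_nonneg _) (weight_nonneg _ _))
        (fun ν => mul_nonneg (norm_nonneg _) (weight_nonneg _ _)))
    have h := weight_add_le s (p.1 : Phase q) (p.2 : Phase q)
    simp only [Function.comp, hnA, shear, Equiv.coe_fn_mk, add_sub_cancel_left,
      AddSubgroup.coe_add]
    calc ‖a p.1‖ * ‖b p.2‖ * weight s ((p.1 : Phase q) + (p.2 : Phase q))
        ≤ ‖a p.1‖ * ‖b p.2‖ * (weight s (p.1 : Phase q) * weight s (p.2 : Phase q)) :=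
          mul_le_mul_of_nonneg_left h (mul_nonneg (norm_nonneg _) (norm_nonneg _))
      _ = _ := by ring
  have hn : Summable fun p : D × D => ‖A p‖ :=
    Summable.of_nonneg_of_le (fun _ => norm_nonneg _)
      (fun p => le_mul_of_one_le_right (norm_nonneg _) (one_le_weight s _)) hw
  constructor
  · refine Summable.of_nonneg_of_le
      (fun ν => mul_nonneg (norm_nonneg _) (weight_nonneg _ _)) (fun κ => ?_) hw.prod
    have h : ∑' ν : D, ‖A (κ, ν)‖ * weight s (κ : Phase q)
        = (∑' ν : D, ‖A (κ, ν)‖) * weight s (κ : Phase q) := tsum_mul_right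
    refine le_of_le_of_eq ?_ h.symm
    exact mul_le_mul_of_nonneg_right (norm_tsum_le_tsum_norm (hn.prod_factor κ))
      (weight_nonneg _ _)
  · have h1 := hasSum_mul_aux hS hT (summable_norm_smul ha.summable_norm)
      (summable_norm_smul hb.summable_norm)
    have h2 : HasSum (fun p : D × D => A p • tfShift (p.1 : Phase q)) (S * T) := by
      rw [← (shear D).hasSum_iff]
      convert h1 using 2 with p
      simp only [Function.comp, hA, shear, Equiv.coe_fn_mk, add_sub_cancel_left,
        AddSubgroup.coe_add]
      rw [smul_mul_smul_comm, tfShift_mul, smul_smul]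
    exact hasSum_fiber_aux hn h2

/-- The algebra of all operators `T = ∑_{ν ∈ D} a(ν) π(ν)` with `a ∈ ℓ¹_s(D)` (the series
converges absolutely in operator norm), under composition and the Hilbert space adjoint. -/
def tfAlgebra (D : AddSubgroup (Phase q)) (s : ℝ≥0) : StarSubalgebra ℂ (L2 q →L[ℂ] L2 q) where
  carrier := {T | ∃ a : D → ℂ, MemL1 D s a ∧
    HasSum (fun ν : D => a ν • tfShift (ν : Phase q)) T}
  mul_mem' := by
    rintro S T ⟨a, ha, hS⟩ ⟨b, hb, hT⟩
    exact ⟨_, mul_mem_aux ha hb hS hT⟩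
  add_mem' := by
    rintro S T ⟨a, ha, hS⟩ ⟨b, hb, hT⟩
    refine ⟨fun ν => a ν + b ν, ?_, ?_⟩
    · refine Summable.of_nonneg_of_le
        (fun ν => mul_nonneg (norm_nonneg _) (weight_nonneg _ _)) (fun ν => ?_) (ha.add hb)
      rw [← add_mul]
      exact mul_le_mul_of_nonneg_right (norm_add_le _ _) (weight_nonneg _ _)
    · simpa only [add_smul] using hS.add hT
  algebraMap_mem' := by
    intro c
    classical
    refine ⟨Pi.single 0 c, ?_, ?_⟩
    · refine summable_of_ne_finset_zero (s := {0}) fun ν hν => ?_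
      rw [Finset.mem_singleton] at hν
      simp [hν]
    · convert hasSum_single (f := fun ν : D =>
        (Pi.single 0 c : D → ℂ) ν • tfShift (ν : Phase q)) 0 ?_ using 1
      · simp [tfShift_zero, Algebra.algebraMap_eq_smul_one]
      · intro ν hν
        simp [hν]
  star_mem' := by
    rintro T ⟨a, ha, hT⟩
    refine ⟨fun ν => star (a (-ν)) * (((pairing (ν : Phase q).1 (ν : Phase q).2)⁻¹ : Circle) : ℂ),
      ?_, ?_⟩
    · have h := (Equiv.neg D).summable_iff.2 ha
      refine h.congr fun ν => ?_
      simp only [Function.comp, weight_neg, norm_mul, Circle.norm_coe, mul_one, norm_star,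
        Equiv.neg_apply, NegMemClass.coe_neg]
    · have h := (Equiv.neg D).hasSum_iff.2 hT.star
      convert h using 2 with ν
      simp only [Function.comp, Equiv.neg_apply, star_smul, star_tfShift, NegMemClass.coe_neg,
        neg_neg]
      rw [ftShift_eq, Circle.smul_def, smul_smul]

lemma ftAlgebra_aux (D : AddSubgroup (Phase q)) (s : ℝ≥0) :
    {T : L2 q →L[ℂ] L2 q | ∃ b : D → ℂ, MemL1 D s b ∧
      HasSum (fun ν : D => b ν • ftShift (ν : Phase q)) T} = ↑(tfAlgebra D s) := by
  ext T
  constructor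
  · rintro ⟨b, hb, hT⟩
    refine ⟨fun ν => b ν * (((pairing (ν : Phase q).1 (ν : Phase q).2)⁻¹ : Circle) : ℂ), ?_, ?_⟩
    · refine Summable.congr hb fun ν => ?_
      rw [norm_mul, Circle.norm_coe, mul_one]
    · convert hT using 2 with ν
      rw [ftShift_eq, Circle.smul_def, smul_smul]
  · rintro ⟨a, ha, hT⟩
    refine ⟨fun ν => a ν * (pairing (ν : Phase q).1 (ν : Phase q).2 : ℂ), ?_, ?_⟩
    · refine Summable.congr ha fun ν => ?_
      rw [norm_mul, Circle.norm_coe, mul_one]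
    · convert hT using 2 with ν
      rw [tfShift_eq, smul_smul]

/-- The algebra of all operators `T = ∑_{ν ∈ D} b(ν) π°(ν)` with `b ∈ ℓ¹_s(D)` (the series
converges absolutely in operator norm), under composition and the Hilbert space adjoint. -/
def ftAlgebra (D : AddSubgroup (Phase q)) (s : ℝ≥0) : StarSubalgebra ℂ (L2 q →L[ℂ] L2 q) :=
  (tfAlgebra D s).copy
    {T | ∃ b : D → ℂ, MemL1 D s b ∧ HasSum (fun ν : D => b ν • ftShift (ν : Phase q)) T}
    (ftAlgebra_aux D s)

end Algebra

/-! ### Lattices and annihilators -/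

section Lattices

variable {q : ℕ}

/-- The subgroup `{(a n, r n mod q) : n ∈ ℤ}` of `ℝ × ℤ_q`. -/
def lattice (q : ℕ) (a : ℝ) (r : ℕ) : AddSubgroup (TimeGroup q) :=
  AddSubgroup.zmultiples (a, (r : ZMod q))

/-- The annihilator `{ξ : exp (2πi ⟨y, ξ⟩) = 1 for all y ∈ Λ}`. -/
def annihilator [NeZero q] (Λ : AddSubgroup (TimeGroup q)) : AddSubgroup (TimeGroup q) where
  carrier := {ξ | ∀ y ∈ Λ, pairing y ξ = 1}
  zero_mem' := fun y _ => pairing_zero_right y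
  add_mem' := fun {ξ η} hξ hη y hy => by rw [pairing_add_right, hξ y hy, hη y hy, one_mul]
  neg_mem' := fun {ξ} hξ y hy => by
    have h := pairing_add_right y ξ (-ξ)
    rw [add_neg_cancel, pairing_zero_right, hξ y hy, one_mul] at h
    exact h.symm

end Lattices

/-! ### Weighted modulation spaces -/

section Modulation

/-- The short-time Fourier transform
`(x, ω) ↦ ⟨f, E_ω T_x w⟩ = ∫ f(t) conj (exp (2πi t ω) w(t - x)) dt` on `ℝ`. -/
def stft (w : 𝓢(ℝ, ℂ)) (f : Lp ℂ 2 (volume : Measure ℝ)) (p : ℝ × ℝ) : ℂ :=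
  ∫ t, f t * (starRingEnd ℂ) ((𝐞 (t * p.2) : ℂ) * w (t - p.1))

/-- The weight `(1 + |x| + |ω|)^s` on `ℝ²`. -/
def weightR (s : ℝ≥0) (p : ℝ × ℝ) : ℝ := (1 + |p.1| + |p.2|) ^ (s : ℝ)

lemma continuous_fourier_mul (ω : ℝ) : Continuous fun t : ℝ => ((𝐞 (t * ω) : Circle) : ℂ) :=
  continuous_induced_dom.comp
    (Real.continuous_fourierChar.comp (continuous_id.mul continuous_const))

lemma memLp_atom (w : 𝓢(ℝ, ℂ)) (p : ℝ × ℝ) :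
    MemLp (fun t : ℝ => ((𝐞 (t * p.2) : Circle) : ℂ) * w (t - p.1)) 2 (volume : Measure ℝ) := by
  have h : MemLp (fun t : ℝ => w (t - p.1)) 2 (volume : Measure ℝ) :=
    (w.memLp 2 volume).comp_measurePreserving (measurePreserving_sub_right volume p.1)
  refine h.of_le ((continuous_fourier_mul p.2).aestronglyMeasurable.mul
    h.aestronglyMeasurable) ?_
  filter_upwards with t
  rw [norm_mul, Circle.norm_coe, one_mul]

lemma stft_eq_inner (w : 𝓢(ℝ, ℂ)) (f : Lp ℂ 2 (volume : Measure ℝ)) (p : ℝ × ℝ) :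
    stft w f p = ⟪(memLp_atom w p).toLp _, f⟫_ℂ := by
  rw [L2.inner_def, stft]
  refine integral_congr_ae ?_
  filter_upwards [(memLp_atom w p).coeFn_toLp] with t h
  rw [h]
  rfl

lemma stronglyMeasurable_stft (w : 𝓢(ℝ, ℂ)) (f : Lp ℂ 2 (volume : Measure ℝ)) :
    StronglyMeasurable (stft w f) := by
  refine StronglyMeasurable.integral_prod_right'
    (f := fun x : (ℝ × ℝ) × ℝ =>
      f x.2 * (starRingEnd ℂ) ((𝐞 (x.2 * x.1.2) : ℂ) * w (x.2 - x.1.1))) ?_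
  refine ((Lp.stronglyMeasurable f).comp_measurable measurable_snd).mul ?_
  have h1 : Continuous fun x : (ℝ × ℝ) × ℝ => ((𝐞 (x.2 * x.1.2) : Circle) : ℂ) :=
    continuous_induced_dom.comp (Real.continuous_fourierChar.comp (by fun_prop))
  have h2 : Continuous fun x : (ℝ × ℝ) × ℝ => w (x.2 - x.1.1) :=
    w.continuous.comp (by fun_prop)
  exact (Complex.continuous_conj.comp (h1.mul h2)).stronglyMeasurable

lemma measurable_weightR (s : ℝ≥0) : Measurable (weightR s) := by
  unfold weightR
  fun_prop

lemma weightR_nonneg (s : ℝ≥0) (p : ℝ × ℝ) : 0 ≤ weightR s p := by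
  unfold weightR
  positivity

/-- The weighted modulation space `M¹_s(ℝ)` (with window `w`). -/
def M1Real (w : 𝓢(ℝ, ℂ)) (s : ℝ≥0) : Submodule ℂ (Lp ℂ 2 (volume : Measure ℝ)) where
  carrier := {f | Integrable fun p : ℝ × ℝ => ‖stft w f p‖ * weightR s p}
  zero_mem' := by
    have h : stft w 0 = 0 := funext fun p => by rw [stft_eq_inner, inner_zero_right]; rfl
    simp [h]
  add_mem' := by
    intro f g hf hg
    refine (Integrable.add hf hg).mono'
      (((stronglyMeasurable_stft w _).norm.mul
        (measurable_weightR s).stronglyMeasurable).aestronglyMeasurable) ?_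
    filter_upwards with p
    have h0 := weightR_nonneg s p
    rw [Real.norm_of_nonneg (mul_nonneg (norm_nonneg _) h0), Pi.add_apply, ← add_mul,
      stft_eq_inner, stft_eq_inner, stft_eq_inner, inner_add_right]
    exact mul_le_mul_of_nonneg_right (norm_add_le _ _) h0
  smul_mem' := by
    intro c f hf
    refine (Integrable.const_mul hf ‖c‖).congr ?_
    filter_upwards with p
    rw [stft_eq_inner, stft_eq_inner, inner_smul_right, norm_mul, mul_assoc]

variable {q : ℕ}

lemma weightR_add_le (s : ℝ≥0) (ν : Phase q) (p : ℝ × ℝ) :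
    weightR s (p + (ν.1.1, ν.2.1)) ≤ weight s ν * weightR s p :=
  (weight_add_le s (((p.1, 0), (p.2, 0)) : Phase q) ν).trans_eq (mul_comm _ _)

lemma map_slice_le [NeZero q] (k : ZMod q) :
    (volume : Measure ℝ).map (fun x => (x, k)) ≤ timeMeasure q := by
  refine Measure.le_iff.2 fun A hA => ?_
  rw [Measure.map_apply measurable_prodMk_right hA, Measure.prod_apply_symm hA, lintegral_count]
  exact ENNReal.le_tsum (f := fun j : ZMod q => volume ((fun x : ℝ => (x, j)) ⁻¹' A)) k

variable [NeZero q]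

lemma quasi_slice (k : ZMod q) :
    Measure.QuasiMeasurePreserving (fun x : ℝ => (x, k)) volume (timeMeasure q) :=
  ⟨measurable_prodMk_right, (map_slice_le k).absolutelyContinuous⟩

lemma memLp_slice (k : ZMod q) (f : L2 q) :
    MemLp (fun x : ℝ => f (x, k)) 2 (volume : Measure ℝ) :=
  ((Lp.memLp f).mono_measure (map_slice_le k)).comp_of_map
    measurable_prodMk_right.aemeasurable

lemma eLpNorm_slice_le (k : ZMod q) (f : L2 q) :
    eLpNorm (fun x : ℝ => f (x, k)) 2 volume ≤ eLpNorm f 2 (timeMeasure q) := by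
  have h := eLpNorm_map_measure (p := 2) (μ := (volume : Measure ℝ))
    ((Lp.memLp f).mono_measure (map_slice_le k)).aestronglyMeasurable
    (measurable_prodMk_right (y := k)).aemeasurable
  exact h.symm.le.trans (eLpNorm_mono_measure _ (map_slice_le k))

/-- The restriction `f ↦ f(·, k)` from `L²(ℝ × ℤ_q)` to `L²(ℝ)`. -/
def slice (k : ZMod q) : L2 q →L[ℂ] Lp ℂ 2 (volume : Measure ℝ) :=
  LinearMap.mkContinuous
    { toFun := fun f => (memLp_slice k f).toLp _
      map_add' := fun f g => by
        refine Lp.ext ?_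
        filter_upwards [(memLp_slice k (f + g)).coeFn_toLp, (memLp_slice k f).coeFn_toLp,
          (memLp_slice k g).coeFn_toLp, (quasi_slice k).ae (Lp.coeFn_add f g),
          Lp.coeFn_add ((memLp_slice k f).toLp _) ((memLp_slice k g).toLp _)]
          with x h1 h2 h3 h4 h5
        rw [h1, h5, Pi.add_apply, h2, h3, h4, Pi.add_apply]
      map_smul' := fun c f => by
        refine Lp.ext ?_
        filter_upwards [(memLp_slice k (c • f)).coeFn_toLp, (memLp_slice k f).coeFn_toLp,
          (quasi_slice k).ae (Lp.coeFn_smul c f),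
          Lp.coeFn_smul c ((memLp_slice k f).toLp _)] with x h1 h2 h3 h4
        rw [h1, RingHom.id_apply, h4, Pi.smul_apply, h2, h3, Pi.smul_apply] }
    1 (fun f => by
      simp only [LinearMap.coe_mk, AddHom.coe_mk, one_mul]
      rw [Lp.norm_toLp, Lp.norm_def]
      exact ENNReal.toReal_mono (Lp.eLpNorm_ne_top f) (eLpNorm_slice_le k f))

lemma slice_coe (k : ZMod q) (f : L2 q) :
    slice k f =ᵐ[volume] fun x => f (x, k) :=
  (memLp_slice k f).coeFn_toLp

/-- The weighted modulation space `M¹_s(ℝ × ℤ_q)` (with window `w`): all `f ∈ L²(ℝ × ℤ_q)`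
with `f(·, k) ∈ M¹_s(ℝ)` for every `k`. -/
def M1 (q : ℕ) [NeZero q] (w : 𝓢(ℝ, ℂ)) (s : ℝ≥0) : Submodule ℂ (L2 q) :=
  ⨅ k : ZMod q, (M1Real w s).comap (slice k : L2 q →ₗ[ℂ] Lp ℂ 2 (volume : Measure ℝ))

lemma mem_M1 {w : 𝓢(ℝ, ℂ)} {s : ℝ≥0} {f : L2 q} :
    f ∈ M1 q w s ↔ ∀ k, Integrable fun p : ℝ × ℝ => ‖stft w (slice k f) p‖ * weightR s p := by
  simp only [M1, Submodule.mem_iInf]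
  rfl

/-! ### The shift algebras act on the modulation space -/

lemma norm_stft_slice_tfShift (w : 𝓢(ℝ, ℂ)) (ν : Phase q) (f : L2 q) (k : ZMod q) (p : ℝ × ℝ) :
    ‖stft w (slice k (tfShift ν f)) p‖
      = ‖stft w (slice (k - ν.1.2) f) (p - (ν.1.1, ν.2.1))‖ := by
  have h1 : (slice k (tfShift ν f) : ℝ → ℂ) =ᵐ[volume]
      fun x => (pairing (x, k) ν.2 : ℂ) * slice (k - ν.1.2) f (x - ν.1.1) := by
    have h2 := (measurePreserving_sub_right (volume : Measure ℝ)
      ν.1.1).quasiMeasurePreserving.ae (slice_coe (k - ν.1.2) f)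
    filter_upwards [slice_coe k (tfShift ν f), h2,
      (quasi_slice k).ae (modulation_coe ν.2 (translation ν.1 f)),
      (quasi_slice k).ae (translation_coe ν.1 f)] with x e1 e2 e3 e4
    rw [e1, e2, tfShift, mul_apply_eq_comp, e3, e4]
    rfl
  have h2 : stft w (slice k (tfShift ν f)) p = ∫ t, (pairing (t, k) ν.2 : ℂ) *
      slice (k - ν.1.2) f (t - ν.1.1) *
        (starRingEnd ℂ) ((𝐞 (t * p.2) : ℂ) * w (t - p.1)) := by
    refine integral_congr_ae ?_
    filter_upwards [h1] with t ht
    rw [ht]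
  have h3 : stft w (slice k (tfShift ν f)) p =
      ((𝐞 (ν.1.1 * (ν.2.1 - p.2)) * ZMod.toCircle (k * ν.2.2) : Circle) : ℂ) *
        stft w (slice (k - ν.1.2) f) (p - (ν.1.1, ν.2.1)) := by
    rw [h2, stft, ← integral_const_mul,
      ← integral_add_right_eq_self (μ := (volume : Measure ℝ)) _ ν.1.1]
    refine integral_congr_ae ?_
    filter_upwards with t
    have e1 : 𝐞 ((t + ν.1.1) * ν.2.1) * (𝐞 ((t + ν.1.1) * p.2))⁻¹
        = 𝐞 (ν.1.1 * (ν.2.1 - p.2)) * (𝐞 (t * (p.2 - ν.2.1)))⁻¹ := by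
      rw [← AddChar.map_neg_eq_inv, ← AddChar.map_neg_eq_inv, ← AddChar.map_add_eq_mul,
        ← AddChar.map_add_eq_mul]
      congr 1
      ring
    have e2 := congrArg (fun z : Circle => (z : ℂ)) e1
    simp only [Circle.coe_mul, Circle.coe_inv_eq_conj] at e2
    have e3 : t + ν.1.1 - p.1 = t - (p - (ν.1.1, ν.2.1)).1 := by
      simp only [Prod.fst_sub]
      ring
    simp only [pairing, Circle.coe_mul, map_mul, add_sub_cancel_right, e3, Prod.snd_sub]
    linear_combination (ZMod.toCircle (k * ν.2.2) : ℂ) * slice (k - ν.1.2) f t *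
      (starRingEnd ℂ) (w (t - (p - (ν.1.1, ν.2.1)).1)) * e2
  rw [h3, norm_mul, Circle.norm_coe, one_mul]

lemma lintegral_stft_shift_le (w : 𝓢(ℝ, ℂ)) (s : ℝ≥0) (ν : Phase q) (f : L2 q) (k : ZMod q) :
    ∫⁻ p, ‖stft w (slice k (tfShift ν f)) p‖ₑ * ENNReal.ofReal (weightR s p)
      ≤ ENNReal.ofReal (weight s ν) *
        ∫⁻ p, ‖stft w (slice (k - ν.1.2) f) p‖ₑ * ENNReal.ofReal (weightR s p) := by
  have h : ∀ p, ‖stft w (slice k (tfShift ν f)) p‖ₑ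
      = ‖stft w (slice (k - ν.1.2) f) (p - (ν.1.1, ν.2.1))‖ₑ := fun p => by
    rw [← ofReal_norm, ← ofReal_norm, norm_stft_slice_tfShift]
  simp only [h]
  rw [← lintegral_add_right_eq_self _ ((ν.1.1, ν.2.1) : ℝ × ℝ),
    ← lintegral_const_mul' _ _ ENNReal.ofReal_ne_top]
  refine lintegral_mono fun p => ?_
  simp only [add_sub_cancel_right]
  calc _ ≤ ‖stft w (slice (k - ν.1.2) f) p‖ₑ * ENNReal.ofReal (weight s ν * weightR s p) := by
        gcongr
        exact weightR_add_le s ν p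
    _ = _ := by
        rw [ENNReal.ofReal_mul (weight_nonneg s ν)]
        ring

lemma mem_M1_iff_lintegral {w : 𝓢(ℝ, ℂ)} {s : ℝ≥0} {f : L2 q} :
    f ∈ M1 q w s ↔
      ∀ k, ∫⁻ p, ‖stft w (slice k f) p‖ₑ * ENNReal.ofReal (weightR s p) < ∞ := by
  rw [mem_M1]
  refine forall_congr' fun k => ?_
  have h1 : AEStronglyMeasurable (fun p : ℝ × ℝ => ‖stft w (slice k f) p‖ * weightR s p) :=
    ((stronglyMeasurable_stft w _).norm.mul
      (measurable_weightR s).stronglyMeasurable).aestronglyMeasurable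
  have h2 : ∀ p, ‖‖stft w (slice k f) p‖ * weightR s p‖ₑ
      = ‖stft w (slice k f) p‖ₑ * ENNReal.ofReal (weightR s p) := fun p => by
    rw [← ofReal_norm, Real.norm_of_nonneg
      (mul_nonneg (norm_nonneg _) (weightR_nonneg s p)),
      ENNReal.ofReal_mul (norm_nonneg _), ofReal_norm]
  simp only [Integrable, HasFiniteIntegral, h1, true_and, h2]

theorem tfAlgebra_apply_mem {D : AddSubgroup (Phase q)} {w : 𝓢(ℝ, ℂ)} {s : ℝ≥0}
    {T : L2 q →L[ℂ] L2 q} (hT : T ∈ tfAlgebra D s) {f : L2 q} (hf : f ∈ M1 q w s) :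
    T f ∈ M1 q w s := by
  obtain ⟨a, ha, hT⟩ := hT
  rw [mem_M1_iff_lintegral] at hf ⊢
  intro k
  set S : Set D := Function.support a with hS
  have hSc : Countable S := by
    have h := ha.summable_norm.countable_support
    have e : Function.support (fun ν => ‖a ν‖) = S := by
      ext ν
      simp [hS]
    rw [e] at h
    exact h.to_subtype
  set C : ℝ≥0∞ := ∑ j : ZMod q,
    ∫⁻ p, ‖stft w (slice j f) p‖ₑ * ENNReal.ofReal (weightR s p) with hC
  have hCt : C < ∞ := ENNReal.sum_lt_top.2 fun j _ => hf j
  -- pointwise expansion of the short-time Fourier transform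
  have hsum : ∀ p, ‖stft w (slice k (T f)) p‖ₑ
      ≤ ∑' ν : S, ‖a ν‖ₑ * ‖stft w (slice k (tfShift ((ν : D) : Phase q) f)) p‖ₑ := by
    intro p
    have h1 : HasSum (fun ν : D => a ν * stft w (slice k (tfShift (ν : Phase q) f)) p)
        (stft w (slice k (T f)) p) := by
      let Φ : (L2 q →L[ℂ] L2 q) →L[ℂ] ℂ :=
        ((innerSL ℂ ((memLp_atom w p).toLp _)).comp (slice k)).comp
          (ContinuousLinearMap.apply ℂ (L2 q) f)
      have h2 := Φ.hasSum hT
      have h3 : ∀ R : L2 q →L[ℂ] L2 q, Φ R = stft w (slice k (R f)) p := fun R => by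
        rw [stft_eq_inner]
        rfl
      rw [h3] at h2
      convert h2 using 2 with ν
      rw [map_smul, h3, smul_eq_mul]
    have h4 : HasSum (fun ν : S => a ν * stft w (slice k (tfShift ((ν : D) : Phase q) f)) p)
        (stft w (slice k (T f)) p) := by
      refine (hasSum_subtype_iff_of_support_subset
        (f := fun ν : D => a ν * stft w (slice k (tfShift (ν : Phase q) f)) p) ?_).2 h1
      intro ν hν
      exact left_ne_zero_of_mul hν
    rw [← h4.tsum_eq]
    refine (enorm_tsum_le_tsum_enorm).trans_eq ?_
    simp only [enorm_mul]
  have hmeas : ∀ ν : S, AEMeasurable fun p =>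
      ‖a ν‖ₑ * ‖stft w (slice k (tfShift ((ν : D) : Phase q) f)) p‖ₑ *
        ENNReal.ofReal (weightR s p) := fun ν =>
    ((((stronglyMeasurable_stft w _).measurable.enorm).const_mul _).mul
      (measurable_weightR s).ennreal_ofReal).aemeasurable
  calc ∫⁻ p, ‖stft w (slice k (T f)) p‖ₑ * ENNReal.ofReal (weightR s p)
      ≤ ∫⁻ p, ∑' ν : S, ‖a ν‖ₑ * ‖stft w (slice k (tfShift ((ν : D) : Phase q) f)) p‖ₑ *
          ENNReal.ofReal (weightR s p) := by
        refine lintegral_mono fun p => ?_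
        rw [ENNReal.tsum_mul_right]
        exact mul_le_mul_left (hsum p) _
    _ = ∑' ν : S, ∫⁻ p, ‖a ν‖ₑ * ‖stft w (slice k (tfShift ((ν : D) : Phase q) f)) p‖ₑ *
          ENNReal.ofReal (weightR s p) := lintegral_tsum hmeas
    _ ≤ ∑' ν : S, ENNReal.ofReal (‖a ν‖ * weight s ((ν : D) : Phase q)) * C := by
        refine ENNReal.tsum_le_tsum fun ν => ?_
        simp only [mul_assoc]
        rw [lintegral_const_mul' _ _ enorm_ne_top]
        refine (mul_le_mul_right (lintegral_stft_shift_le w s _ f k) _).trans ?_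
        rw [ENNReal.ofReal_mul (norm_nonneg _), ofReal_norm, mul_assoc]
        gcongr
        exact Finset.single_le_sum (f := fun j : ZMod q =>
          ∫⁻ p, ‖stft w (slice j f) p‖ₑ * ENNReal.ofReal (weightR s p))
          (fun _ _ => zero_le) (Finset.mem_univ _)
    _ = (∑' ν : S, ENNReal.ofReal (‖a ν‖ * weight s ((ν : D) : Phase q))) * C :=
        ENNReal.tsum_mul_right
    _ < ∞ := by
        refine ENNReal.mul_lt_top ?_ hCt
        have h := ha.comp_injective (Subtype.val_injective : Function.Injective ((↑) : S → D))
        exact lt_top_iff_ne_top.2 h.tsum_ofReal_ne_top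

theorem ftAlgebra_apply_mem {D : AddSubgroup (Phase q)} {w : 𝓢(ℝ, ℂ)} {s : ℝ≥0}
    {T : L2 q →L[ℂ] L2 q} (hT : T ∈ ftAlgebra D s) {f : L2 q} (hf : f ∈ M1 q w s) :
    T f ∈ M1 q w s := by
  rw [ftAlgebra, StarSubalgebra.copy_eq] at hT
  exact tfAlgebra_apply_mem hT hf

/-- The left action `T • f = T f` on `M¹_s(ℝ × ℤ_q)`. -/
instance tfModule (D : AddSubgroup (Phase q)) (w : 𝓢(ℝ, ℂ)) (s : ℝ≥0) :
    Module (tfAlgebra D s) (M1 q w s) where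
  smul T f := ⟨(T : L2 q →L[ℂ] L2 q) f, tfAlgebra_apply_mem T.2 f.2⟩
  one_smul _ := Subtype.ext rfl
  mul_smul _ _ _ := Subtype.ext rfl
  smul_zero T := Subtype.ext (map_zero (T : L2 q →L[ℂ] L2 q))
  smul_add T _ _ := Subtype.ext (map_add (T : L2 q →L[ℂ] L2 q) _ _)
  add_smul _ _ _ := Subtype.ext rfl
  zero_smul _ := Subtype.ext rfl

/-- The right action `f ⬝ T = T f` on `M¹_s(ℝ × ℤ_q)`. Acting from the right, the operators are
multiplied in the order in which they act: `f ⬝ (S T) = (f ⬝ S) ⬝ T = T (S f)`, so the algebra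
that acts from the right is `(ftAlgebra D s)ᵐᵒᵖ`. In Mathlib, a right `B`-module is a module
over `Bᵐᵒᵖ`. -/
instance ftModule (D : AddSubgroup (Phase q)) (w : 𝓢(ℝ, ℂ)) (s : ℝ≥0) :
    Module ((ftAlgebra D s)ᵐᵒᵖ)ᵐᵒᵖ (M1 q w s) where
  smul T f := ⟨(T.unop.unop : L2 q →L[ℂ] L2 q) f, ftAlgebra_apply_mem T.unop.unop.2 f.2⟩
  one_smul _ := Subtype.ext rfl
  mul_smul _ _ _ := Subtype.ext rfl
  smul_zero T := Subtype.ext (map_zero (T.unop.unop : L2 q →L[ℂ] L2 q))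
  smul_add T _ _ := Subtype.ext (map_add (T.unop.unop : L2 q →L[ℂ] L2 q) _ _)
  add_smul _ _ _ := Subtype.ext rfl
  zero_smul _ := Subtype.ext rfl

end Modulation

/-! ### Equivalence bimodules -/

open MulOpposite in
/-- `V` with `lip` and `rip` is an equivalence bimodule (in Rieffel's sense) between the unital
pre-C⋆-algebras `A`, acting from the left, and `B`, acting from the right; the order and the
norm are those of the enclosing C⋆-algebras. As the algebras are unital, fullness says that the
inner products span the whole algebra. -/
structure IsEquivalenceBimodule {A B V : Type*}
    [Ring A] [StarRing A] [Algebra ℂ A] [PartialOrder A] [Norm A]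
    [Ring B] [StarRing B] [Algebra ℂ B] [PartialOrder B] [Norm B]
    [AddCommGroup V] [Module ℂ V] [Module A V] [Module Bᵐᵒᵖ V]
    (lip : V → V → A) (rip : V → V → B) : Prop where
  algebraMap_smul_left : ∀ (c : ℂ) (f : V), algebraMap ℂ A c • f = c • f
  algebraMap_smul_right : ∀ (c : ℂ) (f : V), op (algebraMap ℂ B c) • f = c • f
  smul_comm : ∀ (a : A) (b : B) (f : V), op b • a • f = a • op b • f
  lip_add_left : ∀ f g h : V, lip (f + g) h = lip f h + lip g h
  lip_smul_left : ∀ (a : A) (f g : V), lip (a • f) g = a * lip f g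
  star_lip : ∀ f g : V, star (lip f g) = lip g f
  lip_self_nonneg : ∀ f : V, 0 ≤ lip f f
  lip_self_eq_zero : ∀ f : V, lip f f = 0 ↔ f = 0
  rip_add_right : ∀ f g h : V, rip f (g + h) = rip f g + rip f h
  rip_smul_right : ∀ (b : B) (f g : V), rip f (op b • g) = rip f g * b
  star_rip : ∀ f g : V, star (rip f g) = rip g f
  rip_self_nonneg : ∀ f : V, 0 ≤ rip f f
  rip_self_eq_zero : ∀ f : V, rip f f = 0 ↔ f = 0
  lip_adjoint : ∀ (b : B) (f g : V), lip (op b • f) g = lip f (op (star b) • g)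
  rip_adjoint : ∀ (a : A) (f g : V), rip (a • f) g = rip f (star a • g)
  lip_bounded : ∀ (b : B) (f : V), lip (op b • f) (op b • f) ≤ ((‖b‖ ^ 2 : ℝ) : ℂ) • lip f f
  rip_bounded : ∀ (a : A) (f : V), rip (a • f) (a • f) ≤ ((‖a‖ ^ 2 : ℝ) : ℂ) • rip f f
  lip_smul_eq_smul_rip : ∀ f g h : V, lip f g • h = op (rip g h) • f
  lip_full : Submodule.span ℂ (Set.range fun p : V × V => lip p.1 p.2) = ⊤
  rip_full : Submodule.span ℂ (Set.range fun p : V × V => rip p.1 p.2) = ⊤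

/-! ### The two algebras of the noncommutative torus -/

section Torus

variable (q : ℕ) [NeZero q] (r t : ℕ) (α β : ℝ) (s : ℝ≥0)

/-- The lattice `Λ × Γ` of the time-frequency plane, with `Λ = {(α n, r n)}` and
`Γ = {(β m, t m)}`. -/
abbrev gaborLattice : AddSubgroup (Phase q) := (lattice q α r).prod (lattice q β t)

/-- The adjoint lattice `Γ^⊥ × Λ^⊥`. -/
abbrev adjointLattice : AddSubgroup (Phase q) :=
  (annihilator (lattice q β t)).prod (annihilator (lattice q α r))

/-- The algebra `𝒜_s` of time-frequency shifts over `Λ × Γ`. -/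
abbrev algA : Type := tfAlgebra (gaborLattice q r t α β) s

/-- The operator algebra `𝒜_s°` of frequency-time shifts over `Γ^⊥ × Λ^⊥`, under composition. -/
abbrev algAo : Type := ftAlgebra (adjointLattice q r t α β) s

variable {q r t α β s}

/-- `T = ∑_{ν ∈ Λ × Γ} ⟨f, π(ν) g⟩ π(ν)` with coefficients in `ℓ¹_s(Λ × Γ)`. -/
def IsLeftInner (f g : L2 q) (T : algA q r t α β s) : Prop :=
  MemL1 (gaborLattice q r t α β) s (fun ν => ⟪tfShift (ν : Phase q) g, f⟫_ℂ) ∧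
    HasSum (fun ν : gaborLattice q r t α β =>
      ⟪tfShift (ν : Phase q) g, f⟫_ℂ • tfShift (ν : Phase q)) (T : L2 q →L[ℂ] L2 q)

/-- `T = (q |α β|)⁻¹ ∑_{ν ∈ Γ^⊥ × Λ^⊥} ⟨g, π°(ν) f⟩ π°(ν)` with coefficients in
`ℓ¹_s(Γ^⊥ × Λ^⊥)`. -/
def IsRightInner (f g : L2 q) (T : algAo q r t α β s) : Prop :=
  MemL1 (adjointLattice q r t α β) s
      (fun ν => ((q * |α * β| : ℝ) : ℂ)⁻¹ * ⟪ftShift (ν : Phase q) f, g⟫_ℂ) ∧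
    HasSum (fun ν : adjointLattice q r t α β =>
      (((q * |α * β| : ℝ) : ℂ)⁻¹ * ⟪ftShift (ν : Phase q) f, g⟫_ℂ) • ftShift (ν : Phase q))
      (T : L2 q →L[ℂ] L2 q)

end Torus

end GaborTorus

end

open MeasureTheory
open scoped NNReal ENNReal FourierTransform SchwartzMap InnerProductSpace

noncomputable section

namespace GaborTorus

/-! ### Morita contexts -/

section Morita

open MulOpposite CategoryTheory

/-! Everything rests on one identity. For f, g, h in the modulation space, ∑ ⟨f, π(ν)g⟩ π(ν)h over Λ
× Γ equals (q|αβ|)⁻¹ ∑ ⟨h, π(ν)g⟩ π(ν)f over Γ^⊥ × Λ^⊥ (`fundamental_identity`); this is the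
compatibility of the two inner products. For a fixed translation l ∈ Λ the coefficients ⟨f, π(l,
γ)g⟩ are the Fourier transform of f · conj g(· - l) at γ, so Poisson summation turns the sum over Γ
into a sum over Γ^⊥ (`IsWiener.poisson`, `walnut`). The resulting double sum over Λ and Γ^⊥ is
symmetric under exchange of the two lattices together with f and h. Coprimality makes the adjoint
lattice one of the same form whose own adjoint is the original one (`exists_adjointLattice_eq`).

The analytic input is inversion of the short-time Fourier transform. It bounds the transform by its
convolution with that of the window, which decays rapidly; hence the coefficients lie in ℓ¹_s
(`memL1_inner`). It also gives every element of the modulation space a continuous representative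
that is summable over translates (`exists_isWiener`), so that Poisson summation holds pointwise, and
it shows that the modulation space is dense in L².

Finitely many small bump functions generate a tight frame over any such lattice
(`exists_tightFrame`). This is the reproducing formula, hence finite generation and projectivity.
Read through the identity, a tight frame over the adjoint lattice says that ∑ of the inner products
of the g_i with themselves is a multiple of 1, which gives fullness. The identity also turns the
quadratic form of the inner product of f with itself into a sum of squares, which gives positivity
and definiteness; linearity over the algebras holds because shifts over the two lattices commute.
The norm bound uses a square root of ‖T‖² - T*T, which lies only in the closure of the algebra.
`DualPair` collects the facts in a form symmetric in both lattices, so each property is proved on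
one side only.

A full bimodule V and its conjugate form a Morita context with surjective pairings, and the functors
Hom out of V and out of its conjugate are mutually inverse. The order of multiplication on the
right-hand algebra does not matter, because T ↦ C T* C, with C complex conjugation, identifies it
with its opposite. -/

/-- A Morita context between the `k`-algebras `A` and `B`, given by an `A`-`B`-bimodule `P` and a
`B`-`A`-bimodule `Q`, both of whose pairings are surjective. -/
structure MoritaContext (k A B P Q : Type) [CommRing k] [Ring A] [Algebra k A] [Ring B]
    [Algebra k B] [AddCommGroup P] [AddCommGroup Q] [Module A P] [Module Bᵐᵒᵖ P] [Module B Q]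
    [Module Aᵐᵒᵖ Q] where
  pq : P → Q → A
  qp : Q → P → B
  comm_left : ∀ (a : A) (b : B) (p : P), op b • a • p = a • op b • p
  comm_right : ∀ (a : A) (b : B) (x : Q), op a • b • x = b • op a • x
  pq_add_left : ∀ p p' x, pq (p + p') x = pq p x + pq p' x
  pq_add_right : ∀ p x x', pq p (x + x') = pq p x + pq p x'
  qp_add_left : ∀ x x' p, qp (x + x') p = qp x p + qp x' p
  qp_add_right : ∀ x p p', qp x (p + p') = qp x p + qp x p'
  pq_smul_left : ∀ (a : A) p x, pq (a • p) x = a * pq p x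
  pq_smul_right : ∀ (a : A) p x, pq p (op a • x) = pq p x * a
  pq_balanced : ∀ (b : B) p x, pq (op b • p) x = pq p (b • x)
  qp_smul_left : ∀ (b : B) x p, qp (b • x) p = b * qp x p
  qp_smul_right : ∀ (b : B) x p, qp x (op b • p) = qp x p * b
  qp_balanced : ∀ (a : A) x p, qp (op a • x) p = qp x (a • p)
  assoc_left : ∀ p x p', pq p x • p' = op (qp x p') • p
  assoc_right : ∀ x p x', qp x p • x' = op (pq p x') • x
  pq_surj : ∃ (n : ℕ) (p : Fin n → P) (x : Fin n → Q), ∑ i, pq (p i) (x i) = 1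
  qp_surj : ∃ (n : ℕ) (x : Fin n → Q) (p : Fin n → P), ∑ i, qp (x i) (p i) = 1
  central_left : ∀ (c : k) (p : P), op (algebraMap k B c) • p = algebraMap k A c • p
  central_right : ∀ (c : k) (x : Q), op (algebraMap k A c) • x = algebraMap k B c • x

variable {k A B P Q : Type} [CommRing k] [Ring A] [Algebra k A] [Ring B] [Algebra k B]
  [AddCommGroup P] [AddCommGroup Q] [Module A P] [Module Bᵐᵒᵖ P] [Module B Q] [Module Aᵐᵒᵖ Q]

/-- Exchange of the two algebras of a Morita context. -/
def MoritaContext.swap (C : MoritaContext k A B P Q) : MoritaContext k B A Q P where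
  pq := C.qp
  qp := C.pq
  comm_left b a x := C.comm_right a b x
  comm_right b a p := C.comm_left a b p
  pq_add_left := C.qp_add_left
  pq_add_right := C.qp_add_right
  qp_add_left := C.pq_add_left
  qp_add_right := C.pq_add_right
  pq_smul_left := C.qp_smul_left
  pq_smul_right := C.qp_smul_right
  pq_balanced := C.qp_balanced
  qp_smul_left := C.pq_smul_left
  qp_smul_right := C.pq_smul_right
  qp_balanced := C.pq_balanced
  assoc_left := C.assoc_right
  assoc_right := C.assoc_left
  pq_surj := C.qp_surj
  qp_surj := C.pq_surj
  central_left := C.central_right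
  central_right := C.central_left

namespace MoritaContext

variable (C : MoritaContext k A B P Q)

/-- The additive group of `A`-linear maps from `P`, on which `B` acts through the right action
on `P`. -/
@[nolint unusedArguments]
def HomFrom (_ : MoritaContext k A B P Q) (N : Type) [AddCommGroup N] [Module A N] : Type :=
  P →ₗ[A] N

section

variable {N : Type} [AddCommGroup N] [Module A N]

instance : AddCommGroup (C.HomFrom N) := inferInstanceAs (AddCommGroup (P →ₗ[A] N))

instance : FunLike (C.HomFrom N) P N := inferInstanceAs (FunLike (P →ₗ[A] N) P N)

instance : LinearMapClass (C.HomFrom N) A P N := inferInstanceAs (LinearMapClass (P →ₗ[A] N) A P N)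

@[ext] lemma HomFrom.ext {φ ψ : C.HomFrom N} (h : ∀ p, φ p = ψ p) : φ = ψ := DFunLike.ext _ _ h

lemma HomFrom.add_apply (φ ψ : C.HomFrom N) (p : P) : (φ + ψ) p = φ p + ψ p := rfl

lemma HomFrom.sum_apply {ι : Type} (s : Finset ι) (φ : ι → C.HomFrom N) (p : P) :
    (∑ i ∈ s, φ i) p = ∑ i ∈ s, φ i p := LinearMap.sum_apply s φ p

instance : SMul B (C.HomFrom N) where
  smul b φ := (({ toFun := fun p => φ (op b • p)
                  map_add' := fun p p' => by rw [smul_add, map_add]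
                  map_smul' := fun a p => by
                    rw [C.comm_left, map_smul, RingHom.id_apply] } : P →ₗ[A] N))

lemma HomFrom.smul_apply (b : B) (φ : C.HomFrom N) (p : P) : (b • φ) p = φ (op b • p) := rfl

instance : Module B (C.HomFrom N) where
  one_smul φ := by ext p; rw [HomFrom.smul_apply, op_one, one_smul]
  mul_smul b b' φ := by
    ext p; rw [HomFrom.smul_apply, HomFrom.smul_apply, HomFrom.smul_apply, op_mul, mul_smul]
  smul_zero b := rfl
  smul_add b φ ψ := rfl
  add_smul b b' φ := by
    ext p
    rw [HomFrom.smul_apply, MulOpposite.op_add, add_smul, map_add, HomFrom.add_apply]; rfl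
  zero_smul φ := by
    ext p; rw [HomFrom.smul_apply, MulOpposite.op_zero, zero_smul, map_zero]; rfl

/-- The map `n ↦ (p ↦ ⟨p, x⟩ • n)`. -/
def evalAux (n : N) (x : Q) : C.HomFrom N :=
  (({ toFun := fun p => C.pq p x • n
      map_add' := fun p p' => by rw [C.pq_add_left, add_smul]
      map_smul' := fun a p => by rw [C.pq_smul_left, mul_smul, RingHom.id_apply] } : P →ₗ[A] N))

lemma evalAux_apply (n : N) (x : Q) (p : P) : C.evalAux n x p = C.pq p x • n := rfl

/-- The canonical map `N → Hom_B(Q, Hom_A(P, N))`. -/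
def unitMap (n : N) : C.swap.HomFrom (C.HomFrom N) :=
  (({ toFun := C.evalAux n
      map_add' := fun x x' => by
        ext p
        rw [evalAux_apply, C.pq_add_right, add_smul, HomFrom.add_apply]
        rfl
      map_smul' := fun b x => by
        ext p
        rw [RingHom.id_apply, HomFrom.smul_apply, evalAux_apply, evalAux_apply,
          C.pq_balanced] } : Q →ₗ[B] C.HomFrom N))

lemma unitMap_apply (n : N) (x : Q) (p : P) : C.unitMap n x p = C.pq p x • n := rfl

/-- The canonical map `N → Hom_B(Q, Hom_A(P, N))` is bijective. -/
def unitEquiv (N : Type) [AddCommGroup N] [Module A N] :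
    N ≃ₗ[A] C.swap.HomFrom (C.HomFrom N) :=
  LinearEquiv.ofBijective
    { toFun := C.unitMap
      map_add' := fun n n' => by
        ext x p
        rw [unitMap_apply, smul_add]
        rfl
      map_smul' := fun a n => by
        ext x p
        rw [unitMap_apply, RingHom.id_apply, HomFrom.smul_apply, unitMap_apply,
          C.pq_smul_right, mul_smul] } <| by
    -- Writing 1 = ∑ ⟨u_i, v_i⟩ shows that n is determined by the elements ⟨p, x⟩ n, which gives
    -- injectivity.
    obtain ⟨m, u, v, huv⟩ := C.pq_surj
    constructor
    · intro n n' h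
      have h' : ∀ x p, C.pq p x • n = C.pq p x • n' := fun x p => by
        rw [← unitMap_apply, ← unitMap_apply]
        exact DFunLike.congr_fun (DFunLike.congr_fun h x) p
      rw [← one_smul A n, ← one_smul A n', ← huv, Finset.sum_smul, Finset.sum_smul]
      exact Finset.sum_congr rfl fun i _ => h' _ _
    · intro Θ
      -- If Θ comes from n, then Θ(v_i)(u_i) = ⟨u_i, v_i⟩ n, and these sum to n.
      refine ⟨∑ i, Θ (v i) (u i), ?_⟩
      ext x p
      change C.pq p x • (∑ i, Θ (v i) (u i)) = Θ x p
      rw [Finset.smul_sum]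
      calc ∑ i, C.pq p x • Θ (v i) (u i)
          = ∑ i, Θ (op (C.pq (u i) (v i)) • x) p := by
            refine Finset.sum_congr rfl fun i _ => ?_
            -- Both associativity laws are used: ⟨p, x⟩ u_i = p ⟨x, u_i⟩ moves the scalar from P to
            -- Q, and ⟨x, u_i⟩ v_i = x ⟨u_i, v_i⟩ collects the sum equal to 1.
            rw [← map_smul, C.assoc_left, ← HomFrom.smul_apply, ← map_smul, C.assoc_right]
        _ = Θ x p := by
            rw [← HomFrom.sum_apply, ← map_sum, ← Finset.sum_smul, ← Finset.op_sum, huv, op_one, one_smul]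

end

/-- The functor `N ↦ Hom_A(P, N)`. -/
def functor : ModuleCat.{0} A ⥤ ModuleCat.{0} B where
  obj N := ModuleCat.of B (C.HomFrom N)
  map {N N'} φ := ModuleCat.ofHom
    { toFun := fun ψ => (φ.hom.comp (show P →ₗ[A] N from ψ) : P →ₗ[A] N')
      map_add' := fun _ _ => LinearMap.comp_add _ _ _
      map_smul' := fun _ _ => rfl }
  map_id _ := rfl
  map_comp _ _ := rfl

/-- `𝟭 ≅ Hom_B(Q, Hom_A(P, ·))`. -/
def unitIso : 𝟭 (ModuleCat.{0} A) ≅ C.functor ⋙ C.swap.functor :=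
  NatIso.ofComponents (fun N => (C.unitEquiv N).toModuleIso) fun {N N'} φ => by
    ext n
    refine HomFrom.ext C.swap fun (x : Q) => HomFrom.ext C fun (p : P) => ?_
    exact (map_smul φ.hom (C.pq p x) n).symm

/-- The equivalence of module categories given by a Morita context. -/
def equivalence : ModuleCat.{0} A ≌ ModuleCat.{0} B :=
  -- The counit is the unit of the swapped context, inverted. `Equivalence.mk` corrects the unit, so
  -- no triangle identity has to be checked.
  CategoryTheory.Equivalence.mk C.functor C.swap.functor C.unitIso C.swap.unitIso.symm

open ModuleCat.Algebra in
-- Linearity is where centrality enters: a scalar acts on Hom(P, N) through the right action on P,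
-- and on N through A, and these agree because both algebras induce the same scalar action on P.
theorem isMoritaEquivalent (C : MoritaContext k A B P Q) : IsMoritaEquivalent k A B where
  cond := ⟨{
    eqv := C.equivalence
    linear := { map_smul := fun {N N'} φ c => by
                  ext ψ
                  refine HomFrom.ext C fun (p : P) => ?_
                  change algebraMap k A c • φ.hom ((show P →ₗ[A] N from ψ) p) =
                    φ.hom ((show P →ₗ[A] N from ψ) (op (algebraMap k B c) • p))
                  rw [C.central_left, map_smul, map_smul] } }⟩

end MoritaContext

end Morita

/-! ### Inversion of the short-time Fourier transform -/

section Inversion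

open Filter Topology

/-- Fourier inversion almost everywhere, for an integrable function with integrable Fourier
transform. -/
theorem fourierInv_fourier_ae_eq {f : ℝ → ℂ} (hf : Integrable f) (hf' : Integrable (𝓕 f)) :
    ∀ᵐ t, 𝓕⁻ (𝓕 f) t = f t := by
  have hcont : Continuous (𝓕⁻ (𝓕 f)) := by
    rw [Real.fourierInv_eq_fourier_comp_neg]
    exact VectorFourier.fourierIntegral_continuous Real.continuous_fourierChar
      (L := innerₗ ℝ) continuous_inner hf'.comp_neg
  -- Both sides are tested against compactly supported smooth functions. The flip formula moves the
  -- two transforms onto the test function, where inversion is known for Schwartz functions.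
  refine ae_eq_of_integral_contDiff_smul_eq hcont.locallyIntegrable hf.locallyIntegrable ?_
  intro φ hφ hφc
  have h1 : HasCompactSupport (fun x => (φ x : ℂ)) := hφc.comp_left (g := ((↑) : ℝ → ℂ)) rfl
  have h2 : ContDiff ℝ ((⊤ : ℕ∞) : WithTop ℕ∞) (fun x => (φ x : ℂ)) := Complex.ofRealCLM.contDiff.comp hφ
  let ψ : 𝓢(ℝ, ℂ) := h1.toSchwartzMap h2
  have hψ : ∀ x, ψ x = (φ x : ℂ) := fun x => rfl
  have e1 : ∀ g : ℝ → ℂ, ∫ x, φ x • g x = ∫ x, g x * ψ x := fun g => by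
    refine integral_congr_ae (Eventually.of_forall fun x => ?_)
    simp only [hψ, Complex.real_smul, mul_comm]
  have flip : ∀ {u v : ℝ → ℂ}, Integrable u → Integrable v →
      ∫ x, 𝓕 u x * v x = ∫ x, u x * 𝓕 v x := fun {u v} hu hv => by
    simpa using! (VectorFourier.integral_fourierIntegral_smul_eq_flip (L := innerₗ ℝ)
      Real.continuous_fourierChar continuous_inner hu hv)
  rw [e1, e1]
  have hψi : Integrable (fun x => ψ (-x)) := ψ.integrable.comp_neg
  have hψF : 𝓕 (fun x => ψ (-x)) = 𝓕⁻ (ψ : ℝ → ℂ) := (Real.fourierInv_eq_fourier_comp_neg _).symm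
  have hψFi : Integrable (𝓕⁻ (ψ : ℝ → ℂ)) := by
    rw [← SchwartzMap.fourierInv_coe]
    exact (𝓕⁻ ψ).integrable
  calc ∫ x, 𝓕⁻ (𝓕 f) x * ψ x = ∫ x, 𝓕 (𝓕 f) (-x) * ψ x := by
        simp only [Real.fourierInv_eq_fourier_neg]
    _ = ∫ x, 𝓕 (𝓕 f) x * ψ (-x) := by
        rw [← integral_neg_eq_self]
        simp only [neg_neg]
    _ = ∫ x, f x * 𝓕 (𝓕⁻ (ψ : ℝ → ℂ)) x := by
        rw [flip hf' hψi, hψF, flip hf hψFi]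
    _ = _ := by
        rw [← SchwartzMap.fourierInv_coe, ← SchwartzMap.fourier_coe,
          FourierTransform.fourier_fourierInv_eq]

/-- The time-frequency shift `t ↦ exp (2πi t ω) w(t - x)` of the window. -/
def atom (w : 𝓢(ℝ, ℂ)) (p : ℝ × ℝ) (t : ℝ) : ℂ := ((𝐞 (t * p.2) : Circle) : ℂ) * w (t - p.1)

/-- The synthesis `t ↦ ∫ F(x, ω) exp (2πi t ω) w(t - x) dx dω`. -/
def synth (w : 𝓢(ℝ, ℂ)) (F : ℝ × ℝ → ℂ) (t : ℝ) : ℂ := ∫ p, F p * atom w p t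

lemma continuous_atom (w : 𝓢(ℝ, ℂ)) : Continuous fun z : ℝ × (ℝ × ℝ) => atom w z.2 z.1 := by
  have h1 : Continuous fun z : ℝ × (ℝ × ℝ) => ((𝐞 (z.1 * z.2.2) : Circle) : ℂ) :=
    continuous_induced_dom.comp (Real.continuous_fourierChar.comp (by fun_prop))
  have h2 : Continuous fun z : ℝ × (ℝ × ℝ) => w (z.1 - z.2.1) := w.continuous.comp (by fun_prop)
  exact h1.mul h2

lemma continuous_atom_left (w : 𝓢(ℝ, ℂ)) (p : ℝ × ℝ) : Continuous (atom w p) :=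
  (continuous_atom w).comp (by fun_prop : Continuous fun t : ℝ => (t, p))

lemma continuous_atom_right (w : 𝓢(ℝ, ℂ)) (t : ℝ) : Continuous fun p => atom w p t :=
  (continuous_atom w).comp (by fun_prop : Continuous fun p : ℝ × ℝ => (t, p))

lemma norm_atom (w : 𝓢(ℝ, ℂ)) (p : ℝ × ℝ) (t : ℝ) : ‖atom w p t‖ = ‖w (t - p.1)‖ := by
  rw [atom, norm_mul, Circle.norm_coe, one_mul]

lemma exists_bound (w : 𝓢(ℝ, ℂ)) : ∃ C, ∀ t, ‖w t‖ ≤ C :=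
  ⟨_, fun t => SchwartzMap.norm_le_seminorm ℝ w t⟩

lemma integrable_mul_atom (w : 𝓢(ℝ, ℂ)) {F : ℝ × ℝ → ℂ} (hF : Integrable F) (t : ℝ) :
    Integrable fun p => F p * atom w p t := by
  obtain ⟨C, hC⟩ := exists_bound w
  exact hF.mul_bdd (continuous_atom_right w t).aestronglyMeasurable
    (Eventually.of_forall fun p => (norm_atom w p t).trans_le (hC _))

lemma stft_eq_fourier (w : 𝓢(ℝ, ℂ)) (f : Lp ℂ 2 (volume : Measure ℝ)) (x ω : ℝ) :
    stft w f (x, ω) = 𝓕 (fun t => f t * (starRingEnd ℂ) (w (t - x))) ω := by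
  rw [stft, Real.fourier_real_eq]
  refine integral_congr_ae (Eventually.of_forall fun t => ?_)
  simp only [Circle.smul_def, smul_eq_mul, AddChar.map_neg_eq_inv, Circle.coe_inv_eq_conj, map_mul]
  ring

lemma integrable_mul_conj_window (w : 𝓢(ℝ, ℂ)) (f : Lp ℂ 2 (volume : Measure ℝ)) (x : ℝ) :
    Integrable fun t => f t * (starRingEnd ℂ) (w (t - x)) := by
  have h : MemLp (fun t : ℝ => w (t - x)) 2 (volume : Measure ℝ) :=
    (w.memLp 2 volume).comp_measurePreserving (measurePreserving_sub_right volume x)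
  exact MemLp.integrable_mul (p := 2) (q := 2) (Lp.memLp f) h.star

/-- The squared `L²`-norm of the window. -/
def windowSq (w : 𝓢(ℝ, ℂ)) : ℝ := ∫ t, ‖w t‖ ^ 2

lemma windowSq_pos {w : 𝓢(ℝ, ℂ)} (hw : w ≠ 0) : 0 < windowSq w := by
  have hc : Continuous fun t => ‖w t‖ ^ 2 := by
    have := w.continuous
    fun_prop
  have hi : Integrable fun t => ‖w t‖ ^ 2 := (w.memLp 2 volume).integrable_norm_pow two_ne_zero
  obtain ⟨t, ht⟩ : ∃ t, w t ≠ 0 := by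
    by_contra! h
    exact hw (SchwartzMap.ext h)
  exact (integral_pos_iff_support_of_nonneg (fun t => by positivity) hi).2
    (hc.isOpen_support.measure_pos _ ⟨t, by simpa using ht⟩)

/-- Reconstruction of `f` from an integrable short-time Fourier transform. -/
theorem stft_inversion (w : 𝓢(ℝ, ℂ)) (f : Lp ℂ 2 (volume : Measure ℝ))
    (hf : Integrable (stft w f)) : ∀ᵐ t, synth w (stft w f) t = windowSq w * f t := by
  have h1 : ∀ᵐ x : ℝ, Integrable fun ω => stft w f (x, ω) := Integrable.prod_right_ae hf
  -- For fixed x the short-time transform is the Fourier transform in ω of f · conj w(· - x), and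
  -- this product is integrable.
  have h2 : ∀ᵐ x : ℝ, ∀ᵐ t : ℝ, ∫ ω, ((𝐞 (t * ω) : Circle) : ℂ) * stft w f (x, ω)
      = f t * (starRingEnd ℂ) (w (t - x)) := by
    filter_upwards [h1] with x hx
    simp only [stft_eq_fourier] at hx ⊢
    filter_upwards [fourierInv_fourier_ae_eq (integrable_mul_conj_window w f x) hx] with t ht
    rw [← ht, Real.fourierInv_eq']
    refine integral_congr_ae (Eventually.of_forall fun ω => ?_)
    simp only [smul_eq_mul, Real.fourierChar_apply]
    congr 2
  -- Measurability of the exceptional set is what allows "for a.e. x, for a.e. t" to be exchanged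
  -- for "for a.e. t, for a.e. x".
  have hm : MeasurableSet {z : ℝ × ℝ | ∫ ω, ((𝐞 (z.2 * ω) : Circle) : ℂ) * stft w f (z.1, ω)
      = f z.2 * (starRingEnd ℂ) (w (z.2 - z.1))} := by
    refine measurableSet_eq_fun ?_ ?_
    · refine (StronglyMeasurable.integral_prod_right' (f := fun y : (ℝ × ℝ) × ℝ =>
        ((𝐞 (y.1.2 * y.2) : Circle) : ℂ) * stft w f (y.1.1, y.2)) ?_).measurable
      have h1 : Continuous fun y : (ℝ × ℝ) × ℝ => ((𝐞 (y.1.2 * y.2) : Circle) : ℂ) :=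
        continuous_induced_dom.comp (Real.continuous_fourierChar.comp (by fun_prop))
      exact h1.stronglyMeasurable.mul
        ((stronglyMeasurable_stft w f).comp_measurable (by fun_prop))
    · have h2 : Continuous fun z : ℝ × ℝ => (starRingEnd ℂ) (w (z.2 - z.1)) :=
        Complex.continuous_conj.comp (w.continuous.comp (by fun_prop))
      exact ((Lp.stronglyMeasurable f).measurable.comp measurable_snd).mul h2.measurable
  have h3 := (Measure.ae_ae_comm hm).1 h2
  filter_upwards [h3] with t ht
  have e1 : synth w (stft w f) t = ∫ x, ∫ ω, stft w f (x, ω) * atom w (x, ω) t :=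
    integral_prod _ (integrable_mul_atom w hf t)
  have e2 : ∫ x, (f t * (starRingEnd ℂ) (w (t - x))) * w (t - x) = windowSq w * f t := by
    have e3 : ∀ x, (f t * (starRingEnd ℂ) (w (t - x))) * w (t - x)
        = ((‖w (t - x)‖ ^ 2 : ℝ) : ℂ) * f t := fun x => by
      rw [mul_assoc, Complex.conj_mul', mul_comm]
      push_cast
      rfl
    simp only [e3]
    rw [integral_mul_const, integral_complex_ofReal, windowSq,
      integral_sub_left_eq_self (fun y => ‖w y‖ ^ 2)]
  rw [e1, ← e2]
  refine integral_congr_ae ?_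
  filter_upwards [ht] with x hx
  rw [← hx, ← integral_mul_const]
  refine integral_congr_ae (Eventually.of_forall fun ω => ?_)
  simp only [atom]
  ring

/-- The synthesis of an integrable function is integrable. -/
lemma integrable_synth_aux (w : 𝓢(ℝ, ℂ)) {F : ℝ × ℝ → ℂ} (hF : Integrable F) :
    Integrable (fun z : ℝ × (ℝ × ℝ) => F z.2 * atom w z.2 z.1)
      ((volume : Measure ℝ).prod (volume : Measure (ℝ × ℝ))) := by
  have hm : AEStronglyMeasurable (fun z : ℝ × (ℝ × ℝ) => F z.2 * atom w z.2 z.1)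
      ((volume : Measure ℝ).prod (volume : Measure (ℝ × ℝ))) :=
    (hF.aestronglyMeasurable.comp_snd).mul (continuous_atom w).aestronglyMeasurable
  refine (integrable_prod_iff' hm).2 ⟨Eventually.of_forall fun p => ?_, ?_⟩
  · refine Integrable.const_mul ?_ (F p)
    refine (w.integrable.comp_sub_right p.1).mono (continuous_atom_left w p).aestronglyMeasurable
      (Eventually.of_forall fun t => (norm_atom w p t).le)
  · have : ∀ p : ℝ × ℝ, ∫ t, ‖F p * atom w p t‖ = ‖F p‖ * ∫ t, ‖w t‖ := fun p => by
      simp only [norm_mul, norm_atom, integral_const_mul]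
      rw [integral_sub_right_eq_self (fun y => ‖w y‖)]
    simp only [this]
    exact hF.norm.mul_const _

lemma integrable_synth (w : 𝓢(ℝ, ℂ)) {F : ℝ × ℝ → ℂ} (hF : Integrable F) :
    Integrable (synth w F) := (integrable_synth_aux w hF).integral_prod_left

lemma continuous_synth (w : 𝓢(ℝ, ℂ)) {F : ℝ × ℝ → ℂ} (hF : Integrable F) :
    Continuous (synth w F) := by
  obtain ⟨C, hC⟩ := exists_bound w
  refine continuous_of_dominated (bound := fun p => ‖F p‖ * C) (fun t => ?_) (fun t => ?_) ?_ ?_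
  · exact (integrable_mul_atom w hF t).aestronglyMeasurable
  · refine Eventually.of_forall fun p => ?_
    rw [norm_mul, norm_atom]
    exact mul_le_mul_of_nonneg_left (hC _) (norm_nonneg _)
  · exact hF.norm.mul_const _
  · exact Eventually.of_forall fun p => continuous_const.mul (continuous_atom_left w p)

lemma norm_synth_le (w : 𝓢(ℝ, ℂ)) (F : ℝ × ℝ → ℂ) (t : ℝ) :
    ‖synth w F t‖ₑ ≤ ∫⁻ p, ‖F p‖ₑ * ‖w (t - p.1)‖ₑ := by
  refine (enorm_integral_le_lintegral_enorm _).trans_eq ?_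
  refine lintegral_congr fun p => ?_
  rw [enorm_mul, ← ofReal_norm (atom w p t), norm_atom, ofReal_norm]

/-- Duality of analysis and synthesis. -/
lemma integral_conj_mul_synth (w : 𝓢(ℝ, ℂ)) {F : ℝ × ℝ → ℂ} (hF : Integrable F)
    (u : Lp ℂ 2 (volume : Measure ℝ)) (hu : Integrable u) :
    ∫ t, (starRingEnd ℂ) (u t) * synth w F t
      = ∫ p, F p * (starRingEnd ℂ) (stft w u p) := by
  obtain ⟨C, hC⟩ := exists_bound w
  have hu' : Integrable fun t => (starRingEnd ℂ) (u t) :=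
    (LinearIsometryEquiv.integrable_comp_iff Complex.conjLIE).2 hu
  have hi : Integrable (fun z : ℝ × (ℝ × ℝ) =>
      ((starRingEnd ℂ) (u z.1) * F z.2) * atom w z.2 z.1)
      ((volume : Measure ℝ).prod (volume : Measure (ℝ × ℝ))) :=
    Integrable.mul_bdd (c := C)
      (Integrable.mul_prod hu' hF)
      (continuous_atom w).aestronglyMeasurable
      (Eventually.of_forall fun z => (norm_atom w z.2 z.1).trans_le (hC _))
  calc ∫ t, (starRingEnd ℂ) (u t) * synth w F t
      = ∫ t, ∫ p, ((starRingEnd ℂ) (u t) * F p) * atom w p t := by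
        refine integral_congr_ae (Eventually.of_forall fun t => ?_)
        simp only [synth, ← integral_const_mul, mul_assoc]
    _ = ∫ p, ∫ t, ((starRingEnd ℂ) (u t) * F p) * atom w p t := integral_integral_swap hi
    _ = _ := by
        refine integral_congr_ae (Eventually.of_forall fun p => ?_)
        simp only
        rw [stft, ← integral_conj, ← integral_const_mul]
        refine integral_congr_ae (Eventually.of_forall fun t => ?_)
        simp only [map_mul, Complex.conj_conj, atom]
        ring

/-- Inversion exhibits f as a multiple of a synthesis, and a synthesis is integrable by Fubini. This
is the integrability that the duality formula asks of its first argument. -/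
lemma integrable_of_integrable_stft {w : 𝓢(ℝ, ℂ)} (hw : w ≠ 0)
    {f : Lp ℂ 2 (volume : Measure ℝ)} (hf : Integrable (stft w f)) : Integrable f := by
  refine ((integrable_synth w hf).const_mul ((windowSq w : ℂ)⁻¹)).congr ?_
  filter_upwards [stft_inversion w f hf] with t ht
  have : (windowSq w : ℂ) ≠ 0 := by exact_mod_cast (windowSq_pos hw).ne'
  rw [ht, inv_mul_cancel_left₀ this]

/-- The convolution-type bound of an inner product by short-time Fourier transforms. -/
lemma enorm_inner_le {w : 𝓢(ℝ, ℂ)} (hw : w ≠ 0) {u v : Lp ℂ 2 (volume : Measure ℝ)}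
    (hu : Integrable u) (hv : Integrable (stft w v)) :
    ‖⟪u, v⟫_ℂ‖ₑ ≤ ENNReal.ofReal (windowSq w)⁻¹ * ∫⁻ p, ‖stft w v p‖ₑ * ‖stft w u p‖ₑ := by
  have h0 : (windowSq w : ℂ) ≠ 0 := by exact_mod_cast (windowSq_pos hw).ne'
  have e : ⟪u, v⟫_ℂ = (windowSq w : ℂ)⁻¹ * ∫ p, stft w v p * (starRingEnd ℂ) (stft w u p) := by
    rw [← integral_conj_mul_synth w hv u hu, L2.inner_def, ← integral_const_mul]
    refine integral_congr_ae ?_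
    filter_upwards [stft_inversion w v hv] with t ht
    rw [ht, RCLike.inner_apply]
    field_simp
  rw [e, enorm_mul]
  refine mul_le_mul' (le_of_eq ?_) ((enorm_integral_le_lintegral_enorm _).trans_eq ?_)
  · rw [← ofReal_norm, norm_inv, Complex.norm_real, Real.norm_of_nonneg (windowSq_pos hw).le]
  · refine lintegral_congr fun p => ?_
    rw [enorm_mul]
    congr 1
    rw [← ofReal_norm, RCLike.norm_conj, ofReal_norm]

end Inversion

/-! ### Decay of the short-time Fourier transform of Schwartz functions -/

section Decay

open Filter Topology

/-- The product `t ↦ φ(t) conj w(t - x)` whose Fourier transform is the short-time Fourier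
transform of `φ` at time `x`. -/
def windowed (w φ : 𝓢(ℝ, ℂ)) (x t : ℝ) : ℂ := φ t * (starRingEnd ℂ) (w (t - x))

lemma hasDerivAt_windowed (w φ : 𝓢(ℝ, ℂ)) (x t : ℝ) :
    HasDerivAt (windowed w φ x) (windowed w (SchwartzMap.derivCLM ℂ ℂ φ) x t +
      windowed (SchwartzMap.derivCLM ℂ ℂ w) φ x t) t := by
  have h1 := φ.hasDerivAt t
  have h2 : HasDerivAt (fun t => w (t - x)) (deriv w (t - x)) t :=
    (w.hasDerivAt (t - x)).comp_sub_const t x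
  exact h1.mul h2.star

lemma continuous_windowed (w φ : 𝓢(ℝ, ℂ)) (x : ℝ) : Continuous (windowed w φ x) :=
  continuous_iff_continuousAt.2 fun t => (hasDerivAt_windowed w φ x t).continuousAt

lemma norm_windowed (w φ : 𝓢(ℝ, ℂ)) (x t : ℝ) : ‖windowed w φ x t‖ = ‖φ t‖ * ‖w (t - x)‖ := by
  rw [windowed, norm_mul, RCLike.norm_conj]

lemma integrable_windowed (w φ : 𝓢(ℝ, ℂ)) (x : ℝ) : Integrable (windowed w φ x) := by
  obtain ⟨C, hC⟩ := exists_bound w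
  refine (φ.integrable.norm.mul_const C).mono' (continuous_windowed w φ x).aestronglyMeasurable
    (Eventually.of_forall fun t => ?_)
  rw [norm_windowed]
  exact mul_le_mul_of_nonneg_left (hC _) (norm_nonneg _)

lemma stft_toLp (w φ : 𝓢(ℝ, ℂ)) (p : ℝ × ℝ) :
    stft w (φ.toLp 2 volume) p = 𝓕 (windowed w φ p.1) p.2 := by
  rw [show p = (p.1, p.2) from rfl, stft_eq_fourier]
  refine Real.fourier_congr_ae ?_ _
  filter_upwards [φ.coeFn_toLp 2 volume] with t ht
  rw [ht, windowed]

/-- Since |x| ≤ |t| + |t - x|, a power of |x| is absorbed under the integral by the decay of φ at t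
or of w at t - x. -/
lemma exists_decay_time (a : ℕ) (w φ : 𝓢(ℝ, ℂ)) :
    ∃ C, ∀ x ω : ℝ, |x| ^ a * ‖𝓕 (windowed w φ x) ω‖ ≤ C := by
  obtain ⟨C, hC⟩ := exists_bound w
  set D := SchwartzMap.seminorm ℝ a 0 w
  have hD : ∀ t, |t| ^ a * ‖w t‖ ≤ D := fun t => SchwartzMap.norm_pow_mul_le_seminorm ℝ w a t
  refine ⟨∫ t, 2 ^ (a - 1) * (C * (|t| ^ a * ‖φ t‖) + D * ‖φ t‖), fun x ω => ?_⟩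
  calc |x| ^ a * ‖𝓕 (windowed w φ x) ω‖ ≤ |x| ^ a * ∫ t, ‖windowed w φ x t‖ :=
        mul_le_mul_of_nonneg_left
          (VectorFourier.norm_fourierIntegral_le_integral_norm _ _ _ _ _) (by positivity)
    _ = ∫ t, |x| ^ a * ‖windowed w φ x t‖ := (integral_const_mul _ _).symm
    _ ≤ _ := by
        refine integral_mono ((integrable_windowed w φ x).norm.const_mul _)
          ((((φ.integrable_pow_mul volume a).const_mul _).add
            (φ.integrable.norm.const_mul _)).const_mul _) fun t => ?_
        have h1 : |x| ≤ |t| + |t - x| := by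
          have := abs_sub t (t - x)
          rwa [sub_sub_cancel] at this
        have h2 : |x| ^ a ≤ 2 ^ (a - 1) * (|t| ^ a + |t - x| ^ a) :=
          (pow_le_pow_left₀ (abs_nonneg x) h1 a).trans (add_pow_le (abs_nonneg _) (abs_nonneg _) a)
        rw [norm_windowed]
        calc |x| ^ a * (‖φ t‖ * ‖w (t - x)‖)
            ≤ 2 ^ (a - 1) * (|t| ^ a + |t - x| ^ a) * (‖φ t‖ * ‖w (t - x)‖) :=
              mul_le_mul_of_nonneg_right h2 (by positivity)
          _ = 2 ^ (a - 1) * (‖w (t - x)‖ * (|t| ^ a * ‖φ t‖)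
                + (|t - x| ^ a * ‖w (t - x)‖) * ‖φ t‖) := by ring
          _ ≤ _ := by
              gcongr
              · exact hC _
              · exact hD _

/-- A factor ω becomes a derivative, which the product rule puts on φ or on w; both stay Schwartz
functions. -/
lemma fourier_windowed_deriv (w φ : 𝓢(ℝ, ℂ)) (x ω : ℝ) :
    (2 * Real.pi * Complex.I * ω) * 𝓕 (windowed w φ x) ω
      = 𝓕 (windowed w (SchwartzMap.derivCLM ℂ ℂ φ) x) ω
        + 𝓕 (windowed (SchwartzMap.derivCLM ℂ ℂ w) φ x) ω := by
  have hd : deriv (windowed w φ x) = windowed w (SchwartzMap.derivCLM ℂ ℂ φ) x +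
      windowed (SchwartzMap.derivCLM ℂ ℂ w) φ x :=
    funext fun t => (hasDerivAt_windowed w φ x t).deriv
  have hi : Integrable (deriv (windowed w φ x)) := by
    rw [hd]
    exact (integrable_windowed _ _ x).add (integrable_windowed _ _ x)
  have h := congrFun (Real.fourier_deriv (integrable_windowed w φ x)
    (fun t => (hasDerivAt_windowed w φ x t).differentiableAt) hi) ω
  rw [smul_eq_mul] at h
  rw [← h, hd]
  exact congrFun (VectorFourier.fourierIntegral_add Real.continuous_fourierChar
    (L := innerₗ ℝ) continuous_inner (integrable_windowed _ _ x) (integrable_windowed _ _ x)) ω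

/-- Each factor of |ω| is traded for a derivative of φ or of w. The induction on b therefore
quantifies over both functions. -/
lemma exists_decay (a b : ℕ) : ∀ w φ : 𝓢(ℝ, ℂ),
    ∃ C, ∀ x ω : ℝ, |x| ^ a * |ω| ^ b * ‖𝓕 (windowed w φ x) ω‖ ≤ C := by
  induction b with
  | zero => simpa using exists_decay_time a
  | succ b ih =>
    intro w φ
    obtain ⟨C₁, h₁⟩ := ih w (SchwartzMap.derivCLM ℂ ℂ φ)
    obtain ⟨C₂, h₂⟩ := ih (SchwartzMap.derivCLM ℂ ℂ w) φ
    refine ⟨C₁ + C₂, fun x ω => ?_⟩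
    have e : |ω| * ‖𝓕 (windowed w φ x) ω‖ ≤ ‖(2 * Real.pi * Complex.I * ω) *
        𝓕 (windowed w φ x) ω‖ := by
      rw [norm_mul]
      refine mul_le_mul_of_nonneg_right ?_ (norm_nonneg _)
      simp only [norm_mul, Complex.norm_I, Complex.norm_real, Real.norm_eq_abs, mul_one,
        Complex.norm_ofNat, abs_of_pos Real.pi_pos]
      have : (1 : ℝ) ≤ 2 * Real.pi := by linarith [Real.pi_gt_three]
      exact le_mul_of_one_le_left (abs_nonneg _) this
    rw [fourier_windowed_deriv] at e
    calc |x| ^ a * |ω| ^ (b + 1) * ‖𝓕 (windowed w φ x) ω‖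
        = |x| ^ a * |ω| ^ b * (|ω| * ‖𝓕 (windowed w φ x) ω‖) := by ring
      _ ≤ |x| ^ a * |ω| ^ b * (‖𝓕 (windowed w (SchwartzMap.derivCLM ℂ ℂ φ) x) ω‖ +
            ‖𝓕 (windowed (SchwartzMap.derivCLM ℂ ℂ w) φ x) ω‖) :=
          mul_le_mul_of_nonneg_left (e.trans (norm_add_le _ _)) (by positivity)
      _ ≤ C₁ + C₂ := by
          rw [mul_add]
          exact add_le_add (h₁ x ω) (h₂ x ω)

lemma exists_decay_one_add (m : ℕ) (w φ : 𝓢(ℝ, ℂ)) :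
    ∃ C, 0 ≤ C ∧ ∀ p : ℝ × ℝ,
      ((1 + |p.1|) * (1 + |p.2|)) ^ m * ‖stft w (φ.toLp 2 volume) p‖ ≤ C := by
  obtain ⟨C₁, h₁⟩ := exists_decay 0 0 w φ
  obtain ⟨C₂, h₂⟩ := exists_decay m 0 w φ
  obtain ⟨C₃, h₃⟩ := exists_decay 0 m w φ
  obtain ⟨C₄, h₄⟩ := exists_decay m m w φ
  have key : ∀ p : ℝ × ℝ, ((1 + |p.1|) * (1 + |p.2|)) ^ m * ‖stft w (φ.toLp 2 volume) p‖
      ≤ (2 ^ (m - 1) * 2 ^ (m - 1)) * (C₁ + C₂ + C₃ + C₄) := fun p => by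
    rw [stft_toLp]
    set N := ‖𝓕 (windowed w φ p.1) p.2‖ with hN
    have e₁ := h₁ p.1 p.2
    have e₂ := h₂ p.1 p.2
    have e₃ := h₃ p.1 p.2
    have e₄ := h₄ p.1 p.2
    rw [← hN] at e₁ e₂ e₃ e₄
    have b₁ : (1 + |p.1|) ^ m ≤ 2 ^ (m - 1) * (1 + |p.1| ^ m) := by
      simpa using add_pow_le zero_le_one (abs_nonneg p.1) m
    have b₂ : (1 + |p.2|) ^ m ≤ 2 ^ (m - 1) * (1 + |p.2| ^ m) := by
      simpa using add_pow_le zero_le_one (abs_nonneg p.2) m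
    rw [mul_pow]
    calc (1 + |p.1|) ^ m * (1 + |p.2|) ^ m * N
        ≤ (2 ^ (m - 1) * (1 + |p.1| ^ m)) * (2 ^ (m - 1) * (1 + |p.2| ^ m)) * N := by
          gcongr
      _ = (2 ^ (m - 1) * 2 ^ (m - 1)) * (|p.1| ^ 0 * |p.2| ^ 0 * N + |p.1| ^ m * |p.2| ^ 0 * N
            + |p.1| ^ 0 * |p.2| ^ m * N + |p.1| ^ m * |p.2| ^ m * N) := by ring
      _ ≤ _ := by gcongr
  exact ⟨_, le_trans (by positivity) (key 0), key⟩

/-- The quadratically decaying kernel `(1 + |x|)⁻²`. -/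
def dec (x : ℝ) : ℝ≥0∞ := ENNReal.ofReal ((1 + |x|) ^ 2)⁻¹

lemma measurable_dec : Measurable dec := by
  unfold dec
  fun_prop

/-- This is 1 + |u + v| ≤ (1 + |u|)(1 + |v|): a bounded shift of the argument costs only a constant
factor. -/
lemma dec_le (u v : ℝ) : dec u ≤ ENNReal.ofReal ((1 + |v|) ^ 2) * dec (u + v) := by
  have hu := abs_nonneg u
  have hv := abs_nonneg v
  have huv := abs_nonneg (u + v)
  rw [dec, dec, ← ENNReal.ofReal_mul (by positivity)]
  refine ENNReal.ofReal_le_ofReal ?_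
  rw [← div_eq_mul_inv, le_div_iff₀ (by positivity), inv_mul_le_iff₀ (by positivity), ← mul_pow]
  refine pow_le_pow_left₀ (by positivity) ?_ 2
  have := abs_add_le u v
  nlinarith [mul_nonneg hu hv]

lemma lintegral_dec_lt_top : ∫⁻ x, dec x < ∞ := by
  have h := finite_integral_one_add_norm (E := ℝ) (μ := volume) (r := 2) (by simp)
  refine lt_of_le_of_lt (le_of_eq ?_) h
  refine lintegral_congr fun x => ?_
  have : 0 ≤ 1 + |x| := by positivity
  rw [dec, Real.norm_eq_abs, Real.rpow_neg this]
  norm_num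

lemma summable_inv_one_add_sq {a : ℝ} (ha : a ≠ 0) :
    Summable fun n : ℤ => ((1 + |a * n|) ^ 2)⁻¹ := by
  have h1 : Summable fun n : ℤ => (a ^ 2)⁻¹ * (1 / (n : ℝ) ^ 2) :=
    (Real.summable_one_div_int_pow.2 one_lt_two).mul_left _
  refine Summable.of_norm_bounded_eventually h1 ?_
  have h2 : ({0} : Set ℤ)ᶜ ∈ (cofinite : Filter ℤ) := (Set.finite_singleton 0).compl_mem_cofinite
  filter_upwards [h2] with n hn
  have hn' : (n : ℝ) ≠ 0 := by exact_mod_cast hn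
  have h3 : 0 < |a * n| := abs_pos.2 (mul_ne_zero ha hn')
  rw [Real.norm_of_nonneg (by positivity), one_div, ← mul_inv, ← mul_pow, ← sq_abs (a * n)]
  gcongr
  linarith

/-- The sum is periodic in x with period a. After reduction to |x| ≤ |a|, `dec_le` compares it with
the convergent sum at x = 0. -/
lemma exists_tsum_dec_le {a : ℝ} (ha : a ≠ 0) :
    ∃ K : ℝ≥0∞, K ≠ ∞ ∧ ∀ x, ∑' n : ℤ, dec (x - a * n) ≤ K := by
  refine ⟨ENNReal.ofReal ((1 + |a|) ^ 2) * ∑' n : ℤ, dec (-(a * n)),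
    ENNReal.mul_ne_top ENNReal.ofReal_ne_top ?_, fun x => ?_⟩
  · simp only [dec, abs_neg]
    exact (summable_inv_one_add_sq ha).tsum_ofReal_ne_top
  · set m := round (x / a) with hm
    set y := x - a * m with hy
    have h1 : |y| ≤ |a| := by
      have h := abs_sub_round (x / a)
      have e : y = a * (x / a - m) := by
        rw [hy]
        field_simp
      rw [e, abs_mul]
      exact mul_le_of_le_one_right (abs_nonneg a) (h.trans (by norm_num))
    have e2 : ∑' n : ℤ, dec (x - a * n) = ∑' n : ℤ, dec (y - a * n) := by
      rw [← (Equiv.addRight m).tsum_eq]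
      refine tsum_congr fun n => ?_
      simp only [Equiv.coe_addRight, hy]
      congr 1
      push_cast
      ring
    rw [e2, ← ENNReal.tsum_mul_left]
    refine ENNReal.tsum_le_tsum fun n => ?_
    refine (dec_le (y - a * n) (-y)).trans ?_
    rw [abs_neg, show y - a * n + -y = -(a * n) by ring]
    gcongr

lemma weightR_le (s : ℝ≥0) (p : ℝ × ℝ) :
    weightR s p ≤ ((1 + |p.1|) * (1 + |p.2|)) ^ ⌈(s : ℝ)⌉₊ := by
  have h1 := abs_nonneg p.1
  have h2 := abs_nonneg p.2
  have h3 : 1 ≤ (1 + |p.1|) * (1 + |p.2|) := by nlinarith [mul_nonneg h1 h2]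
  rw [← Real.rpow_natCast]
  refine (Real.rpow_le_rpow (by positivity) ?_ s.2).trans
    (Real.rpow_le_rpow_of_exponent_le h3 (Nat.le_ceil _))
  nlinarith [mul_nonneg h1 h2]

lemma exists_stft_mul_weight_le (s : ℝ≥0) (w φ : 𝓢(ℝ, ℂ)) :
    ∃ C : ℝ≥0∞, C ≠ ∞ ∧ ∀ p : ℝ × ℝ,
      ‖stft w (φ.toLp 2 volume) p‖ₑ * ENNReal.ofReal (weightR s p) ≤ C * (dec p.1 * dec p.2) := by
  -- Of the decay exponent, ⌈s⌉ absorbs the weight and the remaining 2 produces the two kernels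
  -- `dec`.
  obtain ⟨C, hC0, hC⟩ := exists_decay_one_add (⌈(s : ℝ)⌉₊ + 2) w φ
  refine ⟨ENNReal.ofReal C, ENNReal.ofReal_ne_top, fun p => ?_⟩
  have hp := hC p
  rw [dec, dec, ← ENNReal.ofReal_mul (by positivity), ← ENNReal.ofReal_mul hC0, ← ofReal_norm,
    ← ENNReal.ofReal_mul (norm_nonneg _)]
  refine ENNReal.ofReal_le_ofReal ?_
  rw [← mul_inv, ← mul_pow, ← div_eq_mul_inv, le_div_iff₀ (by positivity)]
  refine le_trans ?_ hp
  rw [pow_add]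
  have := weightR_le s p
  calc _ = weightR s p * ((1 + |p.1|) * (1 + |p.2|)) ^ 2 * ‖stft w (φ.toLp 2 volume) p‖ := by ring
    _ ≤ _ := by gcongr

/-- Schwartz functions have weighted integrable short-time Fourier transforms. -/
lemma lintegral_stft_toLp_lt_top (s : ℝ≥0) (w φ : 𝓢(ℝ, ℂ)) :
    ∫⁻ p, ‖stft w (φ.toLp 2 volume) p‖ₑ * ENNReal.ofReal (weightR s p) < ∞ := by
  obtain ⟨C, hC, h⟩ := exists_stft_mul_weight_le s w φ
  refine (lintegral_mono h).trans_lt ?_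
  rw [lintegral_const_mul' _ _ hC]
  refine ENNReal.mul_lt_top hC.lt_top ?_
  have e := lintegral_prod_mul (μ := (volume : Measure ℝ)) (ν := (volume : Measure ℝ))
    measurable_dec.aemeasurable measurable_dec.aemeasurable
  exact lt_of_eq_of_lt e (ENNReal.mul_lt_top lintegral_dec_lt_top lintegral_dec_lt_top)

end Decay

/-! ### Summability of the coefficients over the lattice -/

section Coefficients

open Filter Topology

variable {q : ℕ}

lemma zsmul_mem_lattice (a : ℝ) (r : ℕ) (n : ℤ) :
    ((a * n, (n : ZMod q) * r) : TimeGroup q) ∈ lattice q a r := by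
  refine AddSubgroup.mem_zmultiples_iff.2 ⟨n, ?_⟩
  ext <;> simp [mul_comm]

lemma mem_lattice_iff {a : ℝ} {r : ℕ} {y : TimeGroup q} :
    y ∈ lattice q a r ↔ ∃ n : ℤ, y = (a * n, (n : ZMod q) * r) := by
  constructor
  · intro h
    obtain ⟨n, rfl⟩ := AddSubgroup.mem_zmultiples_iff.1 h
    refine ⟨n, ?_⟩
    ext <;> simp [mul_comm]
  · rintro ⟨n, rfl⟩
    exact zsmul_mem_lattice a r n

/-- The parametrization of the lattice `{(a n, r n)}` by the integers. -/
def latticeMap (a : ℝ) (r : ℕ) (n : ℤ) : lattice q a r :=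
  ⟨(a * n, (n : ZMod q) * r), zsmul_mem_lattice a r n⟩

lemma latticeMap_bijective {a : ℝ} (ha : a ≠ 0) (r : ℕ) :
    Function.Bijective (latticeMap (q := q) a r) := by
  constructor
  · intro n m h
    have h1 : a * n = a * m := congrArg (fun y : lattice q a r => (y : TimeGroup q).1) h
    exact_mod_cast mul_left_cancel₀ ha h1
  · rintro ⟨y, hy⟩
    obtain ⟨n, rfl⟩ := mem_lattice_iff.1 hy
    exact ⟨n, rfl⟩

/-- A product of two subgroups as a product of types. -/
def prodEquiv (H K : AddSubgroup (TimeGroup q)) : H × K ≃ H.prod K where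
  toFun p := ⟨(p.1, p.2), AddSubgroup.mem_prod.2 ⟨p.1.2, p.2.2⟩⟩
  invFun p := (⟨(p : Phase q).1, (AddSubgroup.mem_prod.1 p.2).1⟩,
    ⟨(p : Phase q).2, (AddSubgroup.mem_prod.1 p.2).2⟩)
  left_inv _ := rfl
  right_inv _ := rfl

/-- The projection of the time-frequency plane to `ℝ²`. -/
def planar (ν : Phase q) : ℝ × ℝ := (ν.1.1, ν.2.1)

variable {α β : ℝ}

/-- The lattice is a product and each factor is parametrized by ℤ through its real coordinate, so
the sum splits into two one-dimensional ones. -/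
lemma exists_tsum_dec_lattice_le (r t : ℕ) (hα : α ≠ 0) (hβ : β ≠ 0) :
    ∃ K : ℝ≥0∞, K ≠ ∞ ∧ ∀ p : ℝ × ℝ, ∑' ν : gaborLattice q r t α β,
      dec (p - planar (ν : Phase q)).1 * dec (p - planar (ν : Phase q)).2 ≤ K := by
  obtain ⟨K₁, hK₁, h₁⟩ := exists_tsum_dec_le hα
  obtain ⟨K₂, hK₂, h₂⟩ := exists_tsum_dec_le hβ
  refine ⟨K₁ * K₂, ENNReal.mul_ne_top hK₁ hK₂, fun p => ?_⟩
  rw [← (prodEquiv (lattice q α r) (lattice q β t)).tsum_eq]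
  have e : ∀ (a : ℝ) (ha : a ≠ 0) (r : ℕ) (x : ℝ),
      ∑' y : lattice q a r, dec (x - (y : TimeGroup q).1) = ∑' n : ℤ, dec (x - a * n) :=
    fun a ha r x => by
      rw [← (Equiv.ofBijective _ (latticeMap_bijective ha r)).tsum_eq]
      rfl
  calc _ = ∑' z : lattice q α r × lattice q β t,
        dec (p.1 - (z.1 : TimeGroup q).1) * dec (p.2 - (z.2 : TimeGroup q).1) := rfl
    _ = (∑' y : lattice q α r, dec (p.1 - (y : TimeGroup q).1)) *
          ∑' y : lattice q β t, dec (p.2 - (y : TimeGroup q).1) := by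
        rw [ENNReal.tsum_prod (f := fun (y : lattice q α r) (z : lattice q β t) =>
          dec (p.1 - (y : TimeGroup q).1) * dec (p.2 - (z : TimeGroup q).1)),
          ← ENNReal.tsum_mul_right]
        simp only [ENNReal.tsum_mul_left]
    _ ≤ K₁ * K₂ := by
        rw [e α hα, e β hβ]
        exact mul_le_mul' (h₁ _) (h₂ _)

lemma countable_gaborLattice (r t : ℕ) (hα : α ≠ 0) (hβ : β ≠ 0) :
    Countable (gaborLattice q r t α β) := by
  have h : ∀ {a : ℝ}, a ≠ 0 → ∀ r : ℕ, Countable (lattice q a r) := fun ha r =>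
    (latticeMap_bijective ha r).2.countable
  have := h hα r
  have := h hβ t
  exact (prodEquiv (lattice q α r) (lattice q β t)).symm.injective.countable

/-- The weight as an extended nonnegative number. -/
def eweight (s : ℝ≥0) (p : ℝ × ℝ) : ℝ≥0∞ := ENNReal.ofReal (weightR s p)

lemma weightR_eq (s : ℝ≥0) (p : ℝ × ℝ) :
    weightR s p = weight s (((p.1, 0), (p.2, 0)) : Phase 1) := rfl

lemma eweight_add_le (s : ℝ≥0) (p p' : ℝ × ℝ) :
    eweight s (p + p') ≤ eweight s p * eweight s p' := by
  rw [eweight, eweight, eweight, ← ENNReal.ofReal_mul (weightR_nonneg s p)]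
  refine ENNReal.ofReal_le_ofReal ?_
  simp only [weightR_eq]
  refine le_of_eq_of_le ?_ (weight_add_le s _ _)
  simp

lemma eweight_neg (s : ℝ≥0) (p : ℝ × ℝ) : eweight s (-p) = eweight s p := by
  simp [eweight, weightR]

lemma one_le_eweight (s : ℝ≥0) (p : ℝ × ℝ) : 1 ≤ eweight s p := by
  rw [eweight, ← ENNReal.ofReal_one]
  refine ENNReal.ofReal_le_ofReal ?_
  rw [weightR_eq]
  exact one_le_weight _ _

lemma eweight_ne_top (s : ℝ≥0) (p : ℝ × ℝ) : eweight s p ≠ ∞ := ENNReal.ofReal_ne_top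

lemma measurable_eweight (s : ℝ≥0) : Measurable (eweight s) :=
  (measurable_weightR s).ennreal_ofReal

lemma eweight_sub_le (s : ℝ≥0) (p p' : ℝ × ℝ) :
    eweight s (p - p') ≤ eweight s p * eweight s p' := by
  rw [sub_eq_add_neg]
  exact (eweight_add_le s p (-p')).trans_eq (by rw [eweight_neg])

/-- The modulus of the short-time Fourier transform. -/
def estft (w : 𝓢(ℝ, ℂ)) (f : Lp ℂ 2 (volume : Measure ℝ)) (p : ℝ × ℝ) : ℝ≥0∞ := ‖stft w f p‖ₑ

lemma measurable_estft (w : 𝓢(ℝ, ℂ)) (f : Lp ℂ 2 (volume : Measure ℝ)) :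
    Measurable (estft w f) := (stronglyMeasurable_stft w f).measurable.enorm

/-- Covariance: a time-frequency shift of the window translates its short-time transform, up to a
phase. -/
lemma estft_atom (w : 𝓢(ℝ, ℂ)) (z p : ℝ × ℝ) :
    estft w ((memLp_atom w z).toLp _) p = estft w (w.toLp 2 volume) (p - z) := by
  have h1 : stft w ((memLp_atom w z).toLp _) p = ∫ t, (((𝐞 (t * z.2) : Circle) : ℂ) * w (t - z.1)) *
      (starRingEnd ℂ) ((𝐞 (t * p.2) : ℂ) * w (t - p.1)) := by
    refine integral_congr_ae ?_
    filter_upwards [(memLp_atom w z).coeFn_toLp] with t ht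
    rw [ht]
  have h2 : stft w (w.toLp 2 volume) (p - z) = ∫ t, w t *
      (starRingEnd ℂ) ((𝐞 (t * (p.2 - z.2)) : ℂ) * w (t - (p.1 - z.1))) := by
    refine integral_congr_ae ?_
    filter_upwards [w.coeFn_toLp 2 volume] with t ht
    rw [ht]
    rfl
  have h3 : stft w ((memLp_atom w z).toLp _) p
      = ((𝐞 (z.1 * (z.2 - p.2)) : Circle) : ℂ) * stft w (w.toLp 2 volume) (p - z) := by
    rw [h1, h2, ← integral_const_mul,
      ← integral_add_right_eq_self (μ := (volume : Measure ℝ)) _ z.1]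
    refine integral_congr_ae (Eventually.of_forall fun t => ?_)
    have e1 : 𝐞 ((t + z.1) * z.2) * (𝐞 ((t + z.1) * p.2))⁻¹
        = 𝐞 (z.1 * (z.2 - p.2)) * (𝐞 (t * (p.2 - z.2)))⁻¹ := by
      rw [← AddChar.map_neg_eq_inv, ← AddChar.map_neg_eq_inv, ← AddChar.map_add_eq_mul,
        ← AddChar.map_add_eq_mul]
      congr 1
      ring
    have e2 := congrArg (fun z : Circle => (z : ℂ)) e1
    simp only [Circle.coe_mul, Circle.coe_inv_eq_conj] at e2
    have e3 : t + z.1 - p.1 = t - (p.1 - z.1) := by ring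
    simp only [map_mul, add_sub_cancel_right, e3]
    linear_combination w t * (starRingEnd ℂ) (w (t - (p.1 - z.1))) * e2
  rw [estft, estft, h3, enorm_mul, ← ofReal_norm (_ : ℂ), Circle.norm_coe, ENNReal.ofReal_one,
    one_mul]

lemma integrable_atom (w : 𝓢(ℝ, ℂ)) (z : ℝ × ℝ) : Integrable ((memLp_atom w z).toLp _) := by
  have h : Integrable (atom w z) :=
    (w.integrable.comp_sub_right z.1).mono (continuous_atom_left w z).aestronglyMeasurable
      (Eventually.of_forall fun t => (norm_atom w z t).le)
  exact h.congr (memLp_atom w z).coeFn_toLp.symm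

/-- Reproducing bound: the short-time Fourier transform is dominated by its convolution with that
of the window. -/
lemma estft_le {w : 𝓢(ℝ, ℂ)} (hw : w ≠ 0) {g : Lp ℂ 2 (volume : Measure ℝ)}
    (hg : Integrable (stft w g)) (z : ℝ × ℝ) :
    estft w g z ≤ ENNReal.ofReal (windowSq w)⁻¹ *
      ∫⁻ p, estft w g p * estft w (w.toLp 2 volume) (p - z) := by
  have h := enorm_inner_le hw (integrable_atom w z) hg
  rw [← stft_eq_inner] at h
  refine h.trans_eq ?_
  congr 1
  exact lintegral_congr fun p => congrArg _ (estft_atom w z p)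

/-- Sampling on a lattice is controlled by the integral norm, uniformly over translates of the
lattice. The reproducing bound dominates the weighted transform by its convolution with an
integrable kernel, and the lattice sums of that kernel are bounded. -/
lemma exists_tsum_estft_le {w : 𝓢(ℝ, ℂ)} (hw : w ≠ 0) (s : ℝ≥0) (r t : ℕ) (hα : α ≠ 0)
    (hβ : β ≠ 0) : ∃ K : ℝ≥0∞, K ≠ ∞ ∧ ∀ g : Lp ℂ 2 (volume : Measure ℝ),
      Integrable (stft w g) → ∀ p : ℝ × ℝ,
        ∑' ν : gaborLattice q r t α β, estft w g (p - planar (ν : Phase q)) *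
          eweight s (p - planar (ν : Phase q)) ≤ K * ∫⁻ u, estft w g u * eweight s u := by
  have := countable_gaborLattice (q := q) r t hα hβ
  obtain ⟨K, hK, hKb⟩ := exists_tsum_dec_lattice_le (q := q) r t hα hβ
  obtain ⟨C, hC, hCb⟩ := exists_stft_mul_weight_le s w w
  set κ := ENNReal.ofReal (windowSq w)⁻¹ with hκ
  refine ⟨κ * (C * K), ENNReal.mul_ne_top ENNReal.ofReal_ne_top (ENNReal.mul_ne_top hC hK),
    fun g hg p => ?_⟩
  set W := estft w (w.toLp 2 volume) with hW
  have h1 : ∀ z, estft w g z * eweight s z ≤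
      κ * ∫⁻ u, (estft w g u * eweight s u) * (C * (dec (z - u).1 * dec (z - u).2)) := fun z => by
    refine (mul_le_mul' (estft_le hw hg z) le_rfl).trans ?_
    rw [mul_assoc, ← lintegral_mul_const' _ _ (eweight_ne_top s z)]
    refine mul_le_mul' le_rfl (lintegral_mono fun u => ?_)
    have e : eweight s z ≤ eweight s u * eweight s (u - z) := by
      have := eweight_sub_le s u (u - z)
      rwa [sub_sub_cancel] at this
    have e2 : W (u - z) * eweight s (u - z) ≤ C * (dec (z - u).1 * dec (z - u).2) := by
      refine (hCb (u - z)).trans_eq ?_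
      simp only [Prod.fst_sub, Prod.snd_sub, dec]
      rw [abs_sub_comm, abs_sub_comm u.2]
    calc estft w g u * W (u - z) * eweight s z
        ≤ estft w g u * W (u - z) * (eweight s u * eweight s (u - z)) := by gcongr
      _ = (estft w g u * eweight s u) * (W (u - z) * eweight s (u - z)) := by ring
      _ ≤ _ := by gcongr
  calc _ ≤ ∑' ν : gaborLattice q r t α β, κ * ∫⁻ u, (estft w g u * eweight s u) *
          (C * (dec (p - planar (ν : Phase q) - u).1 * dec (p - planar (ν : Phase q) - u).2)) :=
        ENNReal.tsum_le_tsum fun ν => h1 _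
    _ = κ * ∫⁻ u, ∑' ν : gaborLattice q r t α β, (estft w g u * eweight s u) *
          (C * (dec (p - planar (ν : Phase q) - u).1 * dec (p - planar (ν : Phase q) - u).2)) := by
        rw [ENNReal.tsum_mul_left, lintegral_tsum]
        intro ν
        refine (((measurable_estft w g).mul (measurable_eweight s)).mul
          (Measurable.const_mul ?_ _)).aemeasurable
        exact (measurable_dec.comp (by fun_prop)).mul (measurable_dec.comp (by fun_prop))
    _ ≤ κ * ∫⁻ u, (estft w g u * eweight s u) * (C * K) := by
        gcongr with u
        rw [ENNReal.tsum_mul_left, ENNReal.tsum_mul_left]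
        gcongr
        have := hKb (p - u)
        simpa only [sub_right_comm] using this
    _ = _ := by
        rw [lintegral_mul_const' _ _ (ENNReal.mul_ne_top hC hK)]
        ring

variable [NeZero q]

/-! ### Slices of functions on `ℝ × ℤ_q` -/

lemma ae_timeMeasure {P : TimeGroup q → Prop} (h : ∀ k, ∀ᵐ x : ℝ, P (x, k)) :
    ∀ᵐ y ∂timeMeasure q, P y := by
  have h1 : {y : TimeGroup q | ¬ P y} ⊆ ⋃ k : ZMod q, {x : ℝ | ¬ P (x, k)} ×ˢ {k} := by
    rintro ⟨x, k⟩ hy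
    exact Set.mem_iUnion.2 ⟨k, hy, rfl⟩
  refine measure_mono_null h1 (measure_iUnion_null fun k => ?_)
  rw [Measure.prod_prod]
  have h2 : volume {x : ℝ | ¬ P (x, k)} = 0 := h k
  rw [h2, zero_mul]

lemma ae_slice {P : TimeGroup q → Prop} (h : ∀ᵐ y ∂timeMeasure q, P y) (k : ZMod q) :
    ∀ᵐ x : ℝ, P (x, k) := (quasi_slice k).ae h

lemma integral_timeMeasure {F : TimeGroup q → ℂ} (hF : Integrable F (timeMeasure q)) :
    ∫ y, F y ∂timeMeasure q = ∑ k, ∫ x, F (x, k) := by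
  rw [integral_prod_symm _ hF, integral_fintype]
  · simp
  · exact Integrable.of_finite

lemma integrable_timeMeasure {F : TimeGroup q → ℂ}
    (hF : ∀ k, Integrable fun x => F (x, k)) : Integrable F (timeMeasure q) := by
  have h1 : timeMeasure q = ∑ k : ZMod q, (volume : Measure ℝ).map fun x => (x, k) := by
    refine Measure.ext fun A hA => ?_
    rw [Measure.finsetSum_apply, Measure.prod_apply_symm hA, lintegral_count, tsum_fintype]
    exact Finset.sum_congr rfl fun k _ => (Measure.map_apply measurable_prodMk_right hA).symm
  rw [h1, integrable_finsetSum_measure]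
  intro k _
  have h2 : MeasurableEmbedding fun x : ℝ => (x, k) :=
    measurableEmbedding_prod_mk_right k
  exact h2.integrable_map_iff.2 (hF k)

lemma inner_eq_sum_slice (f g : L2 q) : ⟪f, g⟫_ℂ = ∑ k, ⟪slice k f, slice k g⟫_ℂ := by
  rw [L2.inner_def, integral_timeMeasure (L2.integrable_inner f g)]
  refine Finset.sum_congr rfl fun k _ => ?_
  rw [L2.inner_def]
  refine integral_congr_ae ?_
  filter_upwards [slice_coe k f, slice_coe k g] with x h1 h2
  rw [h1, h2]

lemma ext_slice {f g : L2 q} (h : ∀ k, slice k f = slice k g) : f = g := by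
  refine Lp.ext (ae_timeMeasure fun k => ?_)
  filter_upwards [slice_coe k f, slice_coe k g] with x h1 h2
  rw [← h1, ← h2, h k]

variable {w : 𝓢(ℝ, ℂ)} {s : ℝ≥0}

lemma integrable_stft_slice {f : L2 q} (hf : f ∈ M1 q w s) (k : ZMod q) :
    Integrable (stft w (slice k f)) := by
  refine ⟨(stronglyMeasurable_stft w _).aestronglyMeasurable, ?_⟩
  refine lt_of_le_of_lt (lintegral_mono fun p => ?_) (mem_M1_iff_lintegral.1 hf k)
  exact le_mul_of_one_le_right' (one_le_eweight s p)

lemma tfShift_mem_M1 (ν : Phase q) {f : L2 q} (hf : f ∈ M1 q w s) : tfShift ν f ∈ M1 q w s := by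
  rw [mem_M1_iff_lintegral] at hf ⊢
  exact fun k => (lintegral_stft_shift_le w s ν f k).trans_lt
    (ENNReal.mul_lt_top ENNReal.ofReal_lt_top (hf _))

/-- A shift by ν carries the slice k - ν.1.2 to the slice k. Summing over all slices j instead of
this one makes the bound depend on ν only through its projection to ℝ². -/
lemma enorm_inner_tfShift_le (hw : w ≠ 0) {f g : L2 q} (hf : f ∈ M1 q w s) (hg : g ∈ M1 q w s)
    (ν : Phase q) : ‖⟪tfShift ν g, f⟫_ℂ‖ₑ ≤ ∑ k, ∑ j, ENNReal.ofReal (windowSq w)⁻¹ *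
      ∫⁻ p, estft w (slice k f) p * estft w (slice j g) (p - planar ν) := by
  rw [inner_eq_sum_slice]
  refine (enorm_sum_le _ _).trans (Finset.sum_le_sum fun k _ => ?_)
  have h1 := enorm_inner_le hw
    (integrable_of_integrable_stft hw (integrable_stft_slice (tfShift_mem_M1 ν hg) k))
    (integrable_stft_slice hf k)
  refine h1.trans ?_
  have h2 : ∀ p, ‖stft w (slice k (tfShift ν g)) p‖ₑ
      = estft w (slice (k - ν.1.2) g) (p - planar ν) := fun p => by
    rw [estft, planar, ← ofReal_norm, ← ofReal_norm, norm_stft_slice_tfShift]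
  simp only [h2]
  exact Finset.single_le_sum (f := fun j => ENNReal.ofReal (windowSq w)⁻¹ *
      ∫⁻ p, estft w (slice k f) p * estft w (slice j g) (p - planar ν))
    (fun _ _ => zero_le) (Finset.mem_univ (k - ν.1.2))

/-- The coefficients `⟨f, π(ν) g⟩` over a lattice are weighted summable. -/
theorem memL1_inner (hw : w ≠ 0) (r t : ℕ) (hα : α ≠ 0) (hβ : β ≠ 0) {f g : L2 q}
    (hf : f ∈ M1 q w s) (hg : g ∈ M1 q w s) :
    MemL1 (gaborLattice q r t α β) s fun ν => ⟪tfShift (ν : Phase q) g, f⟫_ℂ := by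
  have := countable_gaborLattice (q := q) r t hα hβ
  obtain ⟨K, hK, hKb⟩ := exists_tsum_estft_le (q := q) hw s r t hα hβ
  set κ := ENNReal.ofReal (windowSq w)⁻¹ with hκ
  have hf' : ∀ k, ∫⁻ p, estft w (slice k f) p * eweight s p ≠ ∞ :=
    fun k => (mem_M1_iff_lintegral.1 hf k).ne
  have hg' : ∀ k, ∫⁻ p, estft w (slice k g) p * eweight s p ≠ ∞ :=
    fun k => (mem_M1_iff_lintegral.1 hg k).ne
  suffices h : ∑' ν : gaborLattice q r t α β, ‖⟪tfShift (ν : Phase q) g, f⟫_ℂ‖ₑ *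
      eweight s (planar (ν : Phase q)) ≠ ∞ by
    refine (ENNReal.summable_toReal h).congr fun ν => ?_
    rw [ENNReal.toReal_mul, toReal_enorm, eweight, ENNReal.toReal_ofReal (weightR_nonneg s _)]
    rfl
  -- The weight at ν is at most the product of the weights at p and at p - ν. One goes to f, whose
  -- transform is integrated; the other goes to g, whose transform is sampled on a translated
  -- lattice.
  refine ne_top_of_le_ne_top (b := ∑ k, ∑ j, κ * ((∫⁻ p, estft w (slice k f) p * eweight s p) *
    (K * ∫⁻ u, estft w (slice j g) u * eweight s u))) ?_ ?_
  · refine ENNReal.sum_ne_top.2 fun k _ => ENNReal.sum_ne_top.2 fun j _ => ?_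
    exact ENNReal.mul_ne_top ENNReal.ofReal_ne_top
      (ENNReal.mul_ne_top (hf' k) (ENNReal.mul_ne_top hK (hg' j)))
  calc _ ≤ ∑' ν : gaborLattice q r t α β, ∑ k, ∑ j, κ * ∫⁻ p, (estft w (slice k f) p *
          eweight s p) * (estft w (slice j g) (p - planar (ν : Phase q)) *
            eweight s (p - planar (ν : Phase q))) := by
        refine ENNReal.tsum_le_tsum fun ν => ?_
        refine (mul_le_mul' (enorm_inner_tfShift_le hw hf hg (ν : Phase q)) le_rfl).trans ?_
        rw [Finset.sum_mul]
        refine Finset.sum_le_sum fun k _ => ?_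
        rw [Finset.sum_mul]
        refine Finset.sum_le_sum fun j _ => ?_
        rw [mul_assoc, ← lintegral_mul_const' _ _ (eweight_ne_top s _)]
        refine mul_le_mul' le_rfl (lintegral_mono fun p => ?_)
        have e : eweight s (planar (ν : Phase q)) ≤
            eweight s p * eweight s (p - planar (ν : Phase q)) := by
          have := eweight_sub_le s p (p - planar (ν : Phase q))
          rwa [sub_sub_cancel] at this
        refine (mul_le_mul' le_rfl e).trans_eq ?_
        ring
    _ = ∑ k, ∑ j, κ * ∫⁻ p, (estft w (slice k f) p * eweight s p) *
          ∑' ν : gaborLattice q r t α β, (estft w (slice j g) (p - planar (ν : Phase q)) *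
            eweight s (p - planar (ν : Phase q))) := by
        rw [Summable.tsum_finsetSum fun _ _ => ENNReal.summable]
        refine Finset.sum_congr rfl fun k _ => ?_
        rw [Summable.tsum_finsetSum fun _ _ => ENNReal.summable]
        refine Finset.sum_congr rfl fun j _ => ?_
        rw [ENNReal.tsum_mul_left, ← lintegral_tsum]
        · simp only [ENNReal.tsum_mul_left]
        · intro ν
          refine (((measurable_estft w _).mul (measurable_eweight s)).mul ?_).aemeasurable
          exact ((measurable_estft w _).comp (measurable_id.sub_const _)).mul
            ((measurable_eweight s).comp (measurable_id.sub_const _))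
    _ ≤ _ := by
        refine Finset.sum_le_sum fun k _ => Finset.sum_le_sum fun j _ => ?_
        gcongr
        rw [← lintegral_mul_const' _ _ (ENNReal.mul_ne_top hK (hg' j))]
        gcongr with p
        exact hKb _ (integrable_stft_slice hg j) p

end Coefficients

/-! ### Continuous representatives and density of the modulation space -/

section Density

open Filter Topology

variable {q : ℕ}

/-! ### The Wiener class -/

/-- Functions on `ℝ × ℤ_q` that are continuous and locally uniformly summable over translates. -/
structure IsWiener (f : TimeGroup q → ℂ) : Prop where
  cont : ∀ k, Continuous fun x => f (x, k)
  bound : ∀ a : ℝ, a ≠ 0 → ∀ (R : ℝ) (k : ZMod q), ∃ b : ℤ → ℝ, Summable b ∧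
    ∀ (n : ℤ) (y : ℝ), |y| ≤ R → ‖f (y + a * n, k)‖ ≤ b n

lemma exists_enorm_le_dec (w : 𝓢(ℝ, ℂ)) : ∃ C : ℝ≥0∞, C ≠ ∞ ∧ ∀ x, ‖w x‖ₑ ≤ C * dec x := by
  obtain ⟨A, hA⟩ := exists_bound w
  set B := SchwartzMap.seminorm ℝ 2 0 w
  have hB : ∀ t, |t| ^ 2 * ‖w t‖ ≤ B := fun t => SchwartzMap.norm_pow_mul_le_seminorm ℝ w 2 t
  have hA0 : 0 ≤ A := (norm_nonneg _).trans (hA 0)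
  have hB0 : 0 ≤ B := le_trans (by positivity) (hB 0)
  refine ⟨ENNReal.ofReal (2 * (A + B)), ENNReal.ofReal_ne_top, fun x => ?_⟩
  rw [dec, ← ENNReal.ofReal_mul (by positivity), ← ofReal_norm]
  refine ENNReal.ofReal_le_ofReal ?_
  rw [← div_eq_mul_inv, le_div_iff₀ (by positivity)]
  nlinarith [hA x, hB x, norm_nonneg (w x), mul_nonneg (norm_nonneg (w x)) (sq_nonneg (1 - |x|))]

/-- Bounds in [0, ∞] suffice, and there sums and integrals of nonnegative functions interchange
freely. -/
lemma isWiener_of_enorm_le {f : TimeGroup q → ℂ} (hc : ∀ k, Continuous fun x => f (x, k))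
    (h : ∀ a : ℝ, a ≠ 0 → ∀ (R : ℝ) (k : ZMod q), ∃ B : ℤ → ℝ≥0∞, ∑' n, B n ≠ ∞ ∧
      ∀ (n : ℤ) (y : ℝ), |y| ≤ R → ‖f (y + a * n, k)‖ₑ ≤ B n) : IsWiener f where
  cont := hc
  bound a ha R k := by
    obtain ⟨B, hB, hle⟩ := h a ha R k
    refine ⟨fun n => (B n).toReal, ENNReal.summable_toReal hB, fun n y hy => ?_⟩
    rw [← toReal_enorm]
    exact ENNReal.toReal_mono (ENNReal.ne_top_of_tsum_ne_top hB n) (hle n y hy)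

lemma tsum_dec_ne_top {a : ℝ} (ha : a ≠ 0) : ∑' n : ℤ, dec (a * n) ≠ ∞ :=
  (summable_inv_one_add_sq ha).tsum_ofReal_ne_top

lemma IsWiener.const_mul {f : TimeGroup q → ℂ} (hf : IsWiener f) (c : ℂ) :
    IsWiener fun y => c * f y where
  cont k := continuous_const.mul (hf.cont k)
  bound a ha R k := by
    obtain ⟨b, hb, h⟩ := hf.bound a ha R k
    refine ⟨fun n => ‖c‖ * b n, hb.mul_left _, fun n y hy => ?_⟩
    rw [norm_mul]
    exact mul_le_mul_of_nonneg_left (h n y hy) (norm_nonneg _)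

/-- The function on `ℝ × ℤ_q` that is `u` on `ℝ × {k}` and vanishes elsewhere. -/
def embedFun (k : ZMod q) (u : ℝ → ℂ) (y : TimeGroup q) : ℂ := if y.2 = k then u y.1 else 0

lemma isWiener_embedFun (k : ZMod q) (φ : 𝓢(ℝ, ℂ)) : IsWiener (embedFun k φ) := by
  refine isWiener_of_enorm_le (fun j => ?_) fun a ha R j => ?_
  · by_cases h : j = k <;> simp only [embedFun, h, if_true, if_false]
    · exact φ.continuous
    · exact continuous_const
  · obtain ⟨C, hC, h⟩ := exists_enorm_le_dec φ
    refine ⟨fun n => C * (ENNReal.ofReal ((1 + R) ^ 2) * dec (a * n)), ?_, fun n y hy => ?_⟩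
    · rw [ENNReal.tsum_mul_left, ENNReal.tsum_mul_left]
      exact ENNReal.mul_ne_top hC (ENNReal.mul_ne_top ENNReal.ofReal_ne_top (tsum_dec_ne_top ha))
    · have h1 : ‖embedFun k φ (y + a * n, j)‖ₑ ≤ ‖φ (y + a * n)‖ₑ := by
        unfold embedFun
        split_ifs
        · exact le_rfl
        · simp
      refine h1.trans ((h _).trans ?_)
      refine mul_le_mul' le_rfl ((dec_le _ (-y)).trans ?_)
      rw [abs_neg, show y + a * n + -y = a * n by ring]
      gcongr

/-- The synthesis is bounded by ∫ |F(p)| |w(t - p.1)| dp, and sums of |w| over translates are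
bounded uniformly in p. Integrability of F therefore gives summability over translates. -/
lemma isWiener_synth (w : 𝓢(ℝ, ℂ)) {F : ZMod q → ℝ × ℝ → ℂ} (hF : ∀ k, Integrable (F k)) :
    IsWiener fun y : TimeGroup q => synth w (F y.2) y.1 := by
  refine isWiener_of_enorm_le (fun k => continuous_synth w (hF k)) fun a ha R k => ?_
  obtain ⟨C, hC, h⟩ := exists_enorm_le_dec w
  obtain ⟨K, hK, hKb⟩ := exists_tsum_dec_le ha
  set A := C * ENNReal.ofReal ((1 + R) ^ 2) with hA
  have hAt : A ≠ ∞ := ENNReal.mul_ne_top hC ENNReal.ofReal_ne_top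
  refine ⟨fun n => ∫⁻ p, ‖F k p‖ₑ * (A * dec (p.1 - a * n)), ?_, fun n y hy => ?_⟩
  · have hm : ∀ n : ℤ, AEMeasurable fun p : ℝ × ℝ => ‖F k p‖ₑ * (A * dec (p.1 - a * n)) :=
      fun n => (hF k).aestronglyMeasurable.enorm.mul
        ((measurable_dec.comp (by fun_prop)).const_mul _).aemeasurable
    rw [← lintegral_tsum hm]
    refine ne_top_of_le_ne_top (b := ∫⁻ p, ‖F k p‖ₑ * (A * K)) ?_ ?_
    · rw [lintegral_mul_const' _ _ (ENNReal.mul_ne_top hAt hK)]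
      exact ENNReal.mul_ne_top (hF k).2.ne (ENNReal.mul_ne_top hAt hK)
    · refine lintegral_mono fun p => ?_
      rw [ENNReal.tsum_mul_left, ENNReal.tsum_mul_left]
      gcongr
      exact hKb _
  · refine (norm_synth_le w (F k) _).trans (lintegral_mono fun p => ?_)
    refine mul_le_mul' le_rfl ((h _).trans ?_)
    rw [hA, mul_assoc]
    gcongr
    refine (dec_le _ (-y)).trans ?_
    rw [abs_neg, show y + a * n - p.1 + -y = -(p.1 - a * n) by ring]
    simp only [dec, abs_neg]
    gcongr

/-! ### Embedding of `L²(ℝ)` and density of the modulation space -/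

variable [NeZero q]

lemma memLp_of_slices {F : TimeGroup q → ℂ} (hm : ∀ k, Measurable fun x => F (x, k))
    (hF : ∀ k, MemLp (fun x => F (x, k)) 2 volume) : MemLp F 2 (timeMeasure q) := by
  have h : Measurable F := measurable_from_prod_countable_left hm
  refine (memLp_two_iff_integrable_sq_norm h.aestronglyMeasurable).2 ?_
  have h2 : Integrable (fun y => ((‖F y‖ ^ 2 : ℝ) : ℂ)) (timeMeasure q) :=
    integrable_timeMeasure fun k =>
      ((memLp_two_iff_integrable_sq_norm (hm k).aestronglyMeasurable).1 (hF k)).ofReal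
  exact h2.re

lemma memLp_embedFun (k : ZMod q) (u : Lp ℂ 2 (volume : Measure ℝ)) :
    MemLp (embedFun k u) 2 (timeMeasure q) := by
  refine memLp_of_slices (fun j => ?_) (fun j => ?_) <;> by_cases h : j = k <;>
    simp only [embedFun, h, if_true, if_false]
  · exact (Lp.stronglyMeasurable u).measurable
  · exact measurable_const
  · exact Lp.memLp u
  · exact MemLp.zero'

/-- The embedding of `L²(ℝ)` as the `k`-th summand of `L²(ℝ × ℤ_q)`. -/
def embed (k : ZMod q) (u : Lp ℂ 2 (volume : Measure ℝ)) : L2 q := (memLp_embedFun k u).toLp _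

lemma embed_coe (k : ZMod q) (u : Lp ℂ 2 (volume : Measure ℝ)) :
    embed k u =ᵐ[timeMeasure q] embedFun k u := (memLp_embedFun k u).coeFn_toLp

lemma slice_embed_self (k : ZMod q) (u : Lp ℂ 2 (volume : Measure ℝ)) :
    slice k (embed k u) = u := by
  refine Lp.ext ?_
  filter_upwards [slice_coe k (embed k u), ae_slice (embed_coe k u) k] with x h1 h2
  rw [h1, h2, embedFun, if_pos rfl]

lemma slice_embed_of_ne {j k : ZMod q} (h : j ≠ k) (u : Lp ℂ 2 (volume : Measure ℝ)) :
    slice j (embed k u) = 0 := by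
  refine Lp.ext ?_
  filter_upwards [slice_coe j (embed k u), ae_slice (embed_coe k u) j,
    Lp.coeFn_zero ℂ 2 (volume : Measure ℝ)] with x h1 h2 h3
  rw [h1, h2, h3, embedFun, if_neg h]
  rfl

lemma inner_embed (k : ZMod q) (u : Lp ℂ 2 (volume : Measure ℝ)) (f : L2 q) :
    ⟪embed k u, f⟫_ℂ = ⟪u, slice k f⟫_ℂ := by
  rw [inner_eq_sum_slice, Finset.sum_eq_single k]
  · rw [slice_embed_self]
  · intro j _ hj
    rw [slice_embed_of_ne hj, inner_zero_left]
  · simp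

variable {w : 𝓢(ℝ, ℂ)} {s : ℝ≥0}

lemma embed_mem_M1 (k : ZMod q) {u : Lp ℂ 2 (volume : Measure ℝ)}
    (hu : ∫⁻ p, estft w u p * eweight s p < ∞) : embed k u ∈ M1 q w s := by
  rw [mem_M1_iff_lintegral]
  intro j
  by_cases h : j = k
  · subst h
    rw [slice_embed_self]
    exact hu
  · rw [slice_embed_of_ne h]
    simp [stft_eq_inner]

lemma lintegral_estft_atom_lt_top (w : 𝓢(ℝ, ℂ)) (s : ℝ≥0) (z : ℝ × ℝ) :
    ∫⁻ p, estft w ((memLp_atom w z).toLp _) p * eweight s p < ∞ := by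
  simp only [estft_atom]
  rw [← lintegral_add_right_eq_self _ z]
  simp only [add_sub_cancel_right]
  calc _ ≤ ∫⁻ p, (estft w (w.toLp 2 volume) p * eweight s p) * eweight s z := by
        refine lintegral_mono fun p => ?_
        rw [mul_assoc]
        exact mul_le_mul' le_rfl (eweight_add_le s p z)
    _ = (∫⁻ p, estft w (w.toLp 2 volume) p * eweight s p) * eweight s z :=
        lintegral_mul_const' _ _ (eweight_ne_top s z)
    _ < ∞ := ENNReal.mul_lt_top (lintegral_stft_toLp_lt_top s w w) (eweight_ne_top s z).lt_top

/-- A function orthogonal to the modulation space vanishes. -/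
theorem eq_zero_of_inner_M1_eq_zero (hw : w ≠ 0) {f : L2 q}
    (hf : ∀ h ∈ M1 q w s, ⟪h, f⟫_ℂ = 0) : f = 0 := by
  refine ext_slice fun k => ?_
  -- Each shifted window, placed in the k-th slice, belongs to the modulation space, so the
  -- short-time transform of this slice vanishes; inversion then makes the slice itself vanish.
  have h1 : stft w (slice k f) = 0 := funext fun z => by
    rw [stft_eq_inner, ← inner_embed]
    exact hf _ (embed_mem_M1 k (lintegral_estft_atom_lt_top w s z))
  have h2 := stft_inversion w (slice k f) (by rw [h1]; exact integrable_zero _ _ _)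
  rw [map_zero]
  refine Lp.ext ?_
  have h0 : (windowSq w : ℂ) ≠ 0 := by exact_mod_cast (windowSq_pos hw).ne'
  filter_upwards [h2, Lp.coeFn_zero ℂ 2 (volume : Measure ℝ)] with t ht ht'
  rw [h1] at ht
  rw [ht']
  simpa [synth, h0] using ht

theorem topologicalClosure_M1 (hw : w ≠ 0) : (M1 q w s).topologicalClosure = ⊤ := by
  rw [Submodule.topologicalClosure_eq_top_iff, Submodule.eq_bot_iff]
  intro f hf
  exact eq_zero_of_inner_M1_eq_zero hw (Submodule.mem_orthogonal _ _ |>.1 hf)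

theorem dense_M1 (hw : w ≠ 0) : Dense (M1 q w s : Set (L2 q)) :=
  Submodule.dense_iff_topologicalClosure_eq_top.2 (topologicalClosure_M1 hw)

/-- By density, identities checked on the modulation space, where the fundamental identity is
available, become operator identities on all of L². -/
lemma ext_M1 (hw : w ≠ 0) {S T : L2 q →L[ℂ] L2 q} (h : ∀ f ∈ M1 q w s, S f = T f) : S = T :=
  ContinuousLinearMap.ext fun f => by
    have h1 := Continuous.ext_on (dense_M1 (q := q) (s := s) hw) S.continuous T.continuous h
    exact congrFun h1 f

/-- Functions in the modulation space have representatives in the Wiener class. -/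
theorem exists_isWiener (hw : w ≠ 0) {f : L2 q} (hf : f ∈ M1 q w s) :
    ∃ F : TimeGroup q → ℂ, IsWiener F ∧ f =ᵐ[timeMeasure q] F := by
  -- The representative is the inversion formula itself: the synthesis of the short-time transform,
  -- divided by the squared norm of the window.
  refine ⟨_, (isWiener_synth w fun k => integrable_stft_slice hf k).const_mul
    (windowSq w : ℂ)⁻¹, ae_timeMeasure fun k => ?_⟩
  have h0 : (windowSq w : ℂ) ≠ 0 := by exact_mod_cast (windowSq_pos hw).ne'
  filter_upwards [stft_inversion w _ (integrable_stft_slice hf k), slice_coe k f] with x h1 h2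
  rw [h1, h2, inv_mul_cancel_left₀ h0]

end Density

/-! ### Poisson summation on `ℝ × ℤ_q` -/

section Poisson

open Filter Topology

lemma fourierChar_eq_one_iff {x : ℝ} : 𝐞 x = 1 ↔ ∃ n : ℤ, x = n := by
  rw [show 𝐞 x = Circle.exp (2 * Real.pi * x) from rfl, Circle.exp_eq_one]
  refine exists_congr fun n => ?_
  have := Real.pi_pos
  constructor
  · intro h
    have : (2 * Real.pi) * (x - n) = 0 := by linear_combination h
    have h2 := (mul_eq_zero.1 this).resolve_left (by positivity)
    linarith
  · rintro rfl
    ring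

lemma fourier_finsetSum {ι : Type*} (S : Finset ι) {f : ι → ℝ → ℂ}
    (hf : ∀ i ∈ S, Integrable (f i)) (ω : ℝ) :
    𝓕 (fun u => ∑ i ∈ S, f i u) ω = ∑ i ∈ S, 𝓕 (f i) ω := by
  simp only [Real.fourier_eq, Finset.smul_sum]
  exact integral_finsetSum _ fun i hi => (Real.fourierIntegral_convergent_iff ω).2 (hf i hi)

variable {q : ℕ}

/-- The line `u ↦ f(c + a u, k)`. -/
def IsWiener.line {f : TimeGroup q → ℂ} (hf : IsWiener f) (a c : ℝ) (k : ZMod q) : C(ℝ, ℂ) :=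
  ⟨fun u => f (c + a * u, k), (hf.cont k).comp (by fun_prop)⟩

lemma IsWiener.line_apply {f : TimeGroup q → ℂ} (hf : IsWiener f) (a c : ℝ) (k : ZMod q) (u : ℝ) :
    hf.line a c k u = f (c + a * u, k) := rfl

/-- This is the hypothesis of Poisson summation on ℝ: the translates by integers have summable sup
norms on every compact set. -/
lemma IsWiener.summable_restrict {f : TimeGroup q → ℂ} (hf : IsWiener f) {a : ℝ} (ha : a ≠ 0)
    (c : ℝ) (k : ZMod q) (K : TopologicalSpace.Compacts ℝ) : Summable fun n : ℤ =>
      ‖((hf.line a c k).comp (ContinuousMap.addRight (n : ℝ))).restrict K‖ := by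
  obtain ⟨R, hR⟩ := K.isCompact.isBounded.exists_norm_le
  obtain ⟨b, hb, h⟩ := hf.bound a ha (|c| + |a| * |R|) k
  refine Summable.of_nonneg_of_le (fun _ => norm_nonneg _) (fun n => ?_) hb
  refine (ContinuousMap.norm_le _ ((norm_nonneg _).trans (h n 0 (by simp; positivity)))).2 ?_
  rintro ⟨u, hu⟩
  have h1 : |c + a * u| ≤ |c| + |a| * |R| := by
    refine (abs_add_le _ _).trans ?_
    rw [abs_mul]
    exact add_le_add le_rfl (mul_le_mul_of_nonneg_left ((hR u hu).trans (le_abs_self R))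
      (abs_nonneg a))
  have h2 := h n (c + a * u) h1
  have e : ((hf.line a c k).comp (ContinuousMap.addRight (n : ℝ))).restrict K ⟨u, hu⟩
      = f (c + a * u + a * n, k) := by
    simp only [ContinuousMap.restrict_apply, ContinuousMap.comp_apply, ContinuousMap.coe_addRight,
      IsWiener.line_apply]
    congr 2
    ring
  rw [e]
  exact h2

lemma IsWiener.integrable_line {f : TimeGroup q → ℂ} (hf : IsWiener f) {a : ℝ} (ha : a ≠ 0)
    (c : ℝ) (k : ZMod q) : Integrable (hf.line a c k) :=
  Real.integrable_of_summable_norm_Icc (hf.summable_restrict ha c k ⟨Set.Icc 0 1, isCompact_Icc⟩)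

lemma IsWiener.fourier_line {f : TimeGroup q → ℂ} (hf : IsWiener f) {β : ℝ} (hβ : β ≠ 0) (c : ℝ)
    (k : ZMod q) (m : ℝ) : 𝓕 (hf.line β⁻¹ c k : ℝ → ℂ) m
      = ((|β| : ℝ) : ℂ) * (𝐞 (m * β * c) : Circle) *
        ∫ v, f (v, k) * ((𝐞 (-(m * β * v)) : Circle) : ℂ) := by
  have h1 : 𝓕 (hf.line β⁻¹ c k : ℝ → ℂ) m = ∫ u, (fun v : ℝ =>
      ((𝐞 (-(m * β * v)) : Circle) : ℂ) * f (c + v, k)) (β⁻¹ * u) := by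
    rw [Real.fourier_real_eq]
    refine integral_congr_ae (Eventually.of_forall fun u => ?_)
    simp only [Circle.smul_def, smul_eq_mul, IsWiener.line_apply]
    congr 4
    field_simp
  rw [h1]
  refine (Measure.integral_comp_mul_left (fun v : ℝ =>
      ((𝐞 (-(m * β * v)) : Circle) : ℂ) * f (c + v, k)) β⁻¹).trans ?_
  rw [inv_inv, Complex.real_smul, mul_assoc]
  congr 1
  rw [← integral_const_mul, ← integral_add_left_eq_self (fun v : ℝ =>
    ((𝐞 (m * β * c) : Circle) : ℂ) * (f (v, k) * ((𝐞 (-(m * β * v)) : Circle) : ℂ))) c]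
  refine integral_congr_ae (Eventually.of_forall fun v => ?_)
  have e : 𝐞 (m * β * c) * 𝐞 (-(m * β * (c + v))) = 𝐞 (-(m * β * v)) := by
    rw [← AddChar.map_add_eq_mul]
    congr 1
    ring
  simp only [← e, Circle.coe_mul]
  ring

variable [NeZero q]

lemma toCircle_intCast_eq (n : ℤ) : ZMod.toCircle (n : ZMod q) = 𝐞 ((n : ℝ) / q) := by
  refine Circle.ext ?_
  rw [ZMod.toCircle_intCast, Real.fourierChar_apply]
  congr 1
  push_cast
  ring

lemma pairing_lattice (β : ℝ) (t : ℕ) (m : ℤ) (ξ : TimeGroup q) :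
    pairing ((β * m, (m : ZMod q) * t) : TimeGroup q) ξ
      = 𝐞 (m * (β * ξ.1 + t * ξ.2.val / q)) := by
  have h : (m : ZMod q) * t * ξ.2 = ((m * t * ξ.2.val : ℤ) : ZMod q) := by
    push_cast
    rw [ZMod.natCast_zmod_val]
  rw [pairing, h, toCircle_intCast_eq, ← AddChar.map_add_eq_mul]
  congr 1
  push_cast
  ring

/-- The lattice is cyclic, so only the pairing with its generator matters. Writing the residue as a
number makes that pairing a single exponential. -/
lemma mem_annihilator_iff {β : ℝ} {t : ℕ} {ξ : TimeGroup q} :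
    ξ ∈ annihilator (lattice q β t) ↔ ∃ n : ℤ, β * ξ.1 + t * ξ.2.val / q = n := by
  rw [← fourierChar_eq_one_iff]
  constructor
  · intro h
    have := h _ (zsmul_mem_lattice β t 1)
    rw [pairing_lattice] at this
    simpa using this
  · intro h y hy
    obtain ⟨m, rfl⟩ := mem_lattice_iff.1 hy
    rw [pairing_lattice, ← zsmul_eq_mul, AddChar.map_zsmul_eq_zpow, h, one_zpow]

/-- The parametrization of the annihilator of `{(β m, t m)}`. -/
def annihilatorEquiv {β : ℝ} (hβ : β ≠ 0) (t : ℕ) :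
    ZMod q × ℤ ≃ annihilator (lattice q β t) :=
  -- Over each residue j the real coordinates of the annihilator form the coset of β⁻¹ℤ through
  -- -tj/(qβ).
  Equiv.ofBijective (fun p => ⟨(-(β⁻¹ * (t * p.1.val / q)) + β⁻¹ * p.2, p.1),
      mem_annihilator_iff.2 ⟨p.2, by field_simp; ring⟩⟩) <| by
    constructor
    · rintro ⟨j, n⟩ ⟨j', n'⟩ h
      have h1 := congrArg (fun y : annihilator (lattice q β t) => (y : TimeGroup q)) h
      simp only [Prod.mk.injEq] at h1
      obtain ⟨h1, rfl⟩ := h1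
      have h2 : (n : ℝ) = n' := mul_left_cancel₀ (inv_ne_zero hβ) (by linarith)
      rw [Prod.mk.injEq]
      exact ⟨rfl, by exact_mod_cast h2⟩
    · rintro ⟨⟨ξ, τ⟩, hξ⟩
      obtain ⟨n, hn⟩ := mem_annihilator_iff.1 hξ
      refine ⟨(τ, n), Subtype.ext (Prod.ext ?_ rfl)⟩
      simp only at hn ⊢
      rw [← hn]
      field_simp
      ring

lemma annihilatorEquiv_apply {β : ℝ} (hβ : β ≠ 0) (t : ℕ) (j : ZMod q) (n : ℤ) :
    (annihilatorEquiv hβ t (j, n) : TimeGroup q)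
      = (-(β⁻¹ * (t * j.val / q)) + β⁻¹ * n, j) := rfl

/-- The Fourier transform on `ℝ × ℤ_q`. -/
def fhat (F : TimeGroup q → ℂ) (ζ : TimeGroup q) : ℂ :=
  ∑ k, ∫ x, F (x, k) * (starRingEnd ℂ) (pairing (x, k) ζ : ℂ)

/-- The annihilator consists of one coset of β⁻¹ℤ for each of the finitely many residues, so the
Wiener bound with step β⁻¹ applies to each. -/
lemma IsWiener.summable_annihilator {f : TimeGroup q → ℂ} (hf : IsWiener f) {β : ℝ} (hβ : β ≠ 0)
    (t : ℕ) (y : TimeGroup q) :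
    Summable fun ξ : annihilator (lattice q β t) => ‖f (y - ξ)‖ := by
  rw [← (Equiv.neg _).summable_iff, ← (annihilatorEquiv hβ t).summable_iff]
  refine (summable_prod_of_nonneg fun _ => norm_nonneg _).2 ⟨fun j => ?_, Summable.of_finite⟩
  obtain ⟨b, hb, h⟩ := hf.bound β⁻¹ (inv_ne_zero hβ) |y.1 - β⁻¹ * (t * j.val / q)| (y.2 + j)
  refine Summable.of_nonneg_of_le (fun _ => norm_nonneg _) (fun n => ?_) hb
  refine le_of_eq_of_le ?_ (h n _ le_rfl)
  simp only [Equiv.neg_apply, NegMemClass.coe_neg, sub_neg_eq_add,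
    annihilatorEquiv_apply]
  congr 2
  refine Prod.ext ?_ rfl
  simp only [Prod.fst_add]
  ring

/-- **Poisson summation** over the lattice `{(β m, t m)}` of `ℝ × ℤ_q`. -/
theorem IsWiener.poisson {f : TimeGroup q → ℂ} (hf : IsWiener f) {β : ℝ} (hβ : β ≠ 0) (t : ℕ)
    (hs : Summable fun γ : lattice q β t => ‖fhat f γ‖) (y : TimeGroup q) :
    ∑' γ : lattice q β t, fhat f γ * (pairing y γ : ℂ)
      = ((|β| : ℝ) : ℂ)⁻¹ * ∑' ξ : annihilator (lattice q β t), f (y - ξ) := by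
  have hβ' := inv_ne_zero hβ
  set c : ZMod q → ℝ := fun j => y.1 - β⁻¹ * (t * j.val / q) with hc
  -- The q cosets of the annihilator are folded into one function on ℝ: the values H(n) together run
  -- over y plus the annihilator, and the Fourier transform of H at m is |β| times the term of the
  -- lattice point with index m.
  let H : C(ℝ, ℂ) := ∑ j, hf.line β⁻¹ (c j) (y.2 + j)
  have hH : ∀ u, H u = ∑ j, hf.line β⁻¹ (c j) (y.2 + j) u := fun u =>
    ContinuousMap.sum_apply _ _ _
  have h_norm : ∀ K : TopologicalSpace.Compacts ℝ, Summable fun n : ℤ =>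
      ‖(H.comp (ContinuousMap.addRight (n : ℝ))).restrict K‖ := fun K => by
    refine Summable.of_nonneg_of_le (fun _ => norm_nonneg _) (fun n => ?_)
      (summable_sum fun j (_ : j ∈ Finset.univ) =>
        hf.summable_restrict hβ' (c j) (y.2 + j) K)
    refine (ContinuousMap.norm_le _ (Finset.sum_nonneg fun _ _ => norm_nonneg _)).2 fun u => ?_
    simp only [ContinuousMap.restrict_apply, ContinuousMap.comp_apply, hH]
    refine (norm_sum_le _ _).trans (Finset.sum_le_sum fun j _ => ?_)
    exact (((hf.line β⁻¹ (c j) (y.2 + j)).comp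
      (ContinuousMap.addRight (n : ℝ))).restrict K).norm_coe_le_norm u
  have hF : ∀ m : ℤ, 𝓕 (H : ℝ → ℂ) m = ((|β| : ℝ) : ℂ) *
      (fhat f ((latticeMap β t m : lattice q β t) : TimeGroup q) *
        (pairing y ((latticeMap β t m : lattice q β t) : TimeGroup q) : ℂ)) := fun m => by
    have h1 : 𝓕 (H : ℝ → ℂ) m = ∑ j, 𝓕 (hf.line β⁻¹ (c j) (y.2 + j) : ℝ → ℂ) m := by
      rw [← fourier_finsetSum _ fun j _ => hf.integrable_line hβ' (c j) (y.2 + j)]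
      exact congrArg (fun g : ℝ → ℂ => 𝓕 g (m : ℝ)) (funext hH)
    have h2 : ∀ ζ, fhat f ζ = ∑ j, ∫ x, f (x, y.2 + j) *
        (starRingEnd ℂ) (pairing (x, y.2 + j) ζ : ℂ) := fun ζ =>
      (Equiv.sum_comp (Equiv.addLeft y.2) fun k =>
        ∫ x, f (x, k) * (starRingEnd ℂ) (pairing (x, k) ζ : ℂ)).symm
    rw [h1, h2, Finset.sum_mul, Finset.mul_sum]
    refine Finset.sum_congr rfl fun j _ => ?_
    rw [hf.fourier_line hβ]
    have hγ : ((latticeMap β t m : lattice q β t) : TimeGroup q)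
        = (β * m, (m : ZMod q) * (t : ZMod q)) := rfl
    rw [hγ]
    set τ : ZMod q := (m : ZMod q) * (t : ZMod q) with hτ
    have e1 : ∀ v : ℝ, (starRingEnd ℂ) (pairing (v, y.2 + j) (β * m, τ) : ℂ)
        = ((𝐞 (-(m * β * v)) : Circle) : ℂ) *
          (starRingEnd ℂ) (ZMod.toCircle ((y.2 + j) * τ) : ℂ) := fun v => by
      rw [AddChar.map_neg_eq_inv, Circle.coe_inv_eq_conj, ← map_mul, ← Circle.coe_mul, pairing]
      congr 4
      ring
    -- The offset c_j produces exactly the phase that cancels the character of ℤ_q at j, leaving the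
    -- pairing with y, which does not depend on j.
    have e2 : 𝐞 (m * β * c j) = (ZMod.toCircle ((y.2 + j) * τ))⁻¹ * pairing y (β * m, τ) := by
      have e3 : ZMod.toCircle (j * τ) = 𝐞 (m * (t * j.val / q)) := by
        have : j * τ = ((m * t * j.val : ℤ) : ZMod q) := by
          push_cast
          rw [ZMod.natCast_zmod_val, mul_comm]
        rw [this, toCircle_intCast_eq]
        congr 1
        push_cast
        ring
      have e4 : 𝐞 (m * β * c j) * 𝐞 (m * (t * j.val / q)) = 𝐞 (y.1 * (β * m)) := by
        rw [← AddChar.map_add_eq_mul, hc]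
        congr 1
        field_simp
        ring
      simp only [pairing]
      rw [add_mul, AddChar.map_add_eq_mul, ← e4, ← e3, mul_inv, mul_right_comm]
      rw [mul_assoc, mul_right_comm (ZMod.toCircle (y.2 * τ))⁻¹]
      simp [mul_assoc, mul_left_comm]
    simp only [e1, ← mul_assoc, integral_mul_const]
    rw [e2]
    simp only [Circle.coe_mul, Circle.coe_inv_eq_conj]
    ring
  have h_sum : Summable fun m : ℤ => 𝓕 (H : ℝ → ℂ) m := by
    simp only [hF]
    refine Summable.mul_left _ (Summable.of_norm ?_)
    simp only [norm_mul, Circle.norm_coe, mul_one]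
    exact hs.comp_injective (latticeMap_bijective hβ t).1
  have key := Real.tsum_eq_tsum_fourier h_norm h_sum 0
  have e1 : ∑' n : ℤ, H (0 + n) = ∑' ξ : annihilator (lattice q β t), f (y - ξ) := by
    let e : ℤ × ZMod q ≃ annihilator (lattice q β t) :=
      ((Equiv.prodComm ℤ (ZMod q)).trans (annihilatorEquiv hβ t)).trans (Equiv.neg _)
    have hsum : Summable fun p : ℤ × ZMod q => f (y - e p) :=
      e.summable_iff.2 (hf.summable_annihilator hβ t y).of_norm
    rw [← e.tsum_eq, hsum.tsum_prod]
    refine tsum_congr fun n => ?_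
    rw [zero_add, hH, tsum_fintype]
    refine Finset.sum_congr rfl fun j _ => ?_
    have he : (e (n, j) : TimeGroup q) = -(annihilatorEquiv hβ t (j, n) : TimeGroup q) := rfl
    rw [he, sub_neg_eq_add, annihilatorEquiv_apply, IsWiener.line_apply]
    congr 1
    refine Prod.ext ?_ rfl
    simp only [Prod.fst_add, hc]
    ring
  rw [e1] at key
  rw [key]
  simp only [QuotientAddGroup.mk_zero, fourier_eval_zero, mul_one, hF]
  have hβa : ((|β| : ℝ) : ℂ) ≠ 0 := by exact_mod_cast (abs_pos.2 hβ).ne'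
  rw [tsum_mul_left, inv_mul_cancel_left₀ hβa,
    ← (Equiv.ofBijective _ (latticeMap_bijective hβ t)).tsum_eq]
  rfl

end Poisson

/-! ### The fundamental identity of Gabor analysis -/

section Walnut

open Filter Topology

variable {q : ℕ}

lemma IsWiener.exists_norm_le [NeZero q] {f : TimeGroup q → ℂ} (hf : IsWiener f) :
    ∃ M : ℝ, ∀ y, ‖f y‖ ≤ M := by
  have h : ∀ k, ∃ M : ℝ, ∀ x, ‖f (x, k)‖ ≤ M := fun k => by
    obtain ⟨b, hb, h⟩ := hf.bound 1 one_ne_zero 1 k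
    refine ⟨∑' n, b n, fun x => ?_⟩
    have h0 : ∀ n, 0 ≤ b n := fun n => (norm_nonneg _).trans (h n 0 (by simp))
    have h1 := h ⌊x⌋ (Int.fract x) (by
      rw [abs_of_nonneg (Int.fract_nonneg x)]
      exact (Int.fract_lt_one x).le)
    rw [one_mul, Int.fract_add_floor] at h1
    exact h1.trans (hb.le_tsum _ fun n _ => h0 n)
  choose M hM using h
  refine ⟨∑ k, M k, fun y => (hM y.2 y.1).trans ?_⟩
  exact Finset.single_le_sum (f := M) (fun k _ => (norm_nonneg _).trans (hM k 0))
    (Finset.mem_univ _)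

lemma IsWiener.mul_conj_sub [NeZero q] {f g : TimeGroup q → ℂ} (hf : IsWiener f)
    (hg : IsWiener g) (z : TimeGroup q) :
    IsWiener fun y => f y * (starRingEnd ℂ) (g (y - z)) where
  cont k := (hf.cont k).mul (Complex.continuous_conj.comp
    ((hg.cont (k - z.2)).comp (continuous_id.sub continuous_const)))
  bound a ha R k := by
    obtain ⟨b, hb, h⟩ := hf.bound a ha R k
    obtain ⟨M, hM⟩ := hg.exists_norm_le
    refine ⟨fun n => b n * M, hb.mul_right _, fun n y hy => ?_⟩
    rw [norm_mul, RCLike.norm_conj]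
    exact mul_le_mul (h n y hy) (hM _) (norm_nonneg _) ((norm_nonneg _).trans (h n y hy))

variable [NeZero q]

lemma tfShift_coe (ν : Phase q) (f : L2 q) :
    tfShift ν f =ᵐ[timeMeasure q] fun y => (pairing y ν.2 : ℂ) * f (y - ν.1) := by
  filter_upwards [modulation_coe ν.2 (translation ν.1 f), translation_coe ν.1 f] with y h1 h2
  rw [tfShift, mul_apply_eq_comp, h1, h2]

lemma tfShift_coe_of_ae_eq (ν : Phase q) {f : L2 q} {F : TimeGroup q → ℂ}
    (h : f =ᵐ[timeMeasure q] F) :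
    tfShift ν f =ᵐ[timeMeasure q] fun y => (pairing y ν.2 : ℂ) * F (y - ν.1) := by
  filter_upwards [tfShift_coe ν f, (measurePreserving_sub ν.1).quasiMeasurePreserving.ae h]
    with y h1 h2
  rw [h1, h2]

/-- For fixed translation the coefficients, as functions of the frequency, are one Fourier
transform. This is what brings Poisson summation in. -/
lemma inner_tfShift_eq_fhat {f g : L2 q} {F G : TimeGroup q → ℂ} (hF : f =ᵐ[timeMeasure q] F)
    (hG : g =ᵐ[timeMeasure q] G) (ν : Phase q) :
    ⟪tfShift ν g, f⟫_ℂ = fhat (fun y => F y * (starRingEnd ℂ) (G (y - ν.1))) ν.2 := by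
  have h : (fun y => ⟪tfShift ν g y, f y⟫_ℂ) =ᵐ[timeMeasure q]
      fun y => F y * (starRingEnd ℂ) (G (y - ν.1)) * (starRingEnd ℂ) (pairing y ν.2 : ℂ) := by
    filter_upwards [hF, tfShift_coe_of_ae_eq ν hG] with y h1 h2
    rw [h1, h2, RCLike.inner_apply, map_mul]
    ring
  rw [L2.inner_def, integral_congr_ae h,
    integral_timeMeasure ((L2.integrable_inner (𝕜 := ℂ) (tfShift ν g) f).congr h)]
  rfl

/-- The operator `∑_{ν ∈ D} ⟨f, π(ν) g⟩ π(ν)`. -/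
def corr (D : AddSubgroup (Phase q)) (f g : L2 q) : L2 q →L[ℂ] L2 q :=
  -- The value is 0 if the series is not summable; `hasSum_corr` provides convergence for ℓ¹
  -- coefficients.
  ∑' ν : D, ⟪tfShift (ν : Phase q) g, f⟫_ℂ • tfShift (ν : Phase q)

lemma hasSum_corr {D : AddSubgroup (Phase q)} {s : ℝ≥0} {f g : L2 q}
    (h : MemL1 D s fun ν => ⟪tfShift (ν : Phase q) g, f⟫_ℂ) :
    HasSum (fun ν : D => ⟪tfShift (ν : Phase q) g, f⟫_ℂ • tfShift (ν : Phase q)) (corr D f g) :=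
  (summable_norm_smul h.summable_norm).of_norm.hasSum

variable {w : 𝓢(ℝ, ℂ)} {s : ℝ≥0} {α β : ℝ} {r t : ℕ}

/-- Walnut's representation of the operator `∑_{ν ∈ Λ × Γ} ⟨f, π(ν) g⟩ π(ν)`. -/
theorem walnut (hw : w ≠ 0) (hα : α ≠ 0) (hβ : β ≠ 0) {Λ Γ Γ' : AddSubgroup (TimeGroup q)}
    (hΛ : Λ = lattice q α r) (hΓ : Γ = lattice q β t) (hΓ' : Γ' = annihilator Γ) {f g h : L2 q}
    (hf : f ∈ M1 q w s) (hg : g ∈ M1 q w s) {F G H : TimeGroup q → ℂ} (hF : IsWiener F)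
    (hG : IsWiener G) (hH : IsWiener H) (hfF : f =ᵐ[timeMeasure q] F)
    (hgG : g =ᵐ[timeMeasure q] G) (hhH : h =ᵐ[timeMeasure q] H) :
    corr (Λ.prod Γ) f g h =ᵐ[timeMeasure q] fun y => ((|β| : ℝ) : ℂ)⁻¹ *
      ∑' l : Λ, ∑' ξ : Γ', H (y - l) * (F (y - ξ) * (starRingEnd ℂ) (G (y - ξ - l))) := by
  -- The subgroups enter through equations so that the statement also applies to annihilators that
  -- are merely equal to such lattices, without rewriting inside subtypes.
  subst hΛ hΓ hΓ'
  set Λ := lattice q α r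
  set Γ := lattice q β t
  have := countable_gaborLattice (q := q) r t hα hβ
  have hm : MemL1 (Λ.prod Γ) s fun ν => ⟪tfShift (ν : Phase q) g, f⟫_ℂ :=
    memL1_inner hw r t hα hβ hf hg
  have hs := hm.summable_norm
  have h1 : corr (Λ.prod Γ) f g h
      = ∑' ν : Λ.prod Γ, ⟪tfShift (ν : Phase q) g, f⟫_ℂ • tfShift (ν : Phase q) h :=
    (((ContinuousLinearMap.apply ℂ (L2 q) h).hasSum (hasSum_corr hm)).tsum_eq).symm
  -- Absolute convergence in L² norm is what permits evaluating the sum pointwise almost everywhere;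
  -- countability of the lattice then gives one null set for all terms.
  have h2 : ∑' ν : Λ.prod Γ, ‖⟪tfShift (ν : Phase q) g, f⟫_ℂ • tfShift (ν : Phase q) h‖ₑ ≠ ∞ := by
    have h3 : Summable fun ν : Λ.prod Γ =>
        ‖⟪tfShift (ν : Phase q) g, f⟫_ℂ • tfShift (ν : Phase q) h‖ := by
      simp only [norm_smul, norm_tfShift_apply]
      exact hs.mul_right _
    simpa only [ofReal_norm] using h3.tsum_ofReal_ne_top
  have h3 : ∀ᵐ y ∂timeMeasure q, ∀ ν : Λ.prod Γ,
      (⟪tfShift (ν : Phase q) g, f⟫_ℂ • tfShift (ν : Phase q) h : L2 q) y =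
        ⟪tfShift (ν : Phase q) g, f⟫_ℂ *
          ((pairing y (ν : Phase q).2 : ℂ) * H (y - (ν : Phase q).1)) := by
    rw [ae_all_iff]
    intro ν
    filter_upwards [tfShift_coe_of_ae_eq (ν : Phase q) hhH,
      Lp.coeFn_smul ⟪tfShift (ν : Phase q) g, f⟫_ℂ (tfShift (ν : Phase q) h)] with y e1 e2
    rw [e2, Pi.smul_apply, e1, smul_eq_mul]
  obtain ⟨M, hM⟩ := hH.exists_norm_le
  filter_upwards [Lp.coeFn_tsum h2, h3] with y e1 e2
  rw [h1, e1, tsum_congr e2]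
  have hsum : Summable fun ν : Λ.prod Γ => ⟪tfShift (ν : Phase q) g, f⟫_ℂ *
      ((pairing y (ν : Phase q).2 : ℂ) * H (y - (ν : Phase q).1)) := by
    refine Summable.of_norm (Summable.of_nonneg_of_le (fun _ => norm_nonneg _) (fun ν => ?_)
      (hs.mul_right M))
    rw [norm_mul, norm_mul, Circle.norm_coe, one_mul]
    exact mul_le_mul_of_nonneg_left (hM _) (norm_nonneg _)
  have hsum' := (prodEquiv Λ Γ).summable_iff.2 hsum
  rw [← tsum_mul_left]
  refine ((prodEquiv Λ Γ).tsum_eq _).symm.trans (hsum'.tsum_prod.trans ?_)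
  simp only [Function.comp]
  -- For a fixed translation l, the sum over frequencies is evaluated by Poisson summation for F ·
  -- conj G(· - l).
  refine tsum_congr fun l => ?_
  have hl : Summable fun γ : Γ =>
      ‖fhat (fun y => F y * (starRingEnd ℂ) (G (y - l))) (γ : TimeGroup q)‖ := by
    have := ((prodEquiv Λ Γ).summable_iff.2 hs).prod_factor l
    refine this.congr fun γ => ?_
    simp only [Function.comp]
    rw [inner_tfShift_eq_fhat hfF hgG]
    rfl
  rw [tsum_mul_left, mul_left_comm, ← (hF.mul_conj_sub hG l).poisson hβ t hl y, ← tsum_mul_left]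
  refine tsum_congr fun γ => ?_
  rw [inner_tfShift_eq_fhat hfF hgG]
  simp only [prodEquiv, Equiv.coe_fn_mk]
  ring

/-- With tt' = -1 mod q, an element (x, k) for which βx + tk/q is an integer n is m(1/(qβ), t') for
m = qn - tk: the real part is immediate, and mt' = -tt'k = k mod q. Thus the annihilator is cyclic.
-/
lemma annihilator_lattice (hβ : β ≠ 0) {t' : ℕ} (h : (t : ZMod q) * t' = -1) :
    annihilator (lattice q β t) = lattice q (q * β)⁻¹ t' := by
  have hq : (q : ℝ) ≠ 0 := by exact_mod_cast NeZero.ne q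
  ext ⟨x, k⟩
  rw [mem_annihilator_iff, mem_lattice_iff]
  constructor
  · rintro ⟨n, hn⟩
    refine ⟨q * n - t * k.val, Prod.ext ?_ ?_⟩
    · simp only at hn ⊢
      push_cast
      rw [← hn]
      field_simp
      ring
    · push_cast
      rw [ZMod.natCast_zmod_val, ZMod.natCast_self]
      linear_combination k * h
  · rintro ⟨m, hm⟩
    obtain ⟨rfl, rfl⟩ := Prod.ext_iff.1 hm
    simp only
    set k : ZMod q := (m : ZMod q) * t'
    have h1 : ((m + t * k.val : ℤ) : ZMod q) = 0 := by
      push_cast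
      rw [ZMod.natCast_zmod_val]
      linear_combination (m : ZMod q) * h
    obtain ⟨n, hn⟩ := (ZMod.intCast_zmod_eq_zero_iff_dvd _ _).1 h1
    refine ⟨n, ?_⟩
    have h2 : (m : ℝ) + t * k.val = q * n := by exact_mod_cast hn
    field_simp
    linarith

lemma exists_neg_inverse (ht : t.Coprime q) : ∃ t' : ℕ, (t : ZMod q) * t' = -1 := by
  refine ⟨(-(t : ZMod q)⁻¹).val, ?_⟩
  rw [ZMod.natCast_zmod_val, mul_neg, ZMod.coe_mul_inv_eq_one t ht]

/-- The adjoint lattice is again of the form `Λ × Γ`. -/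
lemma exists_adjointLattice_eq (hr : r.Coprime q) (ht : t.Coprime q) (hα : α ≠ 0) (hβ : β ≠ 0) :
    ∃ r' t' : ℕ, annihilator (lattice q β t) = lattice q (q * β)⁻¹ t' ∧
      annihilator (lattice q α r) = lattice q (q * α)⁻¹ r' ∧
      annihilator (annihilator (lattice q β t)) = lattice q β t ∧
      annihilator (annihilator (lattice q α r)) = lattice q α r := by
  have hq : (q : ℝ) ≠ 0 := by exact_mod_cast NeZero.ne q
  obtain ⟨r', hr'⟩ := exists_neg_inverse (q := q) hr
  obtain ⟨t', ht'⟩ := exists_neg_inverse (q := q) ht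
  -- The relation between t and t' is symmetric and a ↦ (qa)⁻¹ is an involution, so taking
  -- annihilators twice gives back the lattice.
  have key : ∀ {a : ℝ} {n n' : ℕ}, a ≠ 0 → (n : ZMod q) * n' = -1 →
      annihilator (annihilator (lattice q a n)) = lattice q a n := fun {a n n'} ha h => by
    rw [annihilator_lattice ha h, annihilator_lattice (inv_ne_zero (mul_ne_zero hq ha))
      (mul_comm (n : ZMod q) n' ▸ h)]
    congr 1
    field_simp
  exact ⟨r', t', annihilator_lattice hβ ht', annihilator_lattice hα hr', key hβ ht', key hα hr'⟩

/-- Since G is bounded, the double series is dominated by a product of the summable families of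
values of H and F. This justifies the exchange of the two sums in the fundamental identity. -/
lemma walnut_summable {F G H : TimeGroup q → ℂ} (hF : IsWiener F) (hG : IsWiener G)
    (hH : IsWiener H) (hβ : β ≠ 0) {Λ : AddSubgroup (TimeGroup q)} (hα : α ≠ 0) {r' : ℕ}
    (hΛ : Λ = annihilator (lattice q α r')) (y : TimeGroup q) :
    Summable (Function.uncurry fun (l : Λ) (ξ : annihilator (lattice q β t)) =>
      H (y - l) * (F (y - ξ) * (starRingEnd ℂ) (G (y - ξ - l)))) := by
  subst hΛ
  obtain ⟨M, hM⟩ := hG.exists_norm_le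
  refine Summable.of_norm (Summable.of_nonneg_of_le (fun _ => norm_nonneg _) (fun p => ?_)
    (((hH.summable_annihilator hα r' y).mul_of_nonneg (hF.summable_annihilator hβ t y)
      (fun _ => norm_nonneg _) (fun _ => norm_nonneg _)).mul_right M))
  simp only [Function.uncurry, norm_mul, RCLike.norm_conj]
  rw [mul_assoc]
  exact mul_le_mul_of_nonneg_left (mul_le_mul_of_nonneg_left (hM _) (norm_nonneg _))
    (norm_nonneg _)

/-- The **fundamental identity of Gabor analysis** for `Λ × Γ` and `Γ^⊥ × Λ^⊥`. -/
theorem fundamental_identity (hw : w ≠ 0) (hr : r.Coprime q) (ht : t.Coprime q) (hα : α ≠ 0)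
    (hβ : β ≠ 0) {f g h : L2 q} (hf : f ∈ M1 q w s) (hg : g ∈ M1 q w s) (hh : h ∈ M1 q w s) :
    corr (gaborLattice q r t α β) f g h
      = ((q * |α * β| : ℝ) : ℂ)⁻¹ • corr (adjointLattice q r t α β) h g f := by
  have hq : (q : ℝ) ≠ 0 := by exact_mod_cast NeZero.ne q
  obtain ⟨r', t', e1, e2, e3, e4⟩ := exists_adjointLattice_eq (q := q) hr ht hα hβ
  obtain ⟨F, hF, hfF⟩ := exists_isWiener hw hf
  obtain ⟨G, hG, hgG⟩ := exists_isWiener hw hg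
  obtain ⟨H, hH, hhH⟩ := exists_isWiener hw hh
  refine Lp.ext ?_
  have hβ' := inv_ne_zero (mul_ne_zero hq hβ)
  have hα' := inv_ne_zero (mul_ne_zero hq hα)
  -- Both sides are expanded by `walnut`. For the adjoint lattice the inner sum runs over Λ^⊥⊥ = Λ,
  -- so both expansions are sums over Λ and Γ^⊥, in opposite orders.
  filter_upwards [walnut hw hα hβ rfl rfl rfl hf hg hF hG hH hfF hgG hhH,
    walnut hw hβ' hα' e1 e2 e4.symm hh hg hH hG hF hhH hgG hfF,
    Lp.coeFn_smul ((q * |α * β| : ℝ) : ℂ)⁻¹ (corr (adjointLattice q r t α β) h g f)]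
    with y h1 h2 h3
  rw [h1, h3, Pi.smul_apply, h2, smul_eq_mul,
    ← Summable.tsum_comm (walnut_summable hF hG hH hβ hα' (e4.symm.trans (by rw [e2])) y),
    ← mul_assoc]
  congr 1
  -- The adjoint lattice has frequency step (qα)⁻¹, and q|α| / (q|αβ|) = |β|⁻¹.
  · rw [abs_inv, abs_mul, abs_mul, Nat.abs_cast]
    have := abs_pos.2 hα
    have := abs_pos.2 hβ
    push_cast
    have ha : ((|α| : ℝ) : ℂ) ≠ 0 := by exact_mod_cast (abs_pos.2 hα).ne'
    have hb : ((|β| : ℝ) : ℂ) ≠ 0 := by exact_mod_cast (abs_pos.2 hβ).ne'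
    have hqc : (q : ℂ) ≠ 0 := by exact_mod_cast NeZero.ne q
    field_simp
  · refine tsum_congr fun ξ => tsum_congr fun l => ?_
    rw [sub_right_comm]
    ring

lemma pairing_comm (y ζ : TimeGroup q) : pairing y ζ = pairing ζ y := by
  simp only [pairing, mul_comm]

/-- Time-frequency shifts over `Λ × Γ` and over `Γ^⊥ × Λ^⊥` commute. -/
lemma tfShift_commute {ν μ : Phase q} (hν : ν ∈ gaborLattice q r t α β)
    (hμ : μ ∈ adjointLattice q r t α β) : Commute (tfShift ν) (tfShift μ) := by
  have h1 : cocycle ν μ = 1 := by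
    rw [cocycle, (AddSubgroup.mem_prod.1 hμ).2 _ (AddSubgroup.mem_prod.1 hν).1, inv_one]
  have h2 : cocycle μ ν = 1 := by
    rw [cocycle, pairing_comm, (AddSubgroup.mem_prod.1 hμ).1 _ (AddSubgroup.mem_prod.1 hν).2,
      inv_one]
  rw [Commute, SemiconjBy, tfShift_mul, tfShift_mul, h1, h2, add_comm]

end Walnut

/-! ### Tight Gabor frames with windows in the modulation space -/

section TightFrame

open Filter Topology

/-- A smooth function, supported in `[-1, 1]`, whose squares form a partition of unity under
integer translations. -/
def bump (x : ℝ) : ℝ :=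
  Real.sin (Real.pi / 2 * Real.smoothTransition (x + 1)) *
    Real.cos (Real.pi / 2 * Real.smoothTransition x)

lemma contDiff_bump : ContDiff ℝ ((⊤ : ℕ∞) : WithTop ℕ∞) bump := by
  have h := Real.smoothTransition.contDiff (n := ⊤)
  exact (Real.contDiff_sin.comp (contDiff_const.mul (h.comp (contDiff_id.add contDiff_const)))).mul
    (Real.contDiff_cos.comp (contDiff_const.mul h))

lemma bump_eq_zero {x : ℝ} (hx : 1 ≤ |x|) : bump x = 0 := by
  rcases le_abs'.1 hx with h | h
  · rw [bump, Real.smoothTransition.zero_of_nonpos (by linarith)]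
    simp
  · rw [bump, Real.smoothTransition.one_of_one_le h]
    simp

/-- On [0, 1] one of the two factors of each bump is 1, so the bumps at x and x - 1 are the cosine
and the sine of the same angle. -/
lemma bump_sq_add {x : ℝ} (h0 : 0 ≤ x) (h1 : x ≤ 1) : bump x ^ 2 + bump (x - 1) ^ 2 = 1 := by
  rw [bump, bump, Real.smoothTransition.one_of_one_le (by linarith : 1 ≤ x + 1),
    Real.smoothTransition.zero_of_nonpos (by linarith : x - 1 ≤ 0), sub_add_cancel]
  simp

lemma hasSum_bump_sq (x : ℝ) : HasSum (fun m : ℤ => bump (x - m) ^ 2) 1 := by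
  have h : ∀ m ∉ ({⌊x⌋, ⌊x⌋ + 1} : Finset ℤ), bump (x - m) ^ 2 = 0 := fun m hm => by
    simp only [Finset.mem_insert, Finset.mem_singleton, not_or] at hm
    rw [bump_eq_zero, zero_pow two_ne_zero]
    have h1 := Int.floor_le x
    have h2 := Int.lt_floor_add_one x
    rcases lt_or_gt_of_ne hm.1 with h | h
    · have : (m : ℝ) + 1 ≤ ⌊x⌋ := by exact_mod_cast h
      rw [abs_of_nonneg] <;> linarith
    · have : (⌊x⌋ : ℝ) + 2 ≤ m := by
        have : ⌊x⌋ + 2 ≤ m := by lia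
        exact_mod_cast this
      rw [abs_of_nonpos] <;> linarith
  have h1 := bump_sq_add (Int.fract_nonneg x) (Int.fract_lt_one x).le
  have h2 : ∑ m ∈ ({⌊x⌋, ⌊x⌋ + 1} : Finset ℤ), bump (x - m) ^ 2 = 1 := by
    rw [Finset.sum_pair (by simp), ← h1, Int.fract]
    push_cast
    rw [sub_sub]
  exact h2 ▸ hasSum_sum_of_ne_finset_zero h

lemma exists_schwartz_bump (c δ a : ℝ) (hδ : δ ≠ 0) :
    ∃ ψ : 𝓢(ℝ, ℂ), ∀ x, ψ x = ((c * bump (x / δ - a) : ℝ) : ℂ) := by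
  have h1 : ContDiff ℝ ((⊤ : ℕ∞) : WithTop ℕ∞) fun x : ℝ => ((c * bump (x / δ - a) : ℝ) : ℂ) :=
    Complex.ofRealCLM.contDiff.comp (contDiff_const.mul
      (contDiff_bump.comp ((contDiff_id.div_const δ).sub contDiff_const)))
  have h2 : HasCompactSupport fun x : ℝ => ((c * bump (x / δ - a) : ℝ) : ℂ) := by
    refine HasCompactSupport.of_support_subset_isCompact
      (isCompact_closedBall (0 : ℝ) (|δ| * (1 + |a|))) fun x hx => ?_
    rw [mem_closedBall_zero_iff, Real.norm_eq_abs]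
    by_contra! hlt
    refine hx ?_
    have h3 : 1 + |a| ≤ |x / δ| := by
      rw [abs_div, le_div_iff₀ (abs_pos.2 hδ), mul_comm]
      exact hlt.le
    simp only
    rw [bump_eq_zero, mul_zero, Complex.ofReal_zero]
    have := abs_sub_abs_le_abs_sub (x / δ) a
    linarith
  exact ⟨h2.toSchwartzMap h1, fun x => rfl⟩

variable {q : ℕ} [NeZero q] {w : 𝓢(ℝ, ℂ)} {s : ℝ≥0} {α β : ℝ} {t : ℕ}

lemma embed_toLp_coe (k : ZMod q) (φ : 𝓢(ℝ, ℂ)) :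
    embed k (φ.toLp 2 volume) =ᵐ[timeMeasure q] embedFun k φ := by
  filter_upwards [embed_coe k (φ.toLp 2 volume), ae_timeMeasure
    (P := fun y => (φ.toLp 2 volume : ℝ → ℂ) y.1 = φ y.1) fun _ => φ.coeFn_toLp 2 volume]
    with y h1 h2
  rw [h1, embedFun, embedFun, h2]

/-- Elements of the annihilator over the residue 0 are spaced by 1/|β|. Windows with smaller support
in one slice are hence disjoint from their nontrivial translates. -/
lemma eq_zero_of_mem_annihilator {ξ : TimeGroup q} (hξ : ξ ∈ annihilator (lattice q β t))
    (h2 : ξ.2 = 0) (h1 : |β| * |ξ.1| < 1) (hβ : β ≠ 0) : ξ = 0 := by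
  obtain ⟨n, hn⟩ := mem_annihilator_iff.1 hξ
  rw [h2, ZMod.val_zero, Nat.cast_zero, mul_zero, zero_div, add_zero] at hn
  rw [← abs_mul, hn] at h1
  have h3 : |n| < 1 := by exact_mod_cast h1
  rw [Int.abs_lt_one_iff.1 h3, Int.cast_zero] at hn
  exact Prod.ext ((mul_eq_zero.1 hn).resolve_left hβ) h2

/-- There are finitely many windows in the modulation space that generate a tight Gabor frame over
`Λ × Γ`. -/
theorem exists_tightFrame (hw : w ≠ 0) (r t : ℕ) (hα : α ≠ 0) (hβ : β ≠ 0) :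
    ∃ (n : ℕ) (g : Fin n → L2 q), (∀ i, g i ∈ M1 q w s) ∧
      ∀ f ∈ M1 q w s, ∑ i, corr (gaborLattice q r t α β) f (g i) (g i) = f := by
  -- N is chosen so that δ = α/N satisfies 2|δ||β| ≤ 1. A bump of scale δ then has support of length
  -- at most 1/|β|, and N of them, shifted by δ, fill one period α.
  obtain ⟨N₀, hN₀⟩ := exists_nat_ge (2 * |α| * |β|)
  set N := N₀ + 1
  have hN : (0 : ℝ) < N := by positivity
  set δ := α / N with hδ_def
  have hδ : δ ≠ 0 := div_ne_zero hα hN.ne'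
  have hδβ : |β| * (2 * |δ|) ≤ 1 := by
    rw [hδ_def, abs_div, abs_of_pos hN, ← mul_div_assoc, ← mul_div_assoc, div_le_one hN]
    have : (N : ℝ) = N₀ + 1 := by push_cast [N]; ring
    linarith
  have hβa := abs_pos.2 hβ
  -- The factor √|β| compensates the |β|⁻¹ in Walnut's representation. Each of the N bumps is placed
  -- in each of the q slices.
  choose ψ hψ using fun i : Fin N => exists_schwartz_bump (√|β|) δ i hδ
  set G : Fin N × ZMod q → TimeGroup q → ℂ := fun p => embedFun p.2 (ψ p.1) with hG
  set g : Fin N × ZMod q → L2 q := fun p => embed p.2 ((ψ p.1).toLp 2 volume) with hg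
  have hgM : ∀ p, g p ∈ M1 q w s := fun p => embed_mem_M1 _ (lintegral_stft_toLp_lt_top s w _)
  have hGW : ∀ p, IsWiener (G p) := fun p => isWiener_embedFun _ _
  have hgG : ∀ p, g p =ᵐ[timeMeasure q] G p := fun p => embed_toLp_coe _ _
  -- the windows at two points that differ by an element of the annihilator
  have hdisj : ∀ (p : Fin N × ZMod q) (z : TimeGroup q) (ξ : annihilator (lattice q β t)),
      ξ ≠ 0 → G p z * (starRingEnd ℂ) (G p (z - ξ)) = 0 := fun p z ξ hξ => by
    by_contra hne
    obtain ⟨hne1, hne2⟩ := mul_ne_zero_iff.1 hne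
    rw [map_ne_zero] at hne2
    simp only [hG, embedFun, ne_eq, ite_eq_right_iff, not_forall, hψ, Prod.snd_sub,
      Prod.fst_sub, Complex.ofReal_eq_zero, mul_eq_zero, not_or] at hne1 hne2
    obtain ⟨e1, -, b1⟩ := hne1
    obtain ⟨e2, -, b2⟩ := hne2
    have c1 := not_le.1 fun h => b1 (bump_eq_zero h)
    have c2 := not_le.1 fun h => b2 (bump_eq_zero h)
    refine hξ (Subtype.ext (eq_zero_of_mem_annihilator ξ.2 ?_ ?_ hβ))
    · rw [e1] at e2
      simpa using e2
    · have h3 : |(ξ : TimeGroup q).1 / δ| < 2 := by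
        have e : (ξ : TimeGroup q).1 / δ = (z.1 / δ - p.1) -
            ((z.1 - (ξ : TimeGroup q).1) / δ - p.1) := by ring
        rw [e]
        exact (abs_sub _ _).trans_lt (by linarith)
      rw [abs_div, div_lt_iff₀ (abs_pos.2 hδ)] at h3
      exact (mul_lt_mul_of_pos_left h3 hβa).trans_le hδβ
  have hsq : ∀ (p : Fin N × ZMod q) (z : TimeGroup q), G p z * (starRingEnd ℂ) (G p z)
      = ((if z.2 = p.2 then |β| * bump (z.1 / δ - p.1) ^ 2 else 0 : ℝ) : ℂ) := fun p z => by
    simp only [hG, embedFun]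
    split_ifs with h
    · rw [hψ, Complex.conj_ofReal, ← Complex.ofReal_mul]
      congr 1
      rw [mul_mul_mul_comm, Real.mul_self_sqrt (abs_nonneg β), sq]
    · simp
  -- the frame operator acts pointwise as multiplication by one
  have hone : ∀ y : TimeGroup q, ∑ p : Fin N × ZMod q, ∑' l : lattice q α r,
      (if (y - (l : TimeGroup q)).2 = p.2 then
        |β| * bump ((y - (l : TimeGroup q)).1 / δ - p.1) ^ 2 else 0 : ℝ) = |β| := fun y => by
    -- Division by N writes each integer as i + Nn. The windows i and the lattice points n thus
    -- together run over all translates in the partition of unity.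
    have h1 := (Int.divModEquiv N).symm.hasSum_iff.2 (hasSum_bump_sq (y.1 / δ))
    have h2 := (Equiv.prodComm (Fin N) ℤ).hasSum_iff.2 h1
    have h3 : ∀ (i : Fin N) (n : ℤ), (y.1 - α * n) / δ - i
        = y.1 / δ - (((Int.divModEquiv N).symm (n, i) : ℤ) : ℝ) := fun i n => by
      simp only [Int.divModEquiv, Equiv.coe_fn_symm_mk, hδ_def]
      push_cast
      field_simp
      ring
    have h4 : ∀ i : Fin N, Summable fun n : ℤ => |β| * bump ((y.1 - α * n) / δ - i) ^ 2 :=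
      fun i => by
        simp only [h3]
        exact (h2.summable.prod_factor i).mul_left _
    rw [Fintype.sum_prod_type]
    have h5 : ∀ i : Fin N, ∑ j : ZMod q, ∑' l : lattice q α r,
        (if (y - (l : TimeGroup q)).2 = j then
          |β| * bump ((y - (l : TimeGroup q)).1 / δ - i) ^ 2 else 0 : ℝ)
        = ∑' n : ℤ, |β| * bump ((y.1 - α * n) / δ - i) ^ 2 := fun i => by
      have e : ∀ j : ZMod q, ∑' l : lattice q α r, (if (y - (l : TimeGroup q)).2 = j then
          |β| * bump ((y - (l : TimeGroup q)).1 / δ - i) ^ 2 else 0 : ℝ)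
          = ∑' n : ℤ, (if y.2 - (n : ZMod q) * r = j then
            |β| * bump ((y.1 - α * n) / δ - i) ^ 2 else 0 : ℝ) := fun j =>
        ((Equiv.ofBijective _ (latticeMap_bijective (q := q) hα r)).tsum_eq _).symm
      simp only [e]
      rw [← Summable.tsum_finsetSum fun j _ => Summable.of_nonneg_of_le
        (fun n => by split_ifs <;> positivity) (fun n => by
          split_ifs
          · exact le_rfl
          · positivity) (h4 i)]
      refine tsum_congr fun n => ?_
      rw [Finset.sum_ite_eq]
      simp
    simp only [h5, h3, tsum_mul_left]
    rw [← Finset.mul_sum, ← tsum_fintype (L := SummationFilter.unconditional _)]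
    have h6 := h2.summable.tsum_prod
    rw [h2.tsum_eq] at h6
    exact (congrArg (|β| * ·) h6.symm).trans (mul_one _)
  refine ⟨_, fun i => g ((Fintype.equivFin _).symm i), fun i => hgM _, fun f hf => ?_⟩
  rw [Equiv.sum_comp (Fintype.equivFin (Fin N × ZMod q)).symm
    fun p => corr (gaborLattice q r t α β) f (g p) (g p)]
  obtain ⟨F, hF, hfF⟩ := exists_isWiener hw hf
  have hwal : ∀ᵐ y ∂timeMeasure q, ∀ p, _ := ae_all_iff.2 fun p =>
    walnut (r := r) (Γ' := annihilator (lattice q β t)) hw hα hβ rfl rfl rfl hf (hgM p) hF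
      (hGW p) (hGW p) hfF (hgG p) (hgG p)
  refine Lp.ext ?_
  filter_upwards [hwal, hfF, Lp.coeFn_fun_finsetSum Finset.univ
    fun p => corr (gaborLattice q r t α β) f (g p) (g p)] with y h1 h2 h3
  rw [h3, Finset.sum_congr rfl fun p _ => h1 p, ← Finset.mul_sum, h2]
  have h4 : ∀ p, ∑' l : lattice q α r, ∑' ξ : annihilator (lattice q β t),
      G p (y - l) * (F (y - ξ) * (starRingEnd ℂ) (G p (y - ξ - l)))
      = F y * ((∑' l : lattice q α r, (if (y - (l : TimeGroup q)).2 = p.2 then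
        |β| * bump ((y - (l : TimeGroup q)).1 / δ - p.1) ^ 2 else 0 : ℝ) : ℝ) : ℂ) := fun p => by
    rw [Complex.ofReal_tsum, ← tsum_mul_left]
    refine tsum_congr fun l => ?_
    -- By disjointness of supports only ξ = 0 survives, so the operator is a multiplication
    -- operator.
    rw [tsum_eq_single 0 fun ξ hξ => ?_]
    · rw [← hsq, ZeroMemClass.coe_zero, sub_zero]
      ring
    · rw [mul_left_comm, sub_right_comm, hdisj p _ ξ hξ, mul_zero]
  rw [Finset.sum_congr rfl fun p _ => h4 p, ← Finset.mul_sum, ← Complex.ofReal_sum, hone y,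
    mul_comm, mul_assoc, mul_inv_cancel₀ (by exact_mod_cast hβa.ne'), mul_one]

end TightFrame

/-! ### Pairs of lattices in duality -/

section Duality

open Filter Topology

/-- A positive element of a star algebra of operators has a square root in the closure. -/
lemma exists_star_mul_self_eq {H : Type*} [NormedAddCommGroup H] [InnerProductSpace ℂ H]
    [CompleteSpace H] {S : StarSubalgebra ℂ (H →L[ℂ] H)} {X : H →L[ℂ] H} (hX : X ∈ S)
    (h0 : 0 ≤ X) : ∃ Y ∈ S.topologicalClosure, star Y * Y = X := by
  refine ⟨CFC.sqrt X, ?_, ?_⟩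
  · rw [CFC.sqrt_eq_real_sqrt X h0]
    have : IsClosed (S.topologicalClosure : Set (H →L[ℂ] H)) :=
      StarSubalgebra.isClosed_topologicalClosure _
    -- The continuous functional calculus of X stays in every closed star subalgebra that contains
    -- X.
    exact cfcₙ_mem (𝕜' := ℂ) _ (StarSubalgebra.le_topologicalClosure _ hX)
  · have h : star (CFC.sqrt X) = CFC.sqrt X :=
      ((ContinuousLinearMap.nonneg_iff_isPositive _).1 (CFC.sqrt_nonneg X)).isSelfAdjoint
    rw [h, CFC.sqrt_mul_sqrt_self X h0]

lemma star_mul_self_le_norm_sq {H : Type*} [NormedAddCommGroup H] [InnerProductSpace ℂ H]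
    [CompleteSpace H] (T : H →L[ℂ] H) :
    star T * T ≤ algebraMap ℂ (H →L[ℂ] H) ((‖T‖ ^ 2 : ℝ) : ℂ) := by
  have h := CStarAlgebra.star_mul_le_algebraMap_norm_sq (a := T)
  rwa [IsScalarTower.algebraMap_apply ℝ ℂ (H →L[ℂ] H)] at h

variable {q : ℕ} [NeZero q] {w : 𝓢(ℝ, ℂ)} {s : ℝ≥0}

/-! ### Operators with correlation coefficients over one lattice -/

section Corr

variable {D : AddSubgroup (Phase q)} {T : L2 q →L[ℂ] L2 q}

lemma commute_of_mem_tfAlgebra (hT : T ∈ tfAlgebra D s) {X : L2 q →L[ℂ] L2 q}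
    (hX : ∀ ν ∈ D, Commute (tfShift ν) X) : Commute T X := by
  obtain ⟨a, -, hT⟩ := hT
  have h1 := hT.mul_left X
  have h2 := hT.mul_right X
  refine h2.unique (h1.congr_fun ?_)
  intro ν
  rw [mul_smul_comm, smul_mul_assoc, (hX ν ν.2).eq]

lemma corr_mem_tfAlgebra {f g : L2 q}
    (h : MemL1 D s fun ν => ⟪tfShift (ν : Phase q) g, f⟫_ℂ) : corr D f g ∈ tfAlgebra D s :=
  ⟨_, h, hasSum_corr h⟩

lemma corr_add_left {f f' g : L2 q} (h : MemL1 D s fun ν => ⟪tfShift (ν : Phase q) g, f⟫_ℂ)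
    (h' : MemL1 D s fun ν => ⟪tfShift (ν : Phase q) g, f'⟫_ℂ) :
    corr D (f + f') g = corr D f g + corr D f' g := by
  refine Eq.symm (((hasSum_corr h).add (hasSum_corr h')).tsum_eq.symm.trans ?_)
  simp only [corr, inner_add_right, add_smul]

lemma corr_smul_left (c : ℂ) (f g : L2 q) : corr D (c • f) g = c • corr D f g := by
  simp only [corr, inner_smul_right, mul_smul, tsum_const_smul'']

/-- Coefficientwise, ⟨Tf, π(ν)g⟩ = ⟨f, T*π(ν)g⟩ = ⟨f, π(ν)T*g⟩. -/
lemma corr_star_apply {f g : L2 q} (hT : ∀ ν ∈ D, Commute (tfShift ν) (star T)) :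
    corr D (T f) g = corr D f (star T g) := by
  refine tsum_congr fun ν => ?_
  rw [← mul_apply_eq_comp, (hT ν ν.2).eq, mul_apply_eq_comp,
    ContinuousLinearMap.star_eq_adjoint, ContinuousLinearMap.adjoint_inner_left]

/-- The adjoint of π(-ν) is π(ν) up to a phase. The same phase occurs conjugated in the coefficient,
so the two cancel after the substitution ν ↦ -ν. -/
lemma star_corr {f g : L2 q} (h : MemL1 D s fun ν => ⟪tfShift (ν : Phase q) g, f⟫_ℂ) :
    star (corr D f g) = corr D g f := by
  refine (hasSum_corr h).star.tsum_eq.symm.trans ((Equiv.neg D).tsum_eq _).symm |>.trans ?_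
  refine tsum_congr fun ν => ?_
  have e : star (tfShift ((-ν : D) : Phase q))
      = ((((pairing (ν : Phase q).1 (ν : Phase q).2)⁻¹ : Circle)) : ℂ) • tfShift (ν : Phase q) := by
    rw [star_tfShift, NegMemClass.coe_neg, neg_neg, ftShift_eq, Circle.smul_def]
  set z := (pairing (ν : Phase q).1 (ν : Phase q).2)⁻¹
  have h1 : star ⟪tfShift ((-ν : D) : Phase q) g, f⟫_ℂ
      = (starRingEnd ℂ) (z : ℂ) * ⟪tfShift (ν : Phase q) f, g⟫_ℂ := by
    rw [← inner_smul_left, ← smul_apply, ← e, ContinuousLinearMap.star_eq_adjoint,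
      ContinuousLinearMap.adjoint_inner_left]
    exact inner_conj_symm _ _
  simp only [Equiv.neg_apply, star_smul]
  rw [h1, e, smul_smul, mul_right_comm, ← Circle.coe_inv_eq_conj, ← Circle.coe_mul,
    inv_mul_cancel, Circle.coe_one, one_mul]

lemma hasSum_inner_corr_self {f h : L2 q}
    (hm : MemL1 D s fun ν => ⟪tfShift (ν : Phase q) f, h⟫_ℂ) :
    HasSum (fun ν : D => ‖⟪tfShift (ν : Phase q) f, h⟫_ℂ‖ ^ 2) (RCLike.re ⟪h, corr D h f f⟫_ℂ) := by
  let Φ : (L2 q →L[ℂ] L2 q) →L[ℂ] ℂ := (innerSL ℂ h).comp (ContinuousLinearMap.apply ℂ (L2 q) f)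
  have h1 := RCLike.hasSum_re ℂ (Φ.hasSum (hasSum_corr hm))
  refine h1.congr_fun fun ν => ?_
  have h2 : Φ (⟪tfShift (ν : Phase q) f, h⟫_ℂ • tfShift (ν : Phase q))
      = ⟪tfShift (ν : Phase q) f, h⟫_ℂ * ⟪h, tfShift (ν : Phase q) f⟫_ℂ := by
    rw [map_smul]
    rfl
  rw [h2, ← inner_conj_symm h, RCLike.mul_conj, ← RCLike.ofReal_pow, RCLike.ofReal_re]

end Corr

/-- Two lattices `D` and `D'` whose time-frequency shifts commute, which satisfy the fundamental
identity with the constant `c`, and which both admit tight Gabor frames. -/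
structure DualPair (w : 𝓢(ℝ, ℂ)) (s : ℝ≥0) (D D' : AddSubgroup (Phase q)) (c : ℝ) : Prop where
  window_ne_zero : w ≠ 0
  pos : 0 < c
  memL1 : ∀ f ∈ M1 q w s, ∀ g ∈ M1 q w s, MemL1 D s fun ν => ⟪tfShift (ν : Phase q) g, f⟫_ℂ
  memL1' : ∀ f ∈ M1 q w s, ∀ g ∈ M1 q w s, MemL1 D' s fun ν => ⟪tfShift (ν : Phase q) g, f⟫_ℂ
  commute : ∀ ν ∈ D, ∀ μ ∈ D', Commute (tfShift ν) (tfShift μ)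
  identity : ∀ f ∈ M1 q w s, ∀ g ∈ M1 q w s, ∀ h ∈ M1 q w s,
    corr D f g h = (c : ℂ) • corr D' h g f
  frame : ∃ (n : ℕ) (g : Fin n → L2 q), (∀ i, g i ∈ M1 q w s) ∧
      ∀ f ∈ M1 q w s, ∑ i, corr D f (g i) (g i) = f
  frame' : ∃ (n : ℕ) (g : Fin n → L2 q), (∀ i, g i ∈ M1 q w s) ∧
      ∀ f ∈ M1 q w s, ∑ i, corr D' f (g i) (g i) = f

/-! ### Inner products over a pair of dual lattices -/

namespace DualPair

variable {D D' : AddSubgroup (Phase q)} {c : ℝ} (P : DualPair w s D D' c)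
include P

/-- Exchanging f and h in the fundamental identity exchanges the lattices and inverts c. Every fact
about the left inner product thereby becomes one about the right inner product. -/
lemma swap : DualPair w s D' D c⁻¹ where
  window_ne_zero := P.window_ne_zero
  pos := inv_pos.2 P.pos
  memL1 := P.memL1'
  memL1' := P.memL1
  commute ν hν μ hμ := (P.commute μ hμ ν hν).symm
  identity f hf g hg h hh := by
    have h0 : (c : ℂ) ≠ 0 := by exact_mod_cast P.pos.ne'
    rw [P.identity h hh g hg f hf, smul_smul, Complex.ofReal_inv, inv_mul_cancel₀ h0, one_smul]
  frame := P.frame'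
  frame' := P.frame

variable {S T : L2 q →L[ℂ] L2 q} {f g h : L2 q}

lemma commute_shift (hT : T ∈ tfAlgebra D' s) {ν : Phase q} (hν : ν ∈ D) :
    Commute (tfShift ν) T :=
  (commute_of_mem_tfAlgebra hT fun μ hμ => (P.commute ν hν μ hμ).symm).symm

lemma commute_algebra (hS : S ∈ tfAlgebra D s) (hT : T ∈ tfAlgebra D' s) : Commute S T :=
  commute_of_mem_tfAlgebra hS fun _ hν => P.commute_shift hT hν

lemma corr_adjoint (hT : T ∈ tfAlgebra D' s) (f g : L2 q) :
    corr D (T f) g = corr D f (star T g) :=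
  corr_star_apply fun _ hν => P.commute_shift (star_mem hT) hν

/-- The identity moves Tf from the coefficients to the argument of an operator over D', and that
operator commutes with T. -/
lemma corr_apply_left (hT : T ∈ tfAlgebra D s) (hf : f ∈ M1 q w s) (hg : g ∈ M1 q w s) :
    corr D (T f) g = T * corr D f g := by
  refine ext_M1 (s := s) P.window_ne_zero fun h hh => ?_
  have hc := P.commute_algebra hT (corr_mem_tfAlgebra (P.memL1' h hh g hg))
  rw [P.identity _ (tfAlgebra_apply_mem hT hf) g hg h hh, mul_apply_eq_comp,
    P.identity f hf g hg h hh, map_smul, ← mul_apply_eq_comp, ← mul_apply_eq_comp, hc.eq]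

/-- The identity rewrites the quadratic form as c times a sum over D' of |⟨h, π(ν)f⟩|². Positivity
and definiteness are read off from this. -/
lemma hasSum_reApplyInnerSelf (hf : f ∈ M1 q w s) (hh : h ∈ M1 q w s) :
    HasSum (fun ν : D' => c * ‖⟪tfShift (ν : Phase q) f, h⟫_ℂ‖ ^ 2)
      ((corr D f f).reApplyInnerSelf h) := by
  have h1 := (hasSum_inner_corr_self (P.memL1' h hh f hf)).mul_left c
  rw [ContinuousLinearMap.reApplyInnerSelf_apply, P.identity f hf f hf h hh, inner_re_symm,
    inner_smul_right]
  simpa using h1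

lemma isSelfAdjoint_corr_self (hf : f ∈ M1 q w s) : IsSelfAdjoint (corr D f f) :=
  star_corr (P.memL1 f hf f hf)

lemma isPositive_of_M1 (hT : IsSelfAdjoint T) (h : ∀ x ∈ M1 q w s, 0 ≤ T.reApplyInnerSelf x) :
    T.IsPositive := by
  refine ContinuousLinearMap.isPositive_def'.2 ⟨hT, fun x => ?_⟩
  have h1 : IsClosed {x | 0 ≤ T.reApplyInnerSelf x} :=
    isClosed_le continuous_const T.reApplyInnerSelf_continuous
  exact closure_minimal h h1 (dense_M1 P.window_ne_zero x)

lemma corr_self_nonneg (hf : f ∈ M1 q w s) : 0 ≤ corr D f f := by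
  rw [ContinuousLinearMap.nonneg_iff_isPositive]
  refine P.isPositive_of_M1 (P.isSelfAdjoint_corr_self hf) fun h hh => ?_
  have := P.pos
  exact (P.hasSum_reApplyInnerSelf hf hh).nonneg fun ν => by positivity

/-- With h = f, the term ν = 0 of the sum of squares is c‖f‖⁴, and every term of a vanishing sum of
nonnegative numbers vanishes. -/
lemma eq_zero_of_corr_self (hf : f ∈ M1 q w s) (h : corr D f f = 0) : f = 0 := by
  have h1 := P.hasSum_reApplyInnerSelf hf hf
  rw [h, ContinuousLinearMap.reApplyInnerSelf_apply, zero_apply, inner_zero_left, map_zero,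
    hasSum_zero_iff_of_nonneg fun ν => by have := P.pos; positivity] at h1
  have h2 := congrFun h1 0
  simpa [P.pos.ne', tfShift_zero] using h2

/-- If X = Y*Y with Y in the algebra, the operator is the inner product of Yf with itself. In
general the square root of X lies only in the norm closure; but by the fundamental identity the
quadratic form at a fixed h is a norm-continuous function of X, so its sign survives the limit. -/
lemma corr_conj_nonneg (hf : f ∈ M1 q w s) {X : L2 q →L[ℂ] L2 q} (hX : X ∈ tfAlgebra D' s)
    (h0 : 0 ≤ X) : 0 ≤ corr D (X f) f := by
  have hXf : X f ∈ M1 q w s := tfAlgebra_apply_mem hX hf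
  have hsa : star X = X := (ContinuousLinearMap.nonneg_iff_isPositive X).1 h0 |>.isSelfAdjoint
  rw [ContinuousLinearMap.nonneg_iff_isPositive]
  refine P.isPositive_of_M1 ?_ fun h hh => ?_
  · rw [IsSelfAdjoint, star_corr (P.memL1 _ hXf f hf), P.corr_adjoint hX, hsa]
  -- approximate the square root of `X` by elements of the algebra
  let Φ : (L2 q →L[ℂ] L2 q) → ℝ := fun Y => c * RCLike.re ⟪corr D' h f (Y f), h⟫_ℂ
  have hΦ : ∀ Y ∈ tfAlgebra D' s, (corr D (Y f) f).reApplyInnerSelf h = Φ Y := fun Y hY => by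
    rw [ContinuousLinearMap.reApplyInnerSelf_apply,
      P.identity _ (tfAlgebra_apply_mem hY hf) f hf h hh, inner_smul_left]
    simp [Φ]
  have hΦc : Continuous Φ := by
    have h1 : Continuous fun Y : L2 q →L[ℂ] L2 q => corr D' h f (Y f) :=
      (corr D' h f).continuous.comp (continuous_id.clm_apply continuous_const)
    have h2 : Continuous fun x : L2 q => ⟪x, h⟫_ℂ := continuous_id.inner continuous_const
    exact continuous_const.mul (Complex.continuous_re.comp (h2.comp h1))
  have hcl : ∀ Y ∈ (tfAlgebra D' s).topologicalClosure, 0 ≤ Φ (star Y * Y) := by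
    have hs : Continuous fun Y : L2 q →L[ℂ] L2 q => star Y * Y :=
      Continuous.mul continuous_star continuous_id
    have h1 : IsClosed {Y : L2 q →L[ℂ] L2 q | 0 ≤ Φ (star Y * Y)} :=
      isClosed_Ici.preimage (hΦc.comp hs)
    have h2 : (tfAlgebra D' s : Set (L2 q →L[ℂ] L2 q)) ⊆ {Y | 0 ≤ Φ (star Y * Y)} :=
      fun Y hY => by
        have hYf : Y f ∈ M1 q w s := tfAlgebra_apply_mem hY hf
        have e : corr D ((star Y * Y) f) f = corr D (Y f) (Y f) := by
          rw [mul_apply_eq_comp, P.corr_adjoint (star_mem hY), star_star]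
        rw [Set.mem_ofPred_eq, ← hΦ _ (mul_mem (star_mem hY) hY), e]
        exact ((ContinuousLinearMap.nonneg_iff_isPositive _).1 (P.corr_self_nonneg hYf)).2 h
    exact fun Y hY => closure_minimal h2 h1 hY
  obtain ⟨Y, hY, hYX⟩ := exists_star_mul_self_eq hX h0
  rw [hΦ X hX, ← hYX]
  exact hcl Y hY

/-- The difference of the two sides comes from the positive element ‖T‖² - T*T of the algebra, to
which `corr_conj_nonneg` applies. -/
lemma corr_bounded (hf : f ∈ M1 q w s) (hT : T ∈ tfAlgebra D' s) :
    corr D (T f) (T f) ≤ ((‖T‖ ^ 2 : ℝ) : ℂ) • corr D f f := by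
  set X := algebraMap ℂ (L2 q →L[ℂ] L2 q) ((‖T‖ ^ 2 : ℝ) : ℂ) - star T * T with hX
  have hXm : X ∈ tfAlgebra D' s :=
    sub_mem (algebraMap_mem _ _) (mul_mem (star_mem hT) hT)
  have hX0 : 0 ≤ X := sub_nonneg.2 (star_mul_self_le_norm_sq T)
  have h1 := P.corr_conj_nonneg hf hXm hX0
  have hm := fun {Y} (hY : Y ∈ tfAlgebra D' s) =>
    P.memL1 _ (tfAlgebra_apply_mem hY hf) f hf
  have h2 : corr D (T f) (T f) = corr D ((star T * T) f) f := by
    rw [mul_apply_eq_comp, P.corr_adjoint (star_mem hT), star_star]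
  have h3 : X f + (star T * T) f = ((‖T‖ ^ 2 : ℝ) : ℂ) • f := by
    rw [← add_apply, hX, sub_add_cancel, Algebra.algebraMap_eq_smul_one]
    rfl
  have h4 := corr_add_left (hm hXm) (hm (mul_mem (star_mem hT) hT))
  rw [h3, corr_smul_left] at h4
  rw [h2, h4]
  exact le_add_of_nonneg_left h1

/-- A tight frame over D' expands f as ∑ `corr D' f (g i) (g i)`. The fundamental identity reads
this as ∑ `corr D (g i) (g i)` applied to f, up to the factor c. Fullness follows from it. -/
lemma exists_sum_corr_eq_one : ∃ (n : ℕ) (g : Fin n → L2 q), (∀ i, g i ∈ M1 q w s) ∧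
    ∑ i, corr D (g i) (g i) = (c : ℂ) • (1 : L2 q →L[ℂ] L2 q) := by
  obtain ⟨n, g, hg, h⟩ := P.frame'
  refine ⟨n, g, hg, ext_M1 (s := s) P.window_ne_zero fun f hf => ?_⟩
  rw [sum_apply, smul_apply, one_apply_eq_self]
  conv_rhs => rw [← h f hf, Finset.smul_sum]
  exact Finset.sum_congr rfl fun i _ => P.identity _ (hg i) _ (hg i) f hf

end DualPair

end Duality

/-! ### Equivalence bimodules and Morita equivalence -/

section Bimodule

open MulOpposite

/-- The conjugate of a bimodule. -/
def Conjugate (V : Type) : Type := V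

namespace Conjugate

variable {A B V : Type} [Ring A] [StarRing A] [Ring B] [StarRing B] [AddCommGroup V]

/-- The vector of the original bimodule. -/
def val (f : Conjugate V) : V := f

instance : AddCommGroup (Conjugate V) := inferInstanceAs (AddCommGroup V)

instance [Module Bᵐᵒᵖ V] : Module B (Conjugate V) where
  smul b f := (op (star b) • f.val : V)
  one_smul f := (congrArg (fun b : B => op b • f.val) (star_one B)).trans (one_smul _ _)
  mul_smul b b' f := (congrArg (fun b : B => op b • f.val) (star_mul b b')).trans
    (mul_smul (op (star b)) (op (star b')) f.val)
  smul_zero b := smul_zero (A := V) (op (star b))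
  smul_add b f g := smul_add (A := V) (op (star b)) f g
  add_smul b b' f := (congrArg (fun b : B => op b • f.val) (star_add b b')).trans
    (add_smul (op (star b)) (op (star b')) f.val)
  zero_smul f := (congrArg (fun b : B => op b • f.val) (star_zero B)).trans
    (zero_smul Bᵐᵒᵖ f.val)

instance [Module A V] : Module Aᵐᵒᵖ (Conjugate V) where
  smul a f := (star a.unop • f.val : V)
  one_smul f := (congrArg (fun a : A => a • f.val) (star_one A)).trans (one_smul _ _)
  mul_smul a a' f := (congrArg (fun a : A => a • f.val) (star_mul a'.unop a.unop)).trans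
    (mul_smul (star a.unop) (star a'.unop) f.val)
  smul_zero a := smul_zero (A := V) (star a.unop)
  smul_add a f g := smul_add (A := V) (star a.unop) f g
  add_smul a a' f := (congrArg (fun a : A => a • f.val) (star_add a.unop a'.unop)).trans
    (add_smul (star a.unop) (star a'.unop) f.val)
  zero_smul f := (congrArg (fun a : A => a • f.val) (star_zero A)).trans
    (zero_smul A f.val)

lemma smul_val [Module Bᵐᵒᵖ V] (b : B) (f : Conjugate V) : (b • f).val = op (star b) • f.val := rfl

lemma op_smul_val [Module A V] (a : A) (f : Conjugate V) : (op a • f).val = star a • f.val := rfl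

end Conjugate

/-! ### From equivalence bimodules to Morita contexts -/

namespace IsEquivalenceBimodule

variable {A B V : Type} [Ring A] [StarRing A] [Algebra ℂ A] [PartialOrder A]
  [Norm A] [Ring B] [StarRing B] [Algebra ℂ B] [PartialOrder B] [Norm B]
  [AddCommGroup V] [Module ℂ V] [Module A V] [Module Bᵐᵒᵖ V] {lip : V → V → A} {rip : V → V → B}
  (E : IsEquivalenceBimodule lip rip)

include E

lemma lip_smul_right (a : A) (f g : V) : lip f (a • g) = lip f g * star a := by
  rw [← E.star_lip, E.lip_smul_left, star_mul, E.star_lip]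

lemma lip_add_right (f g h : V) : lip f (g + h) = lip f g + lip f h := by
  rw [← E.star_lip, E.lip_add_left, star_add, E.star_lip, E.star_lip]

lemma rip_smul_left (b : B) (f g : V) : rip (op b • f) g = star b * rip f g := by
  rw [← E.star_rip, E.rip_smul_right, star_mul, E.star_rip]

lemma rip_add_left (f g h : V) : rip (f + g) h = rip f h + rip g h := by
  rw [← E.star_rip, E.rip_add_right, star_add, E.star_rip, E.star_rip]

/-- Fullness makes 1 a linear combination of inner products, and the scalars are absorbed into the
first arguments. -/
lemma exists_sum_lip_eq_one :
    ∃ (n : ℕ) (f g : Fin n → V), ∑ i, lip (f i) (g i) = 1 := by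
  have h : (1 : A) ∈ Submodule.span ℂ (Set.range fun p : V × V => lip p.1 p.2) := by
    rw [E.lip_full]
    trivial
  obtain ⟨n, c, v, hv⟩ := Submodule.mem_span_set'.1 h
  choose p hp using fun i => (v i).2
  refine ⟨n, fun i => algebraMap ℂ A (c i) • (p i).1, fun i => (p i).2, ?_⟩
  rw [← hv]
  refine Finset.sum_congr rfl fun i _ => ?_
  rw [E.lip_smul_left, ← hp i, Algebra.smul_def]

lemma exists_sum_rip_eq_one :
    ∃ (n : ℕ) (f g : Fin n → V), ∑ i, rip (f i) (g i) = 1 := by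
  have h : (1 : B) ∈ Submodule.span ℂ (Set.range fun p : V × V => rip p.1 p.2) := by
    rw [E.rip_full]
    trivial
  obtain ⟨n, c, v, hv⟩ := Submodule.mem_span_set'.1 h
  choose p hp using fun i => (v i).2
  refine ⟨n, fun i => (p i).1, fun i => op (algebraMap ℂ B (c i)) • (p i).2, ?_⟩
  rw [← hv]
  refine Finset.sum_congr rfl fun i _ => ?_
  rw [E.rip_smul_right, ← hp i, Algebra.smul_def, Algebra.commutes]

/-- The Morita context given by an equivalence bimodule and its conjugate. -/
def moritaContext [StarModule ℂ A] [StarModule ℂ B] : MoritaContext ℂ A B V (Conjugate V) where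
  pq f g := lip f g.val
  qp g f := rip g.val f
  comm_left := E.smul_comm
  comm_right a b f := (E.smul_comm (star a) (star b) f.val).symm
  pq_add_left f f' g := E.lip_add_left f f' g.val
  pq_add_right f g g' := E.lip_add_right f g.val g'.val
  qp_add_left g g' f := E.rip_add_left g.val g'.val f
  qp_add_right g f f' := E.rip_add_right g.val f f'
  pq_smul_left a f g := E.lip_smul_left a f g.val
  pq_smul_right a f g := by rw [Conjugate.op_smul_val, E.lip_smul_right, star_star]
  pq_balanced b f g := E.lip_adjoint b f g.val
  qp_smul_left b g f := by rw [Conjugate.smul_val, E.rip_smul_left, star_star]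
  qp_smul_right b g f := E.rip_smul_right b g.val f
  qp_balanced a g f := by rw [Conjugate.op_smul_val, E.rip_adjoint, star_star]
  assoc_left f g h := E.lip_smul_eq_smul_rip f g.val h
  assoc_right g f h := by
    -- On the conjugate module the actions involve adjoints, so the law becomes the compatibility of
    -- the inner products for h, f, g.
    change op (star (rip g.val f)) • h.val = star (lip f h.val) • g.val
    rw [E.star_rip, E.star_lip, E.lip_smul_eq_smul_rip]
  pq_surj := E.exists_sum_lip_eq_one
  qp_surj := E.exists_sum_rip_eq_one
  central_left c f := (E.algebraMap_smul_right c f).trans (E.algebraMap_smul_left c f).symm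
  central_right c f := by
    change star (algebraMap ℂ A c) • f.val = op (star (algebraMap ℂ B c)) • f.val
    rw [← algebraMap_star_comm, ← algebraMap_star_comm, E.algebraMap_smul_left,
      E.algebraMap_smul_right]

theorem isMoritaEquivalent [StarModule ℂ A] [StarModule ℂ B] : IsMoritaEquivalent ℂ A B :=
  E.moritaContext.isMoritaEquivalent

/-- A reproducing formula gives a finite dual basis. -/
theorem finite_projective {n : ℕ} {g : Fin n → V} (h : ∀ f, f = ∑ i, lip f (g i) • g i) :
    Module.Finite A V ∧ Module.Projective A V := by
  let φ : (Fin n → A) →ₗ[A] V := Fintype.linearCombination A g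
  let ψ : V →ₗ[A] Fin n → A :=
    { toFun := fun f i => lip f (g i)
      map_add' := fun f f' => funext fun i => E.lip_add_left f f' (g i)
      map_smul' := fun a f => funext fun i => E.lip_smul_left a f (g i) }
  have hφ : φ ∘ₗ ψ = LinearMap.id := LinearMap.ext fun f => (h f).symm
  exact ⟨Module.Finite.of_surjective φ fun f => ⟨ψ f, LinearMap.congr_fun hφ f⟩,
    Module.Projective.of_split ψ φ hφ⟩

end IsEquivalenceBimodule

open scoped ComplexOrder in
lemma smul_le_smul_of_le {H : Type*} [NormedAddCommGroup H] [InnerProductSpace ℂ H]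
    {S T : H →L[ℂ] H} {c : ℝ} (hc : 0 ≤ c) (h : S ≤ T) : (c : ℂ) • S ≤ (c : ℂ) • T := by
  rw [ContinuousLinearMap.le_def, ← smul_sub]
  exact ((ContinuousLinearMap.le_def _ _).1 h).smul_of_nonneg (by exact_mod_cast hc)

variable {q : ℕ} [NeZero q] {w : 𝓢(ℝ, ℂ)} {s : ℝ≥0} {D D' : AddSubgroup (Phase q)} {c : ℝ}

lemma mem_ftAlgebra_iff {T : L2 q →L[ℂ] L2 q} : T ∈ ftAlgebra D s ↔ T ∈ tfAlgebra D s := by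
  rw [ftAlgebra, StarSubalgebra.copy_eq]

/-! ### The equivalence bimodule of a dual pair -/

namespace DualPair

variable (P : DualPair w s D D' c)

/-- The inner product `∑_{ν ∈ D} ⟨f, π(ν) g⟩ π(ν)`. -/
def lip (f g : M1 q w s) : tfAlgebra D s :=
  ⟨corr D (f : L2 q) g, corr_mem_tfAlgebra (P.memL1 f f.2 g g.2)⟩

/-- The inner product `c ∑_{ν ∈ D'} ⟨g, π°(ν) f⟩ π°(ν)`. -/
def rip (f g : M1 q w s) : (ftAlgebra D' s)ᵐᵒᵖ :=
  op ⟨(c : ℂ) • corr D' (g : L2 q) f, mem_ftAlgebra_iff.2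
    (SMulMemClass.smul_mem _ (corr_mem_tfAlgebra (P.memL1' g g.2 f f.2)))⟩

lemma coe_lip (f g : M1 q w s) : (P.lip f g : L2 q →L[ℂ] L2 q) = corr D (f : L2 q) g := rfl

lemma coe_rip (f g : M1 q w s) :
    ((P.rip f g).unop : L2 q →L[ℂ] L2 q) = (c : ℂ) • corr D' (g : L2 q) f := rfl

/-- The shifts π and π° differ by a phase, which occurs once in the operator and once, conjugated,
in the coefficient. The sums over π and over π° therefore agree term by term. -/
lemma hasSum_rip (f g : M1 q w s) :
    HasSum (fun ν : D' => ((c : ℂ) * ⟪ftShift (ν : Phase q) f, (g : L2 q)⟫_ℂ) •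
      ftShift (ν : Phase q)) ((P.rip f g).unop : L2 q →L[ℂ] L2 q) := by
  rw [coe_rip]
  refine ((hasSum_corr (P.memL1' g g.2 f f.2)).const_smul (c : ℂ)).congr_fun fun ν => ?_
  rw [ftShift_eq, Circle.smul_def, smul_apply, inner_smul_left, smul_smul, smul_smul]
  congr 1
  have hz := Complex.normSq_eq_conj_mul_self
    (z := (((pairing (ν : Phase q).1 (ν : Phase q).2)⁻¹ : Circle) : ℂ))
  rw [Circle.normSq_coe, Complex.ofReal_one] at hz
  linear_combination (-(c : ℂ) * ⟪tfShift (ν : Phase q) (f : L2 q), (g : L2 q)⟫_ℂ) * hz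

include P in
lemma memL1_rip (f g : M1 q w s) :
    MemL1 D' s fun ν => (c : ℂ) * ⟪ftShift (ν : Phase q) f, (g : L2 q)⟫_ℂ := by
  refine ((P.memL1' g g.2 f f.2).mul_left ‖(c : ℂ)‖).congr fun ν => ?_
  simp only
  rw [ftShift_eq, Circle.smul_def, smul_apply, inner_smul_left, norm_mul, norm_mul,
    RCLike.norm_conj, Circle.norm_coe, one_mul, mul_assoc]

lemma ext_rip {S T : (ftAlgebra D' s)ᵐᵒᵖ}
    (h : (S.unop : L2 q →L[ℂ] L2 q) = (T.unop : L2 q →L[ℂ] L2 q)) : S = T :=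
  unop_injective (Subtype.ext h)

lemma rip_smul_right (b : (ftAlgebra D' s)ᵐᵒᵖ) (f g : M1 q w s) :
    P.rip f (op b • g) = P.rip f g * b := by
  refine ext_rip ?_
  have h := P.swap.corr_apply_left (mem_ftAlgebra_iff.1 b.unop.2) g.2 f.2
  refine (congrArg ((c : ℂ) • ·) h).trans ?_
  exact (mul_smul_comm (c : ℂ) (b.unop : L2 q →L[ℂ] L2 q) (corr D' (g : L2 q) f)).symm

/-- Multiplying c = ∑ `lip (g i) (g i)` by a on the left writes a as c⁻¹ ∑ `lip (a • g i) (g i)`. -/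
theorem span_lip : Submodule.span ℂ (Set.range fun p : M1 q w s × M1 q w s => P.lip p.1 p.2)
    = ⊤ := by
  refine eq_top_iff.2 fun a _ => ?_
  obtain ⟨n, g, hg, h⟩ := P.exists_sum_corr_eq_one
  have hc : (c : ℂ) ≠ 0 := by exact_mod_cast P.pos.ne'
  let g' : Fin n → M1 q w s := fun i => ⟨g i, hg i⟩
  have e : a = ∑ i, (c : ℂ)⁻¹ • P.lip (a • g' i) (g' i) := by
    refine Subtype.ext ?_
    rw [AddSubmonoidClass.coe_finsetSum]
    have h1 : ∀ i, (((c : ℂ)⁻¹ • P.lip (a • g' i) (g' i) : tfAlgebra D s) : L2 q →L[ℂ] L2 q)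
        = (c : ℂ)⁻¹ • ((a : L2 q →L[ℂ] L2 q) * corr D (g i) (g i)) := fun i =>
      congrArg ((c : ℂ)⁻¹ • ·) (P.corr_apply_left a.2 (hg i) (hg i))
    rw [Finset.sum_congr rfl fun i _ => h1 i, ← Finset.smul_sum, ← Finset.mul_sum, h,
      mul_smul_comm, inv_smul_smul₀ hc, mul_one]
  rw [e]
  exact Submodule.sum_mem _ fun i _ => Submodule.smul_mem _ _
    (Submodule.subset_span ⟨(a • g' i, g' i), rfl⟩)

theorem span_rip : Submodule.span ℂ (Set.range fun p : M1 q w s × M1 q w s => P.rip p.1 p.2)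
    = ⊤ := by
  refine eq_top_iff.2 fun b _ => ?_
  obtain ⟨n, g, hg, h⟩ := P.swap.exists_sum_corr_eq_one
  have hc : (c : ℂ) ≠ 0 := by exact_mod_cast P.pos.ne'
  let g' : Fin n → M1 q w s := fun i => ⟨g i, hg i⟩
  have e : ∑ i, P.rip (g' i) (g' i) = 1 := by
    refine ext_rip ?_
    rw [Finset.unop_sum, AddSubmonoidClass.coe_finsetSum]
    have h1 : ∀ i, ((P.rip (g' i) (g' i)).unop : L2 q →L[ℂ] L2 q)
        = (c : ℂ) • corr D' (g i) (g i) := fun i => rfl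
    rw [Finset.sum_congr rfl fun i _ => h1 i, ← Finset.smul_sum, h, Complex.ofReal_inv,
      smul_inv_smul₀ hc]
    rfl
  have e' : b = ∑ i, P.rip (g' i) (op b • g' i) := by
    simp only [P.rip_smul_right]
    rw [← Finset.sum_mul, e, one_mul]
  rw [e']
  exact Submodule.sum_mem _ fun i _ => Submodule.subset_span ⟨(g' i, op b • g' i), rfl⟩

theorem isEquivalenceBimodule : IsEquivalenceBimodule P.lip P.rip where
  algebraMap_smul_left c f := rfl
  algebraMap_smul_right c f := rfl
  smul_comm a b f := Subtype.ext (DFunLike.congr_fun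
    (P.commute_algebra a.2 (mem_ftAlgebra_iff.1 b.unop.2)).eq.symm (f : L2 q))
  lip_add_left f g h := Subtype.ext (corr_add_left (P.memL1 f f.2 h h.2) (P.memL1 g g.2 h h.2))
  lip_smul_left a f g := Subtype.ext (P.corr_apply_left a.2 f.2 g.2)
  star_lip f g := Subtype.ext (star_corr (P.memL1 f f.2 g g.2))
  lip_self_nonneg f := P.corr_self_nonneg f.2
  lip_self_eq_zero f := by
    refine ⟨fun h => Subtype.ext (P.eq_zero_of_corr_self f.2 (congrArg Subtype.val h)), ?_⟩
    rintro rfl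
    refine Subtype.ext ?_
    rw [coe_lip]
    simp [corr]
  rip_add_right f g h := ext_rip ((congrArg ((c : ℂ) • ·)
    (corr_add_left (P.memL1' g g.2 f f.2) (P.memL1' h h.2 f f.2))).trans (smul_add _ _ _))
  rip_smul_right := P.rip_smul_right
  star_rip f g := by
    refine ext_rip ((star_smul (c : ℂ) (corr D' (g : L2 q) f)).trans ?_)
    rw [star_corr (P.memL1' g g.2 f f.2), coe_rip, Complex.star_def, Complex.conj_ofReal]
  rip_self_nonneg f := by
    have h := smul_le_smul_of_le P.pos.le (P.swap.corr_self_nonneg f.2)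
    rwa [smul_zero] at h
  rip_self_eq_zero f := by
    have hc : (c : ℂ) ≠ 0 := by exact_mod_cast P.pos.ne'
    constructor
    · intro h
      have h1 : (c : ℂ) • corr D' (f : L2 q) f = 0 :=
        congrArg (fun T : (ftAlgebra D' s)ᵐᵒᵖ => (T.unop : L2 q →L[ℂ] L2 q)) h
      exact Subtype.ext (P.swap.eq_zero_of_corr_self f.2 ((smul_eq_zero.1 h1).resolve_left hc))
    · rintro rfl
      refine ext_rip ?_
      rw [coe_rip]
      simp [corr]
  lip_adjoint b f g := Subtype.ext (P.corr_adjoint (mem_ftAlgebra_iff.1 b.unop.2) f g)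
  rip_adjoint a f g := by
    have h := P.swap.corr_adjoint (star_mem a.2) (g : L2 q) f
    rw [star_star] at h
    exact ext_rip (congrArg ((c : ℂ) • ·) h.symm)
  lip_bounded b f := P.corr_bounded f.2 (mem_ftAlgebra_iff.1 b.unop.2)
  rip_bounded a f := by
    have h := smul_le_smul_of_le P.pos.le (P.swap.corr_bounded f.2 a.2)
    rw [smul_comm] at h
    exact h
  lip_smul_eq_smul_rip f g h := Subtype.ext (P.identity f f.2 g g.2 h h.2)
  lip_full := P.span_lip
  rip_full := P.span_rip

end DualPair

end Bimodule

/-! ### Complex conjugation -/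

section Conjugation

open MulOpposite

variable {q : ℕ}

/-- Complex conjugation on `L²(ℝ × ℤ_q)`. -/
def conjL2 : L2 q →SL[starRingEnd ℂ] L2 q :=
  LinearMap.mkContinuous
    { toFun := fun f => star f
      map_add' := fun f g => by
        refine Lp.ext ?_
        filter_upwards [Lp.coeFn_star (f + g), Lp.coeFn_star f, Lp.coeFn_star g,
          Lp.coeFn_add f g, Lp.coeFn_add (star f) (star g)] with y h1 h2 h3 h4 h5
        rw [h1, h5, Pi.add_apply, h2, h3, Pi.star_apply, h4, Pi.add_apply, star_add]
        rfl
      map_smul' := fun c f => by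
        refine Lp.ext ?_
        filter_upwards [Lp.coeFn_star (c • f), Lp.coeFn_star f, Lp.coeFn_smul c f,
          Lp.coeFn_smul (starRingEnd ℂ c) (star f)] with y h1 h2 h3 h4
        rw [h1, h4, Pi.smul_apply, h2, Pi.star_apply, h3, Pi.smul_apply, star_smul]
        rfl }
    1 (fun f => by
      rw [one_mul]
      refine Lp.norm_le_norm_of_ae_le ?_
      filter_upwards [Lp.coeFn_star f] with y h
      exact (congrArg norm h).trans_le (norm_star _).le)

lemma norm_conjL2_le (f : L2 q) : ‖conjL2 f‖ ≤ ‖f‖ := by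
  refine Lp.norm_le_norm_of_ae_le ?_
  filter_upwards [Lp.coeFn_star f] with y h
  exact (congrArg norm h).trans_le (norm_star _).le

/-- Conjugation of an operator by complex conjugation. -/
def conjOp (T : L2 q →L[ℂ] L2 q) : L2 q →L[ℂ] L2 q := (conjL2.comp T).comp conjL2

lemma conjOp_apply (T : L2 q →L[ℂ] L2 q) (f : L2 q) : conjOp T f = star (T (star f)) := rfl

lemma conjOp_conjOp (T : L2 q →L[ℂ] L2 q) : conjOp (conjOp T) = T :=
  ContinuousLinearMap.ext fun f => by simp only [conjOp_apply, star_star]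

lemma conjOp_mul (S T : L2 q →L[ℂ] L2 q) : conjOp (S * T) = conjOp S * conjOp T :=
  ContinuousLinearMap.ext fun f => by
    simp only [conjOp_apply, mul_apply_eq_comp, star_star]

lemma conjOp_add (S T : L2 q →L[ℂ] L2 q) : conjOp (S + T) = conjOp S + conjOp T :=
  ContinuousLinearMap.ext fun f => map_add conjL2 (S (star f)) (T (star f))

lemma conjOp_smul (c : ℂ) (T : L2 q →L[ℂ] L2 q) : conjOp (c • T) = (starRingEnd ℂ) c • conjOp T :=
  ContinuousLinearMap.ext fun f => conjL2.map_smulₛₗ c (T (star f))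

lemma conjOp_one : conjOp (1 : L2 q →L[ℂ] L2 q) = 1 :=
  ContinuousLinearMap.ext fun f => star_star f

lemma norm_conjOp_le (T : L2 q →L[ℂ] L2 q) : ‖conjOp T‖ ≤ ‖T‖ :=
  ContinuousLinearMap.opNorm_le_bound _ (norm_nonneg T) fun f =>
    (norm_conjL2_le _).trans ((T.le_opNorm _).trans
      (mul_le_mul_of_nonneg_left (norm_conjL2_le f) (norm_nonneg T)))

lemma hasSum_conjOp {ι : Type*} {F : ι → L2 q →L[ℂ] L2 q} {T : L2 q →L[ℂ] L2 q}
    (h : HasSum F T) : HasSum (fun i => conjOp (F i)) (conjOp T) := by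
  let Φ : (L2 q →L[ℂ] L2 q) →+ (L2 q →L[ℂ] L2 q) := AddMonoidHom.mk' conjOp conjOp_add
  have hΦ : Continuous Φ := AddMonoidHomClass.continuous_of_bound Φ 1 fun T => by
    rw [one_mul]
    exact norm_conjOp_le T
  exact h.map Φ hΦ

variable [NeZero q]

lemma conj_pairing (y ζ : TimeGroup q) : (starRingEnd ℂ) (pairing y ζ : ℂ) = (pairing y (-ζ) : ℂ) := by
  have h := pairing_add_right y ζ (-ζ)
  rw [add_neg_cancel, pairing_zero_right] at h
  rw [← Circle.coe_inv_eq_conj, inv_eq_of_mul_eq_one_right h.symm]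

/-- Complex conjugation keeps translations and inverts modulations. A product lattice, being stable
under (y, ζ) ↦ (y, -ζ), is therefore preserved. -/
lemma conjOp_tfShift (ν : Phase q) : conjOp (tfShift ν) = tfShift (ν.1, -ν.2) := by
  refine ContinuousLinearMap.ext fun f => Lp.ext ?_
  rw [conjOp_apply]
  filter_upwards [Lp.coeFn_star (tfShift ν (star f)),
    tfShift_coe_of_ae_eq ν (Lp.coeFn_star f), tfShift_coe (ν.1, -ν.2) f] with y h1 h2 h3
  rw [h1, h3, Pi.star_apply, h2, Pi.star_apply, star_mul', star_star, ← conj_pairing]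
  rfl

variable {s : ℝ≥0} {H K : AddSubgroup (TimeGroup q)}

/-- The reflection `(y, ζ) ↦ (y, -ζ)`. -/
def reflection (H K : AddSubgroup (TimeGroup q)) : H.prod K ≃ H.prod K :=
  ((prodEquiv H K).symm.trans ((Equiv.refl H).prodCongr (Equiv.neg K))).trans (prodEquiv H K)

omit [NeZero q] in
lemma coe_reflection (ν : H.prod K) :
    (reflection H K ν : Phase q) = ((ν : Phase q).1, -(ν : Phase q).2) := rfl

lemma conjOp_mem_tfAlgebra {T : L2 q →L[ℂ] L2 q} (hT : T ∈ tfAlgebra (H.prod K) s) :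
    conjOp T ∈ tfAlgebra (H.prod K) s := by
  obtain ⟨a, ha, hT⟩ := hT
  have hr : ∀ ν, reflection H K (reflection H K ν) = ν := fun ν => by
    refine Subtype.ext ?_
    simp [coe_reflection]
  refine ⟨fun ν => (starRingEnd ℂ) (a (reflection H K ν)), ?_, ?_⟩
  · refine ((reflection H K).summable_iff.2 ha).congr fun ν => ?_
    simp only [Function.comp, RCLike.norm_conj, coe_reflection]
    congr 1
    simp [weight]
  · refine ((reflection H K).hasSum_iff.2 (hasSum_conjOp hT)).congr_fun fun ν => ?_
    simp only [Function.comp, conjOp_smul, conjOp_tfShift]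
    rw [← coe_reflection, hr]

/-- The algebra of frequency-time shifts over a product lattice is isomorphic to its opposite. -/
def ftAlgebraOpEquiv (H K : AddSubgroup (TimeGroup q)) (s : ℝ≥0) :
    ftAlgebra (H.prod K) s ≃ₐ[ℂ] (ftAlgebra (H.prod K) s)ᵐᵒᵖ where
  -- The adjoint is conjugate-linear and reverses products; conjugation by complex conjugation is
  -- conjugate-linear and preserves them. The composite is linear and reverses products.
  toFun T := op ⟨conjOp (star (T : L2 q →L[ℂ] L2 q)), mem_ftAlgebra_iff.2
    (conjOp_mem_tfAlgebra (star_mem (mem_ftAlgebra_iff.1 T.2)))⟩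
  invFun T := ⟨star (conjOp (T.unop : L2 q →L[ℂ] L2 q)), mem_ftAlgebra_iff.2
    (star_mem (conjOp_mem_tfAlgebra (mem_ftAlgebra_iff.1 T.unop.2)))⟩
  left_inv T := Subtype.ext ((congrArg star (conjOp_conjOp _)).trans (star_star _))
  right_inv T := unop_injective (Subtype.ext
    ((congrArg conjOp (star_star _)).trans (conjOp_conjOp _)))
  map_mul' S T := unop_injective (Subtype.ext
    ((congrArg conjOp (star_mul _ _)).trans (conjOp_mul _ _)))
  map_add' S T := unop_injective (Subtype.ext
    ((congrArg conjOp (star_add _ _)).trans (conjOp_add _ _)))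
  commutes' c := by
    refine unop_injective (Subtype.ext ?_)
    change conjOp (star (algebraMap ℂ (L2 q →L[ℂ] L2 q) c)) = algebraMap ℂ (L2 q →L[ℂ] L2 q) c
    rw [Algebra.algebraMap_eq_smul_one, star_smul, star_one, conjOp_smul, conjOp_one]
    simp

end Conjugation

/-! ### The lattices `Λ × Γ` and `Γ^⊥ × Λ^⊥` -/

section Main

variable {q : ℕ} [NeZero q] {w : 𝓢(ℝ, ℂ)} {s : ℝ≥0} {α β : ℝ} {r t : ℕ}

/-- The adjoint lattice is a lattice of the same kind with steps (qβ)⁻¹ and (qα)⁻¹, so the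
summability and frame theorems apply to it as well. -/
theorem dualPair (hw : w ≠ 0) (hr : r.Coprime q) (ht : t.Coprime q) (hα : α ≠ 0) (hβ : β ≠ 0) :
    DualPair w s (gaborLattice q r t α β) (adjointLattice q r t α β) (q * |α * β|)⁻¹ := by
  have hq : (0 : ℝ) < q := by exact_mod_cast Nat.pos_of_ne_zero (NeZero.ne q)
  obtain ⟨r', t', e1, e2, -, -⟩ := exists_adjointLattice_eq (q := q) hr ht hα hβ
  have e : adjointLattice q r t α β = gaborLattice q t' r' (q * β)⁻¹ (q * α)⁻¹ := by
    rw [adjointLattice, e1, e2]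
  have hβ' := inv_ne_zero (mul_ne_zero hq.ne' hβ)
  have hα' := inv_ne_zero (mul_ne_zero hq.ne' hα)
  exact
  { window_ne_zero := hw
    pos := inv_pos.2 (mul_pos hq (abs_pos.2 (mul_ne_zero hα hβ)))
    memL1 := fun f hf g hg => memL1_inner hw r t hα hβ hf hg
    memL1' := fun f hf g hg => by
      rw [e]
      exact memL1_inner hw t' r' hβ' hα' hf hg
    commute := fun ν hν μ hμ => tfShift_commute hν hμ
    identity := fun f hf g hg h hh => by
      rw [Complex.ofReal_inv]
      exact fundamental_identity hw hr ht hα hβ hf hg hh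
    frame := exists_tightFrame hw r t hα hβ
    frame' := by
      rw [e]
      exact exists_tightFrame hw t' r' hβ' hα' }

end Main

end GaborTorus

end

theorem mainTheorem6 (q : ℕ) [NeZero q] (r t : ℕ) (hr : r < q) (hrq : r.Coprime q)
    (ht : t < q) (htq : t.Coprime q) (α β : ℝ) (hα : α ≠ 0) (hβ : β ≠ 0) (s : NNReal)
    (w : SchwartzMap ℝ ℂ) (hw : w ≠ 0) :
    ∃ (lip : GaborTorus.M1 q w s → GaborTorus.M1 q w s → GaborTorus.algA q r t α β s)
      (rip : GaborTorus.M1 q w s → GaborTorus.M1 q w s → (GaborTorus.algAo q r t α β s)ᵐᵒᵖ),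
      (∀ f g : GaborTorus.M1 q w s, GaborTorus.IsLeftInner (f : GaborTorus.L2 q) g (lip f g)) ∧
      (∀ f g : GaborTorus.M1 q w s, GaborTorus.IsRightInner (f : GaborTorus.L2 q) g (rip f g).unop) ∧
      GaborTorus.IsEquivalenceBimodule lip rip ∧
      IsMoritaEquivalent ℂ (GaborTorus.algA q r t α β s) (GaborTorus.algAo q r t α β s)ᵐᵒᵖ ∧
      IsMoritaEquivalent ℂ (GaborTorus.algA q r t α β s) (GaborTorus.algAo q r t α β s) ∧
      Module.Finite (GaborTorus.algA q r t α β s) (GaborTorus.M1 q w s) ∧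
      Module.Projective (GaborTorus.algA q r t α β s) (GaborTorus.M1 q w s) ∧
      ∃ (n : ℕ) (g : Fin n → GaborTorus.M1 q w s),
        ∀ f : GaborTorus.M1 q w s, f = ∑ i, lip f (g i) • g i := by
  have P := GaborTorus.dualPair (s := s) hw hrq htq hα hβ
  have E := P.isEquivalenceBimodule
  have hM := E.isMoritaEquivalent
  obtain ⟨n, g, hg, h⟩ := P.frame
  have hrep : ∀ f : GaborTorus.M1 q w s, f = ∑ i, P.lip f ⟨g i, hg i⟩ • (⟨g i, hg i⟩ :
      GaborTorus.M1 q w s) := fun f => Subtype.ext <| by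
    rw [AddSubmonoidClass.coe_finsetSum]
    exact (h f f.2).symm
  have hproj := E.finite_projective hrep
  -- The bimodule yields Morita equivalence with the opposite algebra, in the order of right
  -- actions; the isomorphism given by complex conjugation removes the opposite.
  refine ⟨P.lip, P.rip, fun f g => ⟨P.memL1 f f.2 g g.2,
    GaborTorus.hasSum_corr (P.memL1 f f.2 g g.2)⟩,
    fun f g => ?_, E, hM, IsMoritaEquivalent.trans ℂ hM (IsMoritaEquivalent.of_algEquiv ℂ
      (GaborTorus.ftAlgebraOpEquiv _ _ s).symm),
    hproj.1, hproj.2, n, _, hrep⟩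
  have h1 := P.memL1_rip f g
  have h2 := P.hasSum_rip f g
  rw [Complex.ofReal_inv] at h1 h2
  exact ⟨h1, h2⟩
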